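/- **Setup.** Let $p$ be a prime, and put $\epsilon=1$ if $p\neq 2$, $\epsilon=2$ if $p=2$. Let $(L_v)_v$ be a finite family of finite extensions of $\mathbb{Q}_p$ with rings of integers $\mathcal{O}_v$ (for example the completions at the places $v\mid p$ of a number field), and for each $v$ let $\mathbf{H}_v$ be a split connected reductive group over $\mathcal{O}_v$ with a split maximal torus $\mathbf{T}_v$ and a Borel subgroup $\mathbf{B}_v\supseteq \mathbf{T}_v$; let $\mathbf{N}_v$ be the unipotent radical of $\mathbf{B}_v$ and $\overline{\mathbf{N}}_v$ that of the opposite Borel subgroup. Put $G=\prod_v\mathbf{H}_v(L_v)$, $G_0=\prod_v\mathbf{H}_v(\mathcal{O}_v)$, $T=\prod_v\mathbf{T}_v(L_v)$, $T_0=\prod_v\mathbf{T}_v(\mathcal{O}_v)$, $N_0=\prod_v\mathbf{N}_v(\mathcal{O}_v)$, $B_0=T_0N_0$; for $s\geq 1$ let $T_s\subseteq T_0$ and $\overline{N}_s\subseteq\prod_v\overline{\mathbf{N}}_v(\mathcal{O}_v)$ be the kernels of reduction modulo $p^s$; let $I\subseteq G_0$ be the preimage of $\prod_v\mathbf{B}_v(\mathcal{O}_v/p)$.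 Choose a homomorphism $T\to T_0$ splitting the inclusion $T_0\subseteq T$, with kernel $\Sigma$, and put $$\Sigma^+=\{t\in\Sigma : t\overline{N}_1t^{-1}\subseteq\overline{N}_1\},\qquad \Sigma^{cpt}=\{t\in\Sigma : t\overline{N}_1t^{-1}\subseteq\overline{N}_2\}.$$ Let $R$ be a Banach--Tate $\mathbb{Z}_p$-algebra: a complete commutative ring with a submultiplicative non-archimedean norm, $|1|=1$, which has a unit $\varpi$ with $|\varpi|<1$ and $|\varpi x|=|\varpi||x|$ for all $x$, together with a norm-decreasing homomorphism $\mathbb{Z}_p\to R$. ("Norm-decreasing" means that norms do not increase.) Let $\kappa:T_0\to R^\times$ be a continuous character to which the norm is adapted: $|\kappa(t)|\leq 1$ for $t\in T_0$ and $|\kappa(t)-1|<1$ for $t\in T_\epsilon$. Let $r_\kappa$ be the minimal $r\in[1/p,1)$ with $|\kappa(t)-1|\leq r$ for all $t\in T_\epsilon$. Extend $\kappa$ to $B_0$ by making it trivial on $N_0$, and let $\mathcal{A}_\kappa\subseteq\mathcal{C}(I,R)$ be the module of continuous functions with $f(gb)=\kappa(b)f(g)$ for $g\in I$, $b\in B_0$,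 and $\mathcal{D}_\kappa=\mathrm{Hom}_{R,cts}(\mathcal{A}_\kappa,R)$. Let $g_1,\dots,g_d$ be a minimal ordered set of topological generators of $\overline{N}_\epsilon$, and choose representatives $h_c$ of the cosets $c\in\overline{N}_1/\overline{N}_\epsilon$. **Claim.** (0) Restriction of functions is a topological isomorphism $\mathcal{A}_\kappa\cong\mathcal{C}(\overline{N}_1,R)$, and there is a homeomorphism $\mathbb{Z}_p^d\cong\overline{N}_\epsilon$, $x\mapsto g_1^{x_1}\cdots g_d^{x_d}$. By the first isomorphism, each $t\in\Sigma^+$ acts on $\mathcal{D}_\kappa$, dually to the action $(f\cdot t)(n)=f(tnt^{-1})$ on $\mathcal{C}(\overline{N}_1,R)$. For $\mu\in\mathcal{D}_\kappa$, regarded as a continuous functional on $\mathcal{C}(\overline{N}_1,R)$, a coset $c$ and $\alpha\in\mathbb{Z}_{\geq 0}^d$, let $d_{c,\alpha}(\mu)\in R$ be the value of $\mu$ at the function that is $h_cg_1^{x_1}\cdots g_d^{x_d}\mapsto\prod_i\binom{x_i}{\alpha_i}$ on $c$ and $0$ outside $c$; so $\mu=\sum_c[h_c]\sum_\alpha d_{c,\alpha}(\mu)\prod_i([g_i]-1)^{\alpha_i}$.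 For $r\in[1/p,1)$ put $\|\mu\|_r=\sup_{c,\alpha}|d_{c,\alpha}(\mu)|\,r^{|\alpha|}$, and let $\mathcal{D}_\kappa^r$ be the completion of $\mathcal{D}_\kappa$ for $\|-\|_r$. A continuous $R$-linear map between normed $R$-modules is compact if it is a limit in operator norm of continuous $R$-linear maps whose images lie in finitely generated submodules. Then for every $r\in[1/p,1)$ with $r\geq r_\kappa$: 1. for $t\in\Sigma^+$, the action of $t$ on $\mathcal{D}_\kappa$ is norm-decreasing for $\|-\|_r$, and hence extends uniquely to a continuous $R$-linear map $\mathcal{D}_\kappa^r\to\mathcal{D}_\kappa^r$; 2. the identity of $\mathcal{D}_\kappa$ extends to an injective, norm-decreasing, compact $R$-linear map $\mathcal{D}_\kappa^{r^{1/p}}\hookrightarrow\mathcal{D}_\kappa^r$; 3. for $t\in\Sigma^{cpt}$, the action of $t$ on $\mathcal{D}_\kappa^r$ is compact, and it is the composition of a norm-decreasing continuous $R$-linear map $\mathcal{D}_\kappa^r\to\mathcal{D}_\kappa^{r^{1/p}}$ with the inclusion of 2. -/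

import Mathlib

open scoped LaurentPolynomial Polynomial

universe u v

noncomputable section

namespace OverconvergentDistributions

/-! ## Affine group schemes and their points -/

/-- The group `H(S)` of `S`-valued points of the affine group scheme `H = Spec A` over `O`, where
`A` is a commutative Hopf algebra over `O`. -/
def Points (O : Type u) [CommRing O] (A : Type u) [CommRing A] [HopfAlgebra O A]
    (S : Type u) [CommRing S] [Algebra O S] : Type u :=
  WithConv (A →ₐ[O] S)

namespace Points

section Basic

variable {O : Type u} [CommRing O] {A : Type u} [CommRing A] [HopfAlgebra O A]
  {S : Type u} [CommRing S] [Algebra O S] {S' : Type u} [CommRing S'] [Algebra O S']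

/-- The algebra homomorphism `A → S` underlying a point. -/
def hom (x : Points O A S) : A →ₐ[O] S := WithConv.ofConv x

/-- The point attached to an algebra homomorphism `A → S`. -/
def mk (x : A →ₐ[O] S) : Points O A S := WithConv.toConv x

theorem ext_hom {x y : Points O A S} (h : x.hom = y.hom) : x = y := WithConv.ofConv_injective h

@[simp] theorem hom_mk (x : A →ₐ[O] S) : (mk x).hom = x := rfl

/-- The group law is dual to the comultiplication of `A` (convolution). -/
instance : Monoid (Points O A S) := inferInstanceAs (Monoid (WithConv (A →ₐ[O] S)))

theorem mul_hom_apply (x y : Points O A S) (a : A) :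
    (x * y).hom a = ∑ i ∈ (Coalgebra.Repr.arbitrary O a).index,
      x.hom ((Coalgebra.Repr.arbitrary O a).left i) *
        y.hom ((Coalgebra.Repr.arbitrary O a).right i) := by
  have h := AlgHom.convMul_apply (R := O) (A := S) (C := A) x y a
  refine Eq.trans (b := Algebra.TensorProduct.lift x.hom y.hom (fun _ _ => .all ..)
    (Coalgebra.comul (R := O) a)) h ?_
  rw [← (Coalgebra.Repr.arbitrary O a).eq, map_sum]
  simp

theorem one_hom_apply (a : A) :
    (1 : Points O A S).hom a = algebraMap O S (Coalgebra.counit a) :=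
  AlgHom.convOne_apply (R := O) (A := S) (C := A) a

/-- Inversion is dual to the antipode of `A`. -/
instance : Group (Points O A S) where
  inv x := mk (x.hom.comp (HopfAlgebra.antipodeAlgHom O A))
  inv_mul_cancel x := by
    apply ext_hom
    ext a
    rw [mul_hom_apply, one_hom_apply, ← AlgHom.commutes x.hom,
      ← HopfAlgebra.sum_antipode_mul_eq_algebraMap_counit (Coalgebra.Repr.arbitrary O a), map_sum]
    simp

/-- Functoriality of points: `H(S) → H(S')` for an `O`-algebra homomorphism `S → S'`. -/
def map (φ : S →ₐ[O] S') : Points O A S →* Points O A S' where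
  toFun x := mk (φ.comp x.hom)
  map_one' := by
    apply ext_hom
    ext a
    simp [one_hom_apply]
  map_mul' x y := by
    apply ext_hom
    ext a
    simp [mul_hom_apply]

@[simp] theorem map_hom (φ : S →ₐ[O] S') (x : Points O A S) : (map φ x).hom = φ.comp x.hom := rfl

/-- Functoriality of points in the group scheme, for a homomorphism of Hopf algebras. -/
def comap {C : Type u} [CommRing C] [HopfAlgebra O C] (π : A →ₐc[O] C) :
    Points O C S →* Points O A S where
  toFun x := mk (x.hom.comp (π : A →ₐ[O] C))
  map_one' := by
    apply ext_hom
    ext a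
    simp [one_hom_apply]
  map_mul' x y := by
    apply ext_hom
    exact AlgHom.convMul_comp_bialgHom_distrib (R := O) (C := C) (B := A) (A := S) x y π

/-- The topology on `H(S)` induced by that of `S`: the coarsest one for which all regular functions
`x ↦ x(a)`, `a ∈ A`, are continuous. -/
instance [TopologicalSpace S] : TopologicalSpace (Points O A S) :=
  TopologicalSpace.induced (fun x (a : A) => x.hom a) inferInstance

theorem continuous_hom_apply [TopologicalSpace S] (a : A) :
    Continuous fun x : Points O A S => x.hom a :=
  (continuous_apply a).comp continuous_induced_dom

theorem continuous_of_hom_apply [TopologicalSpace S] {X : Type*} [TopologicalSpace X]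
    {f : X → Points O A S} (h : ∀ a, Continuous fun x => (f x).hom a) : Continuous f :=
  continuous_induced_rng.2 (continuous_pi h)

instance [TopologicalSpace S] [IsTopologicalRing S] : ContinuousMul (Points O A S) where
  continuous_mul := by
    refine continuous_of_hom_apply fun a => ?_
    simp only [mul_hom_apply]
    exact continuous_finsetSum _ fun i _ =>
      ((continuous_hom_apply _).comp continuous_fst).mul
        ((continuous_hom_apply _).comp continuous_snd)

end Basic

/-! ## Connected reductive groups over an algebraically closed field

The geometric fibres of a smooth group scheme are reduced, so that they are described by their
groups of rational points with the Zariski topology. -/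

section Geometric

variable (O : Type u) [CommRing O] (A : Type u) [CommRing A] [HopfAlgebra O A]
  (k : Type u) [Field k] [Algebra O k]

/-- The regular functions on `H(k)`: the `k`-span of the functions `x ↦ x(a)`, `a ∈ A`. -/
def regularFunctions : Submodule k (Points O A k → k) :=
  Submodule.span k (Set.range fun (a : A) (x : Points O A k) => x.hom a)

/-- The Zariski topology on `H(k)`. -/
@[reducible] def zariskiTopology : TopologicalSpace (Points O A k) :=
  TopologicalSpace.generateFrom {D | ∃ F ∈ regularFunctions O A k, D = {x | F x ≠ 0}}

variable {O A k} in
/-- A point of `H(k)` is unipotent if right translation by it is locally unipotent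
on the regular functions of `H`. -/
def IsUnipotent (x : Points O A k) : Prop :=
  ∀ a : A, ∃ n : ℕ,
    (fun (F : Points O A k → k) (y : Points O A k) => F (y * x) - F y)^[n] (fun y => y.hom a) = 0

/-- `H_k` is connected, and its unipotent radical is trivial: every Zariski closed, connected,
normal subgroup of `H(k)` that consists of unipotent elements is trivial. -/
structure IsConnectedReductiveFibre : Prop where
  connected : @IsConnected _ (zariskiTopology O A k) (Set.univ : Set (Points O A k))
  unipotentRadical_eq_bot : ∀ U : Subgroup (Points O A k), U.Normal →
    @IsClosed _ (zariskiTopology O A k) (U : Set (Points O A k)) →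
    @IsConnected _ (zariskiTopology O A k) (U : Set (Points O A k)) →
    (∀ x ∈ U, IsUnipotent x) → U = ⊥

end Geometric

/-! ## The subgroups attached to a cocharacter -/

section Dynamic

variable {O : Type u} [CommRing O] {A : Type u} [CommRing A] [HopfAlgebra O A] {n : ℕ}

/-- The split torus `𝔾_m^n`, as the Hopf algebra `O[ℤ^n]` of its character group. -/
abbrev SplitTorus (O : Type u) [CommRing O] (n : ℕ) : Type u := AddMonoidAlgebra O (Fin n → ℤ)

/-- The `S`-points of the subgroup scheme of `H` given by `π : O[H] → O[ℤ^n]`. -/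
def torus (π : A →ₐc[O] SplitTorus O n) (S : Type u) [CommRing S] [Algebra O S] :
    Subgroup (Points O A S) :=
  (comap (S := S) π).range

/-- The universal point `μ(z) ∈ H(S[z, z⁻¹])` of a cocharacter `μ : 𝔾_m → 𝔾_m^n → H`; the
cocharacter is given by its pairing with the characters of `𝔾_m^n`. -/
def cocharPoint (π : A →ₐc[O] SplitTorus O n) (μ : (Fin n → ℤ) →+ ℤ)
    (S : Type u) [CommRing S] [Algebra O S] : Points O A S[T;T⁻¹] :=
  comap π (mk (AddMonoidAlgebra.lift O S[T;T⁻¹] (Fin n → ℤ)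
    { toFun := fun m => LaurentPolynomial.T (μ m.toAdd)
      map_one' := by simp
      map_mul' := fun a b => by rw [toAdd_mul, map_add, LaurentPolynomial.T_add] }))

/-- `x ↦ x`, as a map `H(S) → H(S[z, z⁻¹])`. -/
def constPoint (S : Type u) [CommRing S] [Algebra O S] : Points O A S →* Points O A S[T;T⁻¹] :=
  map (IsScalarTower.toAlgHom O S S[T;T⁻¹])

/-- `x ↦ μ(z) x μ(z)⁻¹`, as a map `H(S) → H(S[z, z⁻¹])`. -/
def conjPoint (π : A →ₐc[O] SplitTorus O n) (μ : (Fin n → ℤ) →+ ℤ)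
    (S : Type u) [CommRing S] [Algebra O S] : Points O A S →* Points O A S[T;T⁻¹] :=
  (MulAut.conj (cocharPoint π μ S)).toMonoidHom.comp (constPoint S)

/-- The natural map `H(S[z]) → H(S[z, z⁻¹])`. -/
def polyToLaurent (S : Type u) [CommRing S] [Algebra O S] :
    Points O A S[X] →* Points O A S[T;T⁻¹] :=
  map ((Polynomial.toLaurentAlg (R := S)).restrictScalars O)

/-- The map `H(S[z]) → H(S)`, `z ↦ 0`. -/
def evalZero (S : Type u) [CommRing S] [Algebra O S] : Points O A S[X] →* Points O A S :=
  map ((Polynomial.aeval (0 : S)).restrictScalars O)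

/-- `Z_H(μ)(S)`: the points that commute with `μ`. -/
def centralizer (π : A →ₐc[O] SplitTorus O n) (μ : (Fin n → ℤ) →+ ℤ)
    (S : Type u) [CommRing S] [Algebra O S] : Subgroup (Points O A S) :=
  (conjPoint π μ S).eqLocus (constPoint S)

/-- `P_H(μ)(S)`: the points `x` for which `lim_{z → 0} μ(z) x μ(z)⁻¹` exists. -/
def parabolic (π : A →ₐc[O] SplitTorus O n) (μ : (Fin n → ℤ) →+ ℤ)
    (S : Type u) [CommRing S] [Algebra O S] : Subgroup (Points O A S) :=
  (polyToLaurent S).range.comap (conjPoint π μ S)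

/-- `U_H(μ)(S)`: the points `x` for which `lim_{z → 0} μ(z) x μ(z)⁻¹` exists and equals `1`. -/
def unipotent (π : A →ₐc[O] SplitTorus O n) (μ : (Fin n → ℤ) →+ ℤ)
    (S : Type u) [CommRing S] [Algebra O S] : Subgroup (Points O A S) :=
  (((evalZero S).ker).map (polyToLaurent S)).comap (conjPoint π μ S)

end Dynamic

end Points

/-- A split connected reductive group scheme `H` over `O` together with a split maximal torus
`T ⊆ H` and a Borel subgroup `B ⊇ T`.

* `H = Spec A` is smooth and affine, with connected reductive geometric fibres.
* `T ≅ 𝔾_m^rank` is a closed subgroup scheme, given by the surjection `π : A → O[ℤ^rank]`.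
* `B` is given by a regular cocharacter `μ` of `T` lying in the interior of the Weyl chamber
  of `B`: regularity is the condition `Z_H(μ) = T` (which also forces `T` to be a maximal torus),
  and then `B = P_H(μ)`, its unipotent radical is `U_H(μ)`, and the opposite Borel subgroup and
  its unipotent radical are `P_H(-μ)` and `U_H(-μ)`. -/
structure SplitReductiveGroup (O : Type u) [CommRing O] where
  A : Type u
  [commRing : CommRing A]
  [hopfAlgebra : HopfAlgebra O A]
  smooth : Algebra.Smooth O A
  reductive : ∀ (k : Type u) [Field k] [IsAlgClosed k] [Algebra O k],
    Points.IsConnectedReductiveFibre O A k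
  rank : ℕ
  π : A →ₐc[O] Points.SplitTorus O rank
  π_surjective : Function.Surjective π
  μ : (Fin rank → ℤ) →+ ℤ
  regular : ∀ (S : Type u) [CommRing S] [Algebra O S],
    Points.centralizer π μ S = Points.torus π S

attribute [instance] SplitReductiveGroup.commRing SplitReductiveGroup.hopfAlgebra

namespace SplitReductiveGroup

variable {O : Type u} [CommRing O] (H : SplitReductiveGroup O)
  (S : Type u) [CommRing S] [Algebra O S]

/-- `H(S)`. -/
abbrev Pts : Type u := Points O H.A S

/-- `T(S)`. -/
def T : Subgroup (H.Pts S) := Points.torus H.π S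

/-- `B(S)`. -/
def B : Subgroup (H.Pts S) := Points.parabolic H.π H.μ S

/-- `N(S)`, for the unipotent radical `N` of `B`. -/
def N : Subgroup (H.Pts S) := Points.unipotent H.π H.μ S

/-- `N̄(S)`, for the unipotent radical `N̄` of the Borel subgroup opposite to `B`. -/
def Nbar : Subgroup (H.Pts S) := Points.unipotent H.π (-H.μ) S

end SplitReductiveGroup

/-! ## The `p`-adic groups -/

/-- The ring of integers `{x : ‖x‖ ≤ 1}` of a non-archimedean field. -/
abbrev RingOfIntegers (L : Type u) [NormedField L] [IsUltrametricDist L] : Subring L :=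
  (NormedField.valuation (K := L)).integer

/-- A finite family of finite extensions `L v` of `ℚ_p`, and for every `v` a split connected
reductive group over the ring of integers of `L v`, with a split maximal torus and a Borel
subgroup. (For a connected reductive group over a number field `F` that is split at all `v ∣ p`,
take `L v = F_v` for `v ∣ p`.) -/
structure GroupDatum (p : ℕ) [Fact p.Prime] where
  places : Type
  [fintype : Fintype places]
  L : places → Type u
  [normedField : ∀ v, NormedField (L v)]
  [ultrametric : ∀ v, IsUltrametricDist (L v)]
  [normedAlgebra : ∀ v, NormedAlgebra ℚ_[p] (L v)]
  [finiteDimensional : ∀ v, FiniteDimensional ℚ_[p] (L v)]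
  H : ∀ v, SplitReductiveGroup (RingOfIntegers (L v))

attribute [instance] GroupDatum.fintype GroupDatum.normedField GroupDatum.ultrametric
  GroupDatum.normedAlgebra GroupDatum.finiteDimensional

namespace GroupDatum

variable {p : ℕ} [Fact p.Prime] (D : GroupDatum.{u} p)

/-- The ring of integers of `L v`. -/
abbrev O (v : D.places) : Type u := RingOfIntegers (D.L v)

/-- `G = ∏ H_v(L v)`. -/
abbrev G : Type u := ∀ v, (D.H v).Pts (D.L v)

/-- `G₀ = ∏ H_v(O_v)`. -/
abbrev G₀ : Type u := ∀ v, (D.H v).Pts (D.O v)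

/-- The ring `O_v / p^s`. -/
abbrev OMod (v : D.places) (s : ℕ) : Type u := D.O v ⧸ Ideal.span {((p : D.O v)) ^ s}

/-- The inclusion `G₀ → G`. -/
def incl : D.G₀ →* D.G :=
  MonoidHom.pi fun v =>
    (Points.map (IsScalarTower.toAlgHom (D.O v) (D.O v) (D.L v))).comp (Pi.evalMonoidHom _ v)

/-- The reduction map `G₀ → ∏ H_v(O_v / p^s)`. -/
def red (s : ℕ) : D.G₀ →* ∀ v, (D.H v).Pts (D.OMod v s) :=
  MonoidHom.pi fun v =>
    (Points.map (Ideal.Quotient.mkₐ (D.O v) (Ideal.span {((p : D.O v)) ^ s}))).comp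
      (Pi.evalMonoidHom _ v)

/-- `T = ∏ T_v(L v)`. -/
def T : Subgroup D.G := Subgroup.pi Set.univ fun v => (D.H v).T (D.L v)

/-- `T₀ = ∏ T_v(O_v)`. -/
def T₀ : Subgroup D.G₀ := Subgroup.pi Set.univ fun v => (D.H v).T (D.O v)

/-- `T_s = Ker (T₀ → ∏ T_v(O_v / p^s))`. -/
def Tlevel (s : ℕ) : Subgroup D.G₀ := D.T₀ ⊓ (D.red s).ker

/-- `N₀ = ∏ N_v(O_v)`. -/
def N₀ : Subgroup D.G₀ := Subgroup.pi Set.univ fun v => (D.H v).N (D.O v)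

/-- `N̄_s = Ker (∏ N̄_v(O_v) → ∏ N̄_v(O_v / p^s))`. -/
def Nbar (s : ℕ) : Subgroup D.G₀ :=
  (Subgroup.pi Set.univ fun v => (D.H v).Nbar (D.O v)) ⊓ (D.red s).ker

/-- The Iwahori subgroup `I`: the preimage of `∏ B_v(O_v / p)` under reduction modulo `p`. -/
def Iwahori : Subgroup D.G₀ :=
  (Subgroup.pi Set.univ fun v => (D.H v).B (D.OMod v 1)).comap (D.red 1)

/-- `ε = 1` for odd `p`, and `ε = 2` for `p = 2`. -/
def eps (p : ℕ) : ℕ := if p = 2 then 2 else 1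

theorem one_le_eps (p : ℕ) : 1 ≤ eps p := by unfold eps; split_ifs <;> norm_num

theorem ker_red_anti {s s' : ℕ} (h : s ≤ s') : (D.red s').ker ≤ (D.red s).ker := by
  intro x hx
  rw [MonoidHom.mem_ker] at hx ⊢
  funext v
  have hv := congrFun hx v
  apply Points.ext_hom
  ext a
  have ha : (((D.red s') x) v).hom a = (1 : (D.H v).Pts (D.OMod v s')).hom a := by
    rw [hv, Pi.one_apply]
  rw [Points.one_hom_apply] at ha
  rw [Pi.one_apply, Points.one_hom_apply]
  change Ideal.Quotient.mk (Ideal.span {((p : D.O v)) ^ s'}) ((x v).hom a) =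
    Ideal.Quotient.mk (Ideal.span {((p : D.O v)) ^ s'}) (Coalgebra.counit a) at ha
  change Ideal.Quotient.mk (Ideal.span {((p : D.O v)) ^ s}) ((x v).hom a) =
    Ideal.Quotient.mk (Ideal.span {((p : D.O v)) ^ s}) (Coalgebra.counit a)
  rw [Ideal.Quotient.eq, Ideal.mem_span_singleton] at ha ⊢
  exact (pow_dvd_pow _ h).trans ha

theorem Nbar_anti {s s' : ℕ} (h : s ≤ s') : D.Nbar s' ≤ D.Nbar s :=
  inf_le_inf_left _ (D.ker_red_anti h)

theorem Nbar_le_Iwahori : D.Nbar 1 ≤ D.Iwahori := by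
  intro x hx
  have h : D.red 1 x = 1 := hx.2
  rw [Iwahori, Subgroup.mem_comap, h]
  exact one_mem _

/-- `t N̄₁ t⁻¹ ⊆ N̄_s`, inside `G`. -/
def ConjMapsInto (t : D.G) (s : ℕ) : Prop :=
  ∀ n ∈ D.Nbar 1, ∃ m ∈ D.Nbar s, D.incl m = t * D.incl n * t⁻¹

/-- `Σ⁺`, for a retraction `σ : T → T₀` of the inclusion, with kernel `Σ`. -/
def SigmaPlus (σ : D.T →* D.T₀) : Set D.T :=
  {t | σ t = 1 ∧ D.ConjMapsInto (t : D.G) 1}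

/-- `Σ^cpt`, for a retraction `σ : T → T₀` of the inclusion, with kernel `Σ`. -/
def SigmaCpt (σ : D.T →* D.T₀) : Set D.T :=
  {t | σ t = 1 ∧ D.ConjMapsInto (t : D.G) 2}

variable {D} in
theorem ConjMapsInto.mono {t : D.G} {s s' : ℕ} (h : s ≤ s') (ht : D.ConjMapsInto t s') :
    D.ConjMapsInto t s := fun n hn =>
  let ⟨m, hm, e⟩ := ht n hn
  ⟨m, D.Nbar_anti h hm, e⟩

/-- Conjugation by `t` on `N̄₁`, for `t ∈ G` with `t N̄₁ t⁻¹ ⊆ N̄₁`. -/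
def conjFun {t : D.G} (ht : D.ConjMapsInto t 1) (n : D.Nbar 1) : D.Nbar 1 :=
  ⟨(ht n n.2).choose, (ht n n.2).choose_spec.1⟩

theorem incl_conjFun {t : D.G} (ht : D.ConjMapsInto t 1) (n : D.Nbar 1) :
    D.incl (D.conjFun ht n) = t * D.incl n * t⁻¹ :=
  (ht n n.2).choose_spec.2

theorem continuous_incl : Continuous D.incl := by
  refine continuous_pi fun v => Points.continuous_of_hom_apply fun a => ?_
  exact continuous_subtype_val.comp
    ((Points.continuous_hom_apply (S := D.O v) a).comp (continuous_apply v))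

theorem continuous_of_incl {X : Type*} [TopologicalSpace X] {f : X → D.G₀}
    (h : Continuous fun x => D.incl (f x)) : Continuous f := by
  refine continuous_pi fun v => Points.continuous_of_hom_apply fun a => ?_
  refine continuous_induced_rng.2 ?_
  exact (Points.continuous_hom_apply (S := D.L v) a).comp ((continuous_apply v).comp h)

theorem continuous_conjFun {t : D.G} (ht : D.ConjMapsInto t 1) : Continuous (D.conjFun ht) := by
  refine continuous_induced_rng.2 (D.continuous_of_incl ?_)
  have : (fun n => D.incl ((D.conjFun ht n : D.Nbar 1) : D.G₀)) =
      fun n : D.Nbar 1 => t * D.incl n * t⁻¹ := funext (D.incl_conjFun ht)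
  change Continuous fun n => D.incl ((D.conjFun ht n : D.Nbar 1) : D.G₀)
  rw [this]
  exact (continuous_const.mul (D.continuous_incl.comp continuous_subtype_val)).mul continuous_const

/-- Conjugation by `t` on `N̄₁`, as a continuous map. -/
def conj {t : D.G} (ht : D.ConjMapsInto t 1) : C(D.Nbar 1, D.Nbar 1) :=
  ⟨D.conjFun ht, D.continuous_conjFun ht⟩

theorem isOpen_ideal (v : D.places) (s : ℕ) :
    IsOpen {y : D.O v | y ∈ Ideal.span {((p : D.O v)) ^ s}} := by
  have hp : (0 : ℝ) < ‖((p : D.L v)) ^ s‖ := by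
    have : (p : D.L v) ≠ 0 := by
      have : CharZero (D.L v) := charZero_of_injective_algebraMap (algebraMap ℚ_[p] (D.L v)).injective
      exact_mod_cast (Fact.out : p.Prime).ne_zero
    exact norm_pos_iff.2 (pow_ne_zero s this)
  have : {y : D.O v | y ∈ Ideal.span {((p : D.O v)) ^ s}} =
      Subtype.val ⁻¹' (Metric.closedBall (0 : D.L v) ‖((p : D.L v)) ^ s‖) := by
    ext y
    simp only [Set.mem_ofPred_eq, Ideal.mem_span_singleton, Set.mem_preimage,
      mem_closedBall_zero_iff]
    constructor
    · rintro ⟨z, rfl⟩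
      have hz : ‖(z : D.L v)‖ ≤ 1 := z.2
      simpa using mul_le_mul_of_nonneg_left hz hp.le
    · intro h
      have hp' : ((p : D.L v)) ^ s ≠ 0 := norm_pos_iff.1 hp
      refine ⟨⟨(y : D.L v) / ((p : D.L v)) ^ s, ?_⟩, ?_⟩
      · change ‖(y : D.L v) / ((p : D.L v)) ^ s‖ ≤ 1
        rw [norm_div]
        exact (div_le_one hp).2 h
      · ext
        simp [mul_div_cancel₀, hp']
  rw [this]
  exact (IsUltrametricDist.isOpen_closedBall _ hp.ne').preimage continuous_subtype_val

/-- The principal congruence subgroups are open. -/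
theorem isOpen_ker_red (s : ℕ) : IsOpen ((D.red s).ker : Set D.G₀) := by
  have key : ∀ v, ∃ S : Finset (D.H v).A, Algebra.adjoin (D.O v) (S : Set (D.H v).A) = ⊤ := by
    intro v
    have := (D.H v).smooth.finitePresentation
    have h : Algebra.FiniteType (D.O v) (D.H v).A := inferInstance
    exact h.out
  choose S hS using key
  have : ((D.red s).ker : Set D.G₀) = ⋂ v, ⋂ a ∈ S v,
      {x | (x v).hom a - Coalgebra.counit a ∈ Ideal.span {((p : D.O v)) ^ s}} := by
    ext x
    simp only [SetLike.mem_coe, MonoidHom.mem_ker, Set.mem_iInter, Set.mem_ofPred_eq]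
    have e : ∀ v a, (((D.red s x) v).hom a = (1 : (D.H v).Pts (D.OMod v s)).hom a) ↔
        (x v).hom a - Coalgebra.counit a ∈ Ideal.span {((p : D.O v)) ^ s} := by
      intro v a
      rw [Points.one_hom_apply, ← Ideal.Quotient.eq]
      rfl
    constructor
    · intro h v a _
      rw [← e, h, Pi.one_apply]
    · intro h
      funext v
      apply Points.ext_hom
      refine AlgHom.ext_of_adjoin_eq_top (hS v) fun a ha => ?_
      exact (e v a).2 (h v a ha)
  rw [this]
  refine isOpen_iInter_of_finite fun v => isOpen_biInter_finset fun a _ => ?_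
  have hc : Continuous fun x : D.G₀ => (x v).hom a - Coalgebra.counit a :=
    ((Points.continuous_hom_apply a).comp (continuous_apply v)).sub continuous_const
  exact (D.isOpen_ideal v s).preimage hc

instance (s : ℕ) : ContinuousMul (D.Nbar s) :=
  Topology.IsInducing.continuousMul (D.Nbar s).subtype Topology.IsInducing.subtypeVal

/-- `N̄_ε`, as a subgroup of `N̄₁`. -/
abbrev NbarEps : Subgroup (D.Nbar 1) := (D.Nbar (eps p)).subgroupOf (D.Nbar 1)

theorem isClopen_NbarEps : IsClopen (D.NbarEps : Set (D.Nbar 1)) := by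
  have hop : IsOpen (D.NbarEps : Set (D.Nbar 1)) := by
    have : (D.NbarEps : Set (D.Nbar 1)) =
        Subtype.val ⁻¹' ((D.red (eps p)).ker : Set D.G₀) := by
      ext x
      simp only [SetLike.mem_coe, Subgroup.mem_subgroupOf, Set.mem_preimage]
      exact ⟨fun h => h.2, fun h => ⟨x.2.1, h⟩⟩
    rw [this]
    exact (D.isOpen_ker_red _).preimage continuous_subtype_val
  exact ⟨Subgroup.isClosed_of_isOpen _ hop, hop⟩

end GroupDatum

/-! ## Banach–Tate algebras, compact maps -/

/-- A Banach–Tate `ℤ_p`-algebra: a complete commutative ring with a submultiplicative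
non-archimedean norm (with `‖1‖ = 1`), with a multiplicative unit `ϖ` of norm `< 1`, and with a
norm-decreasing homomorphism `ℤ_p → R`. -/
class IsBanachTateAlgebra (p : ℕ) [Fact p.Prime] (R : Type v) [NormedCommRing R]
    [Algebra ℤ_[p] R] : Prop extends NormOneClass R, IsUltrametricDist R, CompleteSpace R where
  exists_pseudoUniformizer : ∃ ϖ : Rˣ, (∀ x : R, ‖(ϖ : R) * x‖ = ‖(ϖ : R)‖ * ‖x‖) ∧ ‖(ϖ : R)‖ < 1
  norm_algebraMap_le : ∀ z : ℤ_[p], ‖algebraMap ℤ_[p] R z‖ ≤ ‖z‖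

/-- An `R`-linear map is of finite rank if its image lies in a finitely generated submodule. A
continuous `R`-linear map is compact if it is a limit, for the operator norm, of continuous
`R`-linear maps of finite rank. -/
def IsCompactMap {R : Type*} [NormedCommRing R] {M N : Type*} [NormedAddCommGroup M]
    [NormedAddCommGroup N] [Module R M] [Module R N] (φ : M →L[R] N) : Prop :=
  ∀ δ : ℝ, 0 < δ → ∃ ψ : M →L[R] N,
    (∃ P : Submodule R N, P.FG ∧ ∀ m, ψ m ∈ P) ∧ ∀ m, ‖φ m - ψ m‖ ≤ δ * ‖m‖

theorem continuous_algebraMap_padicInt (p : ℕ) [Fact p.Prime] (R : Type v) [NormedCommRing R]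
    [Algebra ℤ_[p] R] [IsBanachTateAlgebra p R] : Continuous (algebraMap ℤ_[p] R) :=
  AddMonoidHomClass.continuous_of_bound (algebraMap ℤ_[p] R) 1 fun z => by
    simpa using IsBanachTateAlgebra.norm_algebraMap_le z

theorem exists_bound {p : ℕ} [Fact p.Prime] {R : Type v} [NormedCommRing R] [Algebra ℤ_[p] R]
    [IsBanachTateAlgebra p R] {X : Type*} [TopologicalSpace X] (ν : C(X, R) →L[R] R) :
    ∃ K : ℝ, ∀ f : C(X, R), (∀ x, ‖f x‖ ≤ 1) → ‖ν f‖ ≤ K := by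
  have h : ν ⁻¹' Metric.ball 0 1 ∈ nhds (0 : C(X, R)) := by
    refine ν.continuous.continuousAt.preimage_mem_nhds ?_
    rw [map_zero]
    exact Metric.ball_mem_nhds _ one_pos
  obtain ⟨W, hW, hWs⟩ := UniformSpace.mem_nhds_iff.1 h
  obtain ⟨K, V, -, hV, hVW⟩ := (ContinuousMap.mem_compactConvergence_entourage_iff W).1 hW
  obtain ⟨δ, hδ, hδV⟩ := Metric.mem_uniformity_dist.1 hV
  obtain ⟨ϖ, -, hϖ⟩ := IsBanachTateAlgebra.exists_pseudoUniformizer (p := p) (R := R)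
  obtain ⟨n, hn⟩ := exists_pow_lt_of_lt_one hδ hϖ
  refine ⟨‖((ϖ ^ n)⁻¹ : Rˣ).val‖, fun f hf => ?_⟩
  have h1 : ((ϖ ^ n : Rˣ) : R) • f ∈ ν ⁻¹' Metric.ball 0 1 := by
    refine hWs (hVW fun x _ => hδV ?_)
    have h2 : ‖((ϖ ^ n : Rˣ) : R) * f x‖ < δ := by
      refine (norm_mul_le _ _).trans_lt ((mul_le_of_le_one_right (norm_nonneg _) (hf x)).trans_lt ?_)
      rw [Units.val_pow_eq_pow_val]
      exact (norm_pow_le _ _).trans_lt hn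
    simpa [dist_eq_norm] using h2
  have h3 : ‖((ϖ ^ n : Rˣ) : R) * ν f‖ ≤ 1 := by
    have : ‖ν (((ϖ ^ n : Rˣ) : R) • f)‖ < 1 := by simpa using h1
    rw [map_smul, smul_eq_mul] at this
    exact this.le
  calc ‖ν f‖ = ‖((ϖ ^ n)⁻¹ : Rˣ).val * (((ϖ ^ n : Rˣ) : R) * ν f)‖ := by
        rw [← mul_assoc, Units.inv_mul, one_mul]
    _ ≤ ‖((ϖ ^ n)⁻¹ : Rˣ).val‖ * ‖((ϖ ^ n : Rˣ) : R) * ν f‖ := norm_mul_le _ _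
    _ ≤ ‖((ϖ ^ n)⁻¹ : Rˣ).val‖ := mul_le_of_le_one_right (norm_nonneg _) h3

section Characters

variable {p : ℕ} [Fact p.Prime] (D : GroupDatum.{u} p) {R : Type v} [NormedCommRing R]

/-- The norm of `R` is adapted to the character `κ`. -/
structure IsAdapted (κ : D.T₀ →* Rˣ) : Prop where
  norm_le_one : ∀ t, ‖(κ t : R)‖ ≤ 1
  norm_sub_one_lt : ∀ t : D.T₀, (t : D.G₀) ∈ D.Tlevel (GroupDatum.eps p) → ‖(κ t : R) - 1‖ < 1

/-- `r_κ`: the minimal `r ∈ [1/p, 1)` such that `|κ(t) - 1| ≤ r` for all `t ∈ T_ε`. -/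
def rMin (κ : D.T₀ →* Rˣ) : ℝ :=
  sInf {r : ℝ | r ∈ Set.Ico ((p : ℝ)⁻¹) 1 ∧
    ∀ t : D.T₀, (t : D.G₀) ∈ D.Tlevel (GroupDatum.eps p) → ‖(κ t : R) - 1‖ ≤ r}

/-- `𝒜_κ`: the continuous functions `f : I → R` with `f(gb) = κ(b) f(g)` for `g ∈ I` and
`b ∈ B₀ = T₀ N₀`, where `κ` is extended to `B₀` by making it trivial on `N₀`. It is topologized as
a subspace of `C(I, R)`, with the topology of uniform convergence. -/
def AKappa (κ : D.T₀ →* Rˣ) : Submodule R C(D.Iwahori, R) where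
  carrier := {f | ∀ (g g' : D.Iwahori) (t : D.T₀) (n : D.N₀),
    (g' : D.G₀) = g * (t * n) → f g' = κ t * f g}
  add_mem' hf hf' g g' t n h := by
    simp only [ContinuousMap.add_apply, hf g g' t n h, hf' g g' t n h, mul_add]
  zero_mem' g g' t n h := by simp
  smul_mem' c f hf g g' t n h := by
    simp only [ContinuousMap.smul_apply, smul_eq_mul, hf g g' t n h]
    ring

/-- `𝒟_κ = Hom_{R,cts}(𝒜_κ, R)`. -/
abbrev DKappa (κ : D.T₀ →* Rˣ) := AKappa D κ →L[R] R

instance (κ : D.T₀ →* Rˣ) : AddCommGroup (DKappa D κ) :=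
  ContinuousLinearMap.addCommGroup (M := AKappa D κ) (M₂ := R) (R := R) (R₂ := R)
    (σ₁₂ := RingHom.id R)

/-- The inclusion `N̄₁ → I`. -/
def nbarToIwahori : C(D.Nbar 1, D.Iwahori) :=
  ⟨fun n => ⟨n, D.Nbar_le_Iwahori n.2⟩, by fun_prop⟩

end Characters

/-! ## The norms `‖-‖_r` and the completions `𝒟_κ^r` -/

section Norms

variable {p : ℕ} [Fact p.Prime] (D : GroupDatum.{u} p)

/-- The radii `r ∈ [1/p, 1)`. -/
abbrev Radius (p : ℕ) : Type := Set.Ico ((p : ℝ)⁻¹) 1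

theorem Radius.nonneg {p : ℕ} (r : Radius p) : 0 ≤ (r : ℝ) :=
  (inv_nonneg.2 (Nat.cast_nonneg p)).trans r.2.1

/-- The radius `r^{1/p}`. -/
def Radius.root (r : Radius p) : Radius p :=
  ⟨(r : ℝ) ^ ((p : ℝ)⁻¹), by
    have hp : (0 : ℝ) < p := Nat.cast_pos.2 (Fact.out : p.Prime).pos
    refine ⟨r.2.1.trans (Real.self_le_rpow_of_le_one r.nonneg r.2.2.le ?_),
      Real.rpow_lt_one r.nonneg r.2.2 (inv_pos.2 hp)⟩
    exact inv_le_one_of_one_le₀ (Nat.one_le_cast.2 (Fact.out : p.Prime).one_le)⟩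

/-- The auxiliary choices in the definition of `‖-‖_r`: a minimal ordered set `g` of topological
generators of `N̄_ε`, and a set of representatives of the cosets in `N̄₁ / N̄_ε`. -/
structure NormChoice where
  d : ℕ
  g : Fin d → D.NbarEps
  dense : Dense ((Subgroup.closure (Set.range g) : Subgroup D.NbarEps) : Set D.NbarEps)
  minimal : ∀ (d' : ℕ) (g' : Fin d' → D.NbarEps),
    Dense ((Subgroup.closure (Set.range g') : Subgroup D.NbarEps) : Set D.NbarEps) → d ≤ d'
  rep : D.Nbar 1 ⧸ D.NbarEps → D.Nbar 1
  mk_rep : ∀ c, (rep c : D.Nbar 1 ⧸ D.NbarEps) = c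

variable {D} {R : Type v} [NormedCommRing R]

/-- The two standard identifications that enter the definition of the norms on `𝒟_κ`; there is
at most one term of this type.
* `coord` is the homeomorphism `ℤ_p^d ≃ N̄_ε`, `x ↦ g₁^{x₁} ⋯ g_d^{x_d}`; by continuity, it is
  determined by its values for `x ∈ ℕ^d`.
* `res : 𝒜_κ ≃ C(N̄₁, R)` is the restriction of functions from `I` to `N̄₁`. -/
structure Identifications (C : NormChoice D) (κ : D.T₀ →* Rˣ) where
  coord : (Fin C.d → ℤ_[p]) ≃ₜ D.NbarEps
  coord_natCast : ∀ x : Fin C.d → ℕ,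
    coord (fun i => (x i : ℤ_[p])) = (List.ofFn fun i => C.g i ^ x i).prod
  res : AKappa D κ ≃L[R] C(D.Nbar 1, R)
  res_apply : ∀ (f : AKappa D κ) (n : D.Nbar 1),
    res f n = (f : C(D.Iwahori, R)) (nbarToIwahori D n)

/-- Pullback of continuous functions along a continuous map. -/
def pullback (R : Type*) [NormedCommRing R] {X Y : Type*} [TopologicalSpace X]
    [TopologicalSpace Y] (φ : C(X, Y)) : C(Y, R) →L[R] C(X, R) where
  toFun f := f.comp φ
  map_add' _ _ := rfl
  map_smul' _ _ := rfl
  cont := ContinuousMap.continuous_precomp φ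

variable {C : NormChoice D} {κ : D.T₀ →* Rˣ}

namespace Identifications

variable (Φ : Identifications C κ)

/-- The left action of `t` on `𝒟_κ`, for `t ∈ G` with `t N̄₁ t⁻¹ ⊆ N̄₁`. It is dual to the right
action on `𝒜_κ ≅ C(N̄₁, R)` that is given by `(f · t)(n) = f(t n t⁻¹)`. -/
def act {t : D.G} (ht : D.ConjMapsInto t 1) : DKappa D κ →ₗ[R] DKappa D κ where
  toFun μ := μ.comp ((Φ.res.symm : C(D.Nbar 1, R) →L[R] AKappa D κ).comp
    ((pullback R (D.conj ht)).comp (Φ.res : AKappa D κ →L[R] C(D.Nbar 1, R))))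
  map_add' _ _ := rfl
  map_smul' _ _ := rfl

open Classical in
/-- The function underlying `basisFun`. -/
def basisFunAux (c : D.Nbar 1 ⧸ D.NbarEps) (α : Fin C.d → ℕ) (x : D.Nbar 1) : ℤ_[p] :=
  if h : (C.rep c)⁻¹ * x ∈ D.NbarEps then
    ∏ i, mahler (α i) (Φ.coord.symm ⟨(C.rep c)⁻¹ * x, h⟩ i) else 0

theorem continuous_basisFunAux (c : D.Nbar 1 ⧸ D.NbarEps) (α : Fin C.d → ℕ) :
    Continuous (Φ.basisFunAux c α) := by
  have hU : IsClopen {x : D.Nbar 1 | (C.rep c)⁻¹ * x ∈ D.NbarEps} :=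
    D.isClopen_NbarEps.preimage (continuous_const_mul (C.rep c)⁻¹)
  rw [continuous_iff_continuousAt]
  intro x
  by_cases hx : (C.rep c)⁻¹ * x ∈ D.NbarEps
  · refine ContinuousOn.continuousAt ?_ (hU.isOpen.mem_nhds hx)
    rw [continuousOn_iff_continuous_domRestrict]
    have : Set.domRestrict {x : D.Nbar 1 | (C.rep c)⁻¹ * x ∈ D.NbarEps} (Φ.basisFunAux c α) =
        fun y : {x : D.Nbar 1 // (C.rep c)⁻¹ * x ∈ D.NbarEps} =>
          ∏ i, mahler (α i) (Φ.coord.symm ⟨(C.rep c)⁻¹ * y.1, y.2⟩ i) := by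
      funext y
      exact dif_pos y.2
    rw [this]
    refine continuous_finsetProd _ fun i _ => (mahler (α i)).continuous.comp ?_
    refine (continuous_apply i).comp (Φ.coord.symm.continuous.comp ?_)
    exact Continuous.subtype_mk
      ((continuous_const_mul (C.rep c)⁻¹).comp continuous_subtype_val) _
  · have : (Φ.basisFunAux c α) =ᶠ[nhds x] fun _ => 0 := by
      filter_upwards [hU.compl.isOpen.mem_nhds hx] with y hy
      exact dif_neg hy
    exact continuousAt_const.congr this.symm

variable [Algebra ℤ_[p] R] [IsBanachTateAlgebra p R]

/-- For a coset `c = h N̄_ε` of `N̄_ε` in `N̄₁` with chosen representative `h`, and a multi-index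
`α`: the function on `N̄₁` that is zero outside of `c` and is given on `c` by
`h g₁^{x₁} ⋯ g_d^{x_d} ↦ ∏ i, (x_i choose α_i)`. -/
def basisFun (c : D.Nbar 1 ⧸ D.NbarEps) (α : Fin C.d → ℕ) : C(D.Nbar 1, R) :=
  ⟨fun x => algebraMap ℤ_[p] R (Φ.basisFunAux c α x),
    (continuous_algebraMap_padicInt p R).comp (Φ.continuous_basisFunAux c α)⟩

theorem norm_basisFun_le (c : D.Nbar 1 ⧸ D.NbarEps) (α : Fin C.d → ℕ) (x : D.Nbar 1) :
    ‖(Φ.basisFun c α : C(D.Nbar 1, R)) x‖ ≤ 1 :=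
  (IsBanachTateAlgebra.norm_algebraMap_le _).trans (PadicInt.norm_le_one _)

/-- Under `𝒟_κ ≅ 𝒟(N̄₁, R) = ⨁_c [h_c] 𝒟(N̄_ε, R)`, an element `μ ∈ 𝒟_κ` has a unique
expansion `μ = ∑_c [h_c] ∑_α d_{c,α} b^α` with `b^α = ∏ i, ([g_i] - 1)^{α_i}`; this is the
coefficient `d_{c,α}`. By duality between `b^α` and the Mahler basis (the Amice transform), it is
the value of `μ` at `basisFun c α`. -/
def coeff (μ : DKappa D κ) (c : D.Nbar 1 ⧸ D.NbarEps) (α : Fin C.d → ℕ) : R :=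
  μ (Φ.res.symm (Φ.basisFun c α))

theorem bddAbove_coeff (r : Radius p) (μ : DKappa D κ) :
    BddAbove (Set.range fun i : (D.Nbar 1 ⧸ D.NbarEps) × (Fin C.d → ℕ) =>
      ‖Φ.coeff μ i.1 i.2‖ * (r : ℝ) ^ (∑ j, i.2 j)) := by
  obtain ⟨K, hK⟩ := exists_bound (p := p)
    (μ.comp (Φ.res.symm : C(D.Nbar 1, R) →L[R] AKappa D κ))
  refine ⟨K, ?_⟩
  rintro _ ⟨i, rfl⟩
  have h := hK (Φ.basisFun i.1 i.2) (Φ.norm_basisFun_le i.1 i.2)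
  exact (mul_le_of_le_one_right (norm_nonneg _)
    (pow_le_one₀ r.nonneg r.2.2.le)).trans h

/-- The norm `‖μ‖_r = sup_{c, α} |d_{c,α}| r^{|α|}` on `𝒟_κ`. -/
def rNorm (r : Radius p) : AddGroupSeminorm (DKappa D κ) where
  toFun μ := ⨆ i : (D.Nbar 1 ⧸ D.NbarEps) × (Fin C.d → ℕ),
    ‖Φ.coeff μ i.1 i.2‖ * (r : ℝ) ^ (∑ j, i.2 j)
  map_zero' := by simp [coeff]
  neg' μ := by
    have h : ∀ c α, ‖Φ.coeff (-μ) c α‖ = ‖Φ.coeff μ c α‖ := fun c α =>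
      norm_neg (Φ.coeff μ c α)
    simp only [h]
  add_le' μ ν := by
    refine Real.iSup_le (fun i => ?_) (add_nonneg
      (Real.iSup_nonneg fun i => mul_nonneg (norm_nonneg _) (pow_nonneg r.nonneg _))
      (Real.iSup_nonneg fun i => mul_nonneg (norm_nonneg _) (pow_nonneg r.nonneg _)))
    have h : ‖Φ.coeff (μ + ν) i.1 i.2‖ ≤ ‖Φ.coeff μ i.1 i.2‖ + ‖Φ.coeff ν i.1 i.2‖ :=
      norm_add_le _ _
    refine (mul_le_mul_of_nonneg_right h (pow_nonneg r.nonneg _)).trans ?_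
    rw [add_mul]
    exact add_le_add (le_ciSup (Φ.bddAbove_coeff r μ) i) (le_ciSup (Φ.bddAbove_coeff r ν) i)

theorem rNorm_smul_le (r : Radius p) (a : R) (μ : DKappa D κ) :
    Φ.rNorm r (a • μ) ≤ ‖a‖ * Φ.rNorm r μ := by
  have h0 : 0 ≤ Φ.rNorm r μ := apply_nonneg _ _
  refine Real.iSup_le (fun i => ?_) (mul_nonneg (norm_nonneg _) h0)
  have h : ‖Φ.coeff (a • μ) i.1 i.2‖ ≤ ‖a‖ * ‖Φ.coeff μ i.1 i.2‖ := norm_mul_le _ _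
  refine (mul_le_mul_of_nonneg_right h (pow_nonneg r.nonneg _)).trans ?_
  rw [mul_assoc]
  exact mul_le_mul_of_nonneg_left (le_ciSup (Φ.bddAbove_coeff r μ) i) (norm_nonneg _)

/-- The module `𝒟_κ`, equipped with `‖-‖_r`. -/
def NormedDKappa (_Φ : Identifications C κ) (_r : Radius p) : Type _ := DKappa D κ

instance (r : Radius p) : AddCommGroup (Φ.NormedDKappa r) :=
  inferInstanceAs (AddCommGroup (DKappa D κ))

instance (r : Radius p) : Module R (Φ.NormedDKappa r) :=
  inferInstanceAs (Module R (DKappa D κ))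

instance (r : Radius p) : SeminormedAddCommGroup (Φ.NormedDKappa r) :=
  AddGroupSeminorm.toSeminormedAddCommGroup (E := Φ.NormedDKappa r) (Φ.rNorm r)

instance (r : Radius p) : IsBoundedSMul R (Φ.NormedDKappa r) :=
  IsBoundedSMul.of_norm_smul_le (Φ.rNorm_smul_le r)

/-- `𝒟_κ^r`: the completion of `𝒟_κ` with respect to `‖-‖_r`. -/
abbrev Completed (r : Radius p) : Type _ := UniformSpace.Completion (Φ.NormedDKappa r)

/-- The canonical map `𝒟_κ → 𝒟_κ^r`. -/
def toCompleted (r : Radius p) : DKappa D κ →ₗ[R] Φ.Completed r where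
  toFun μ := UniformSpace.Completion.coe' (α := Φ.NormedDKappa r) μ
  map_add' μ ν := UniformSpace.Completion.coe_add (α := Φ.NormedDKappa r) μ ν
  map_smul' a μ := UniformSpace.Completion.coe_smul (X := Φ.NormedDKappa r) a μ

end Identifications

end Norms

end OverconvergentDistributions

end

open OverconvergentDistributions

/-!
The isomorphism `𝒜_κ ≅ 𝒞(N̄₁, R)` is the Iwahori decomposition `I = N̄₁ T₀ N₀`, and the action of
`t`, the norms and the completions only depend on functions on `N̄₁`. So there are two tasks: to
understand the groups of integral points `N̄_s` as `p`-adic groups, and to bound the action of `t`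
on distributions on `N̄₁`.

*Groups.* Conjugation by the torus grades the coordinate ring of the group by weights, and the
subgroups `T`, `N`, `N̄` are cut out by conditions on functions of certain weights. By smoothness,
the group is near the identity an affine space with homogeneous coordinates (`Points.Coordinates`),
so for `s ≥ 1` an element that is congruent to `1` modulo `p ^ s` is the same as a tuple of elements
of `p ^ s 𝒪`; the coordinates are divided according to the sign of the weight, which yields the
Iwahori decomposition by successive approximation (`exists_iwahori_decomposition`, whence
`restriction`). The points are units of the convolution algebra of linear functionals on the
coordinate ring, and the binomial expansion of `x ^ p` around `x = 1` in this algebra shows that on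
`N̄_ε` the map `x ↦ x ^ p` is a bijection from one congruence subgroup to the next, multiplicative
to first order; commutators lie `ε` steps deeper than in a general filtered group. This is a
`UniformFiltration`, constructed in `GroupDatum.filtration`. In such a group, a minimal ordered set
of topological generators is a basis modulo the first step, and successive approximation gives the
coordinates of the second kind (`UniformFiltration.exists_homeomorph`).

*Distributions.* In the group ring `ℤ[N̄_ε]`, the monomials `∏ ([g_i] - 1) ^ α_i` are dual to the
binomial functions `∏ (x_i choose α_i)` (`pairing_orderedProd_sub_one`). Hence the Mahler
coefficients of a function are its integrals against the monomials, and pulling a binomial function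
back along conjugation by `t` amounts to integrating it against translates of
`∏ ([t g_i t⁻¹] - 1) ^ α_i` (`norm_mahlerCoeff_conj_le`). Those lie in `J ^ |α|`, where `J` is
generated by `p` and the elements `[h] - 1`. Uniformity implies that `J ^ n` is generated by the
elements `p ^ i ∏ ([g_j] - 1) ^ β_j` with `i + |β| ≥ n`, up to any higher power of `J`
(`exists_monomialSpan`), and high powers of `J` are weakly small, since the augmentation ideal of
the group ring of a finite `p`-group over `ℤ / p ^ k` is nilpotent (`exists_pairing_eq_zero`). As
`|p| ≤ r`, this gives the estimate that makes `Σ⁺` act by norm-decreasing maps (`norm_pairing_le`,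
`rNorm_act_le`). For `t ∈ Σ^cpt`, the elements `t g_i t⁻¹` are `p`-th powers, and
`[u ^ p] - 1 ∈ p J + J ^ p`; both `p` and `J ^ p` have size at most `r` when `J` is given the size
`r ^ (1 / p)`, so the action is norm-decreasing from `‖-‖_r` to the larger norm `‖-‖_{r ^ (1 / p)}`
(`rNorm_root_act_le`).

*Completions.* An element of a completion is determined by its coefficients, so the inclusion of
completions is injective; it is compact because it is the limit of the truncations of the expansions
(`isCompactMap_of_toCompleted`). The action of `Σ^cpt` factors through it.
-/

noncomputable section

namespace OverconvergentDistributions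

namespace Points

/-! ### The weight decomposition of the coordinate ring under conjugation by the torus -/

section Weights

variable {O : Type u} [CommRing O] {A : Type u} [CommRing A] [HopfAlgebra O A] {n : ℕ}
  (π : A →ₐc[O] SplitTorus O n)
  {S : Type u} [CommRing S] [Algebra O S] {S' : Type u} [CommRing S'] [Algebra O S']

/-- The `S`-point of the torus on which a character `χ` takes the value `t χ`. -/
def torusPoint (t : Multiplicative (Fin n → ℤ) →* S) : Points O A S :=
  comap π (mk (AddMonoidAlgebra.lift O S (Fin n → ℤ) t))

theorem torusPoint_mul (t t' : Multiplicative (Fin n → ℤ) →* S) :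
    torusPoint π (t * t') = torusPoint π t * torusPoint π t' := by
  rw [torusPoint, torusPoint, torusPoint, ← map_mul]
  congr 1
  apply ext_hom
  refine AddMonoidAlgebra.algHom_ext (fun χ => ?_) (Subsingleton.elim _ _)
  refine Eq.trans ?_ (AlgHom.convMul_apply (R := O) (A := S) (C := SplitTorus O n)
    (mk (AddMonoidAlgebra.lift O S (Fin n → ℤ) t))
    (mk (AddMonoidAlgebra.lift O S (Fin n → ℤ) t')) _).symm
  simp [mk, hom]

theorem torusPoint_one : torusPoint π (1 : Multiplicative (Fin n → ℤ) →* S) = 1 := by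
  have h := torusPoint_mul π (1 : Multiplicative (Fin n → ℤ) →* S) 1
  rw [one_mul] at h
  exact left_eq_mul.1 h

theorem map_torusPoint (φ : S →ₐ[O] S') (t : Multiplicative (Fin n → ℤ) →* S) :
    map φ (torusPoint π t) = torusPoint π ((φ : S →* S').comp t) := by
  apply ext_hom
  change φ.comp ((AddMonoidAlgebra.lift O S (Fin n → ℤ) t).comp (π : A →ₐ[O] SplitTorus O n)) =
    (AddMonoidAlgebra.lift O S' (Fin n → ℤ) _).comp (π : A →ₐ[O] SplitTorus O n)
  rw [← AlgHom.comp_assoc]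
  congr 1
  refine AddMonoidAlgebra.algHom_ext (fun χ => ?_) (Subsingleton.elim _ _)
  simp

theorem mem_torus_iff {x : Points O A S} : x ∈ torus π S ↔ ∃ t, torusPoint π t = x := by
  constructor
  · rintro ⟨y, rfl⟩
    refine ⟨(AddMonoidAlgebra.lift O S (Fin n → ℤ)).symm y.hom, ?_⟩
    rw [torusPoint, Equiv.apply_symm_apply]
    rfl
  · rintro ⟨t, rfl⟩
    exact ⟨_, rfl⟩

variable (O A) in
/-- The conjugate of the universal point of the group scheme by the universal point of the torus,
which is the coaction of the torus on the coordinate ring that is dual to conjugation. -/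
def coaction : A →ₐ[O] AddMonoidAlgebra A (Fin n → ℤ) :=
  (torusPoint π (AddMonoidAlgebra.of A (Fin n → ℤ)) *
    map (IsScalarTower.toAlgHom O A (AddMonoidAlgebra A (Fin n → ℤ))) (mk (AlgHom.id O A)) *
    (torusPoint π (AddMonoidAlgebra.of A (Fin n → ℤ)))⁻¹).hom

/-- The projection of the coordinate ring to its weight space for the character `χ`. -/
def weight (χ : Fin n → ℤ) : A →ₗ[O] A where
  toFun a := (coaction O A π a).coeff χ
  map_add' a b := by simp
  map_smul' c a := by simp

/-- The characters that occur in a regular function. -/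
def weights (a : A) : Finset (Fin n → ℤ) := (coaction O A π a).coeff.support

variable {π} in
theorem weight_eq_zero {a : A} {χ : Fin n → ℤ} (h : χ ∉ weights π a) : weight π χ a = 0 :=
  Finsupp.notMem_support_iff.1 h

/-- Every conjugation by a point of the torus is a base change of the universal one: it multiplies
functions of weight `χ` by the value of `χ`. -/
theorem conj_torusPoint_hom (t : Multiplicative (Fin n → ℤ) →* S) (x : Points O A S) (a : A) :
    (torusPoint π t * x * (torusPoint π t)⁻¹).hom a =
      ∑ χ ∈ weights π a, x.hom (weight π χ a) * t (Multiplicative.ofAdd χ) := by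
  let Φ : AddMonoidAlgebra A (Fin n → ℤ) →ₐ[O] S :=
    AddMonoidAlgebra.liftNCAlgHom x.hom t fun _ _ => .all ..
  have hΦ : ∀ χ b, Φ (AddMonoidAlgebra.single χ b) = x.hom b * t (Multiplicative.ofAdd χ) :=
    fun χ b => AddMonoidAlgebra.liftNC_single _ _ _ _
  have h1 : (Φ : AddMonoidAlgebra A (Fin n → ℤ) →* S).comp (AddMonoidAlgebra.of A (Fin n → ℤ)) =
      t := by
    refine MonoidHom.ext fun χ => (hΦ _ _).trans ?_
    simp
  have h2 : map Φ (map (IsScalarTower.toAlgHom O A (AddMonoidAlgebra A (Fin n → ℤ)))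
      (mk (AlgHom.id O A))) = x := by
    apply ext_hom
    ext b
    refine (hΦ 0 b).trans ?_
    simp
  have h : torusPoint π t * x * (torusPoint π t)⁻¹ = map Φ (mk (coaction O A π)) := by
    change _ = map Φ (_ * _ * _)
    rw [map_mul, map_mul, map_inv, map_torusPoint, h1, h2]
  rw [h]
  change Φ (coaction O A π a) = _
  conv_lhs => rw [← AddMonoidAlgebra.sum_coeff_single (coaction O A π a)]
  rw [Finsupp.sum, map_sum]
  exact Finset.sum_congr rfl fun χ _ => hΦ _ _

/-- The coordinate ring is the sum of its weight spaces: conjugation by the identity is trivial. -/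
theorem sum_weight (a : A) : ∑ χ ∈ weights π a, weight π χ a = a := by
  have h := conj_torusPoint_hom π 1 (mk (AlgHom.id O A)) a
  rw [torusPoint_one] at h
  simpa using h.symm

/-- The weight projections are orthogonal idempotents: this compares the conjugation by a product
of two universal points of the torus with two successive conjugations. -/
theorem weight_weight (χ χ' : Fin n → ℤ) (a : A) :
    weight π χ' (weight π χ a) = if χ' = χ then weight π χ a else 0 := by
  classical
  let t₁ : Multiplicative (Fin n → ℤ) →* AddMonoidAlgebra A ((Fin n → ℤ) × (Fin n → ℤ)) :=
    (AddMonoidAlgebra.of A _).comp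
      (AddMonoidHom.toMultiplicative (AddMonoidHom.inl (Fin n → ℤ) (Fin n → ℤ)))
  let t₂ : Multiplicative (Fin n → ℤ) →* AddMonoidAlgebra A ((Fin n → ℤ) × (Fin n → ℤ)) :=
    (AddMonoidAlgebra.of A _).comp
      (AddMonoidHom.toMultiplicative (AddMonoidHom.inr (Fin n → ℤ) (Fin n → ℤ)))
  let x : Points O A (AddMonoidAlgebra A ((Fin n → ℤ) × (Fin n → ℤ))) :=
    mk (IsScalarTower.toAlgHom O A _)
  have e : torusPoint π (t₂ * t₁) * x * (torusPoint π (t₂ * t₁))⁻¹ =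
      torusPoint π t₂ * (torusPoint π t₁ * x * (torusPoint π t₁)⁻¹) * (torusPoint π t₂)⁻¹ := by
    rw [torusPoint_mul]
    group
  have h := congrArg (fun y => (y.hom a).coeff (χ', χ)) e
  have hx : ∀ b, x.hom b = AddMonoidAlgebra.single 0 b := fun _ => rfl
  have ht₁ : ∀ ψ, t₁ (Multiplicative.ofAdd ψ) = AddMonoidAlgebra.single (ψ, 0) 1 := fun _ => rfl
  have ht₂ : ∀ ψ, t₂ (Multiplicative.ofAdd ψ) = AddMonoidAlgebra.single (0, ψ) 1 := fun _ => rfl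
  simp only [conj_torusPoint_hom, hx, MonoidHom.mul_apply, ht₁, ht₂, Finset.sum_mul,
    AddMonoidAlgebra.single_mul_single, AddMonoidAlgebra.coeff_sum, Finsupp.finsetSum_apply,
    AddMonoidAlgebra.coeff_single, Finsupp.single_apply, Prod.mk_add_mk, zero_add, add_zero,
    mul_one, Prod.mk.injEq] at h
  have hr : ∀ ψ ∈ weights π a, (∑ ψ' ∈ weights π (weight π ψ a),
      if ψ' = χ' ∧ ψ = χ then weight π ψ' (weight π ψ a) else 0) =
      if ψ = χ then weight π χ' (weight π ψ a) else 0 := by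
    intro ψ _
    by_cases hψ : ψ = χ
    · simp only [hψ, and_true, if_true]
      rw [Finset.sum_ite_eq']
      split_ifs with h'
      · rfl
      · exact (weight_eq_zero h').symm
    · simp [hψ]
  have hl : (∑ ψ ∈ weights π a, if ψ = χ' ∧ ψ = χ then weight π ψ a else 0) =
      if χ' = χ then weight π χ a else 0 := by
    by_cases hc : χ' = χ
    · subst hc
      simp only [and_self, if_true]
      rw [Finset.sum_ite_eq']
      split_ifs with h'
      · rfl
      · exact (weight_eq_zero h').symm
    · rw [if_neg hc]
      refine Finset.sum_eq_zero fun ψ _ => if_neg ?_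
      rintro ⟨rfl, h'⟩
      exact hc h'
  rw [hl, Finset.sum_congr rfl hr, Finset.sum_ite_eq'] at h
  rw [h]
  split_ifs with h'
  · rfl
  · rw [weight_eq_zero h', map_zero]

theorem weight_weight_self (χ : Fin n → ℤ) (a : A) :
    weight π χ (weight π χ a) = weight π χ a := by
  rw [weight_weight, if_pos rfl]

theorem weight_weight_ne {χ χ' : Fin n → ℤ} (h : χ' ≠ χ) (a : A) :
    weight π χ' (weight π χ a) = 0 := by
  rw [weight_weight, if_neg h]

theorem weights_weight_subset (χ : Fin n → ℤ) (a : A) : weights π (weight π χ a) ⊆ {χ} := by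
  intro ψ hψ
  rw [Finset.mem_singleton]
  by_contra h
  exact Finsupp.mem_support_iff.1 hψ (weight_weight_ne π h a)

theorem conj_torusPoint_hom_weight (t : Multiplicative (Fin n → ℤ) →* S) (x : Points O A S)
    (χ : Fin n → ℤ) (a : A) :
    (torusPoint π t * x * (torusPoint π t)⁻¹).hom (weight π χ a) =
      x.hom (weight π χ a) * t (Multiplicative.ofAdd χ) := by
  rw [conj_torusPoint_hom, Finset.sum_subset (weights_weight_subset π χ a), Finset.sum_singleton,
    weight_weight_self]
  intro ψ _ hψ
  rw [weight_eq_zero hψ, map_zero, zero_mul]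

/-- A product of two homogeneous functions is homogeneous. -/
theorem weight_mul_weight (χ χ' : Fin n → ℤ) (a b : A) :
    weight π (χ + χ') (weight π χ a * weight π χ' b) = weight π χ a * weight π χ' b := by
  have key : ∀ ψ c, coaction O A π (weight π ψ c) = AddMonoidAlgebra.single ψ (weight π ψ c) := by
    intro ψ c
    ext ψ'
    change weight π ψ' (weight π ψ c) = _
    classical
    rw [weight_weight, AddMonoidAlgebra.coeff_single, Finsupp.single_apply]
    simp only [eq_comm]
  change (coaction O A π (_ * _)).coeff _ = _
  rw [map_mul, key, key, AddMonoidAlgebra.single_mul_single, AddMonoidAlgebra.coeff_single,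
    Finsupp.single_eq_same]

/-- The counit is invariant under conjugation, since the identity is fixed. -/
theorem counit_weight {χ : Fin n → ℤ} (h : χ ≠ 0) (a : A) :
    Coalgebra.counit (R := O) (weight π χ a) = 0 := by
  have e := conj_torusPoint_hom_weight π (AddMonoidAlgebra.of O (Fin n → ℤ)) 1 χ a
  rw [mul_one, mul_inv_cancel, one_hom_apply] at e
  have := congrArg (fun y => y.coeff χ) e
  simpa [AddMonoidAlgebra.coeff_single, Finsupp.single_apply, h, eq_comm] using this.symm

end Weights

/-! ### The dynamic subgroups in terms of weights -/

section DynamicWeights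

variable {O : Type u} [CommRing O] {A : Type u} [CommRing A] [HopfAlgebra O A] {n : ℕ}
  (π : A →ₐc[O] SplitTorus O n) (μ : (Fin n → ℤ) →+ ℤ)
  {S : Type u} [CommRing S] [Algebra O S] {S' : Type u} [CommRing S'] [Algebra O S']

theorem conjPoint_hom_weight (x : Points O A S) (χ : Fin n → ℤ) (a : A) :
    (conjPoint π μ S x).hom (weight π χ a) =
      LaurentPolynomial.C (x.hom (weight π χ a)) * LaurentPolynomial.T (μ χ) :=
  conj_torusPoint_hom_weight π _ (constPoint S x) χ a

theorem eq_of_hom_weight {x y : Points O A S}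
    (h : ∀ χ a, x.hom (weight π χ a) = y.hom (weight π χ a)) : x = y := by
  apply ext_hom
  ext a
  rw [← sum_weight π a, map_sum, map_sum]
  exact Finset.sum_congr rfl fun χ _ => h χ a

/-- `Z_H(μ)` is the locus where the functions vanish on whose weight `μ` is nonzero. -/
theorem mem_centralizer_iff {x : Points O A S} :
    x ∈ centralizer π μ S ↔ ∀ χ, μ χ ≠ 0 → ∀ a, x.hom (weight π χ a) = 0 := by
  constructor
  · intro h χ hχ a
    have h1 : (conjPoint π μ S x).hom (weight π χ a) = LaurentPolynomial.C (x.hom (weight π χ a)) :=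
      congrArg (fun y : Points O A S[T;T⁻¹] => y.hom (weight π χ a)) h
    rw [conjPoint_hom_weight, ← LaurentPolynomial.single_eq_C_mul_T,
      ← LaurentPolynomial.single_eq_C] at h1
    have h2 := congrArg (fun q : S[T;T⁻¹] => q.coeff (μ χ)) h1
    simp only [AddMonoidAlgebra.coeff_single, Finsupp.single_apply, if_true, if_neg hχ.symm] at h2
    exact h2
  · intro h
    refine eq_of_hom_weight π fun χ a => ?_
    rw [conjPoint_hom_weight]
    change _ = LaurentPolynomial.C (x.hom (weight π χ a))
    by_cases hχ : μ χ = 0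
    · simp [hχ]
    · simp [h χ hχ a]

/-- The value at `μ(z) x μ(z)⁻¹` of a function of weight `χ` is `c z ^ μ(χ)`, so if this extends to
`z = 0`, it is a monomial or zero. -/
theorem hom_weight_of_polyToLaurent {x : Points O A S} {y : Points O A S[X]}
    (h : polyToLaurent S y = conjPoint π μ S x) (χ : Fin n → ℤ) (a : A) :
    y.hom (weight π χ a) =
      if 0 ≤ μ χ then Polynomial.monomial (μ χ).toNat (x.hom (weight π χ a)) else 0 := by
  have h1 : Polynomial.toLaurent (y.hom (weight π χ a)) =
      LaurentPolynomial.C (x.hom (weight π χ a)) * LaurentPolynomial.T (μ χ) := by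
    rw [← conjPoint_hom_weight, ← h]
    rfl
  rw [← LaurentPolynomial.trunc_C_mul_T, ← h1, Polynomial.trunc_toLaurent]

/-- `P_H(μ)` is the locus where the functions vanish on whose weight `μ` is negative. -/
theorem mem_parabolic_iff {x : Points O A S} :
    x ∈ parabolic π μ S ↔ ∀ χ, μ χ < 0 → ∀ a, x.hom (weight π χ a) = 0 := by
  constructor
  · rintro ⟨y, hy⟩ χ hχ a
    have h2 := hom_weight_of_polyToLaurent π μ hy χ a
    rw [if_neg hχ.not_ge] at h2
    have h1 : Polynomial.toLaurent (y.hom (weight π χ a)) =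
        LaurentPolynomial.C (x.hom (weight π χ a)) * LaurentPolynomial.T (μ χ) := by
      rw [← conjPoint_hom_weight, ← hy]
      rfl
    rw [h2, map_zero, ← LaurentPolynomial.single_eq_C_mul_T] at h1
    exact AddMonoidAlgebra.single_eq_zero.1 h1.symm
  · intro h
    have hr : ∀ a, (conjPoint π μ S x).hom a ∈
        ((Polynomial.toLaurentAlg (R := S)).restrictScalars O).range := by
      intro a
      rw [← sum_weight π a, map_sum]
      refine sum_mem fun χ _ => ?_
      rw [conjPoint_hom_weight]
      rcases lt_or_ge (μ χ) 0 with hχ | hχ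
      · rw [h χ hχ, map_zero, zero_mul]
        exact zero_mem _
      · refine ⟨Polynomial.C (x.hom (weight π χ a)) * Polynomial.X ^ (μ χ).toNat, ?_⟩
        change Polynomial.toLaurent _ = _
        rw [Polynomial.toLaurent_C_mul_X_pow, Int.toNat_of_nonneg hχ]
    let e := AlgEquiv.ofInjective ((Polynomial.toLaurentAlg (R := S)).restrictScalars O)
      Polynomial.toLaurent_injective
    refine ⟨mk ((e.symm : _ →ₐ[O] S[X]).comp ((conjPoint π μ S x).hom.codRestrict _ hr)), ?_⟩
    apply ext_hom
    ext a : 1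
    exact congrArg Subtype.val (e.apply_symm_apply ⟨(conjPoint π μ S x).hom a, hr a⟩)

/-- `U_H(μ)` is the locus where, in addition, the functions on whose weight `μ` is zero take their
values as at the identity. -/
theorem mem_unipotent_iff {x : Points O A S} :
    x ∈ unipotent π μ S ↔ (∀ χ, μ χ < 0 → ∀ a, x.hom (weight π χ a) = 0) ∧
      ∀ χ, μ χ = 0 → ∀ a,
        x.hom (weight π χ a) = algebraMap O S (Coalgebra.counit (weight π χ a)) := by
  constructor
  · rintro ⟨y, hy0, hy⟩
    refine ⟨(mem_parabolic_iff π μ).1 ⟨y, hy⟩, fun χ hχ a => ?_⟩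
    have h2 := hom_weight_of_polyToLaurent π μ hy χ a
    have h3 : Polynomial.aeval (0 : S) (y.hom (weight π χ a)) =
        algebraMap O S (Coalgebra.counit (weight π χ a)) := by
      rw [← one_hom_apply, ← MonoidHom.mem_ker.1 hy0]
      rfl
    rw [← h3, h2, hχ]
    simp
  · rintro ⟨h, h0⟩
    obtain ⟨y, hy⟩ := (mem_parabolic_iff π μ).2 h
    refine ⟨y, ?_, hy⟩
    refine MonoidHom.mem_ker.2 (eq_of_hom_weight π fun χ a => ?_)
    change Polynomial.aeval (0 : S) (y.hom (weight π χ a)) = _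
    rw [one_hom_apply, hom_weight_of_polyToLaurent π μ hy χ a]
    rcases lt_trichotomy (μ χ) 0 with hχ | hχ | hχ
    · have : χ ≠ 0 := by
        rintro rfl
        simp at hχ
      rw [if_neg hχ.not_ge, counit_weight π this, map_zero, map_zero]
    · simp [hχ, h0]
    · have : χ ≠ 0 := by
        rintro rfl
        simp at hχ
      have h' : (μ χ).toNat ≠ 0 := by omega
      rw [if_pos hχ.le, counit_weight π this, map_zero, Polynomial.aeval_monomial, zero_pow h',
        mul_zero]

/-- The Levi decomposition of `P_H(μ)`: the component in `Z_H(μ)` of a point `x` is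
`lim_{z → 0} μ(z) x μ(z)⁻¹`. -/
theorem exists_centralizer_mul_unipotent {x : Points O A S} (hx : x ∈ parabolic π μ S) :
    ∃ z ∈ centralizer π μ S, ∃ u ∈ unipotent π μ S, x = z * u := by
  obtain ⟨y, hy⟩ := hx
  have hz : evalZero S y ∈ centralizer π μ S := by
    rw [mem_centralizer_iff]
    intro χ hχ a
    change Polynomial.aeval (0 : S) (y.hom (weight π χ a)) = _
    rw [hom_weight_of_polyToLaurent π μ hy χ a]
    split_ifs with h0
    · have h' : (μ χ).toNat ≠ 0 := by omega
      rw [Polynomial.aeval_monomial, zero_pow h', mul_zero]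
    · exact map_zero _
  let c : Points O A S[X] := map (IsScalarTower.toAlgHom O S S[X]) (evalZero S y)
  have hc : polyToLaurent S c = constPoint S (evalZero S y) := by
    apply ext_hom
    ext a : 1
    exact Polynomial.toLaurent_C _
  have hc0 : evalZero S c = evalZero S y := by
    apply ext_hom
    ext a : 1
    exact Polynomial.aeval_C _ _
  refine ⟨evalZero S y, hz, (evalZero S y)⁻¹ * x, ?_, by group⟩
  refine ⟨c⁻¹ * y, ?_, ?_⟩
  · refine MonoidHom.mem_ker.2 ?_
    rw [map_mul, map_inv, hc0, inv_mul_cancel]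
  · rw [map_mul, map_inv, hc, map_mul, map_inv, hy]
    congr 2
    exact hz.symm

theorem centralizer_le_parabolic : centralizer π μ S ≤ parabolic π μ S := fun _ hx =>
  (mem_parabolic_iff π μ).2 fun χ hχ a => (mem_centralizer_iff π μ).1 hx χ hχ.ne a

theorem unipotent_le_parabolic : unipotent π μ S ≤ parabolic π μ S := fun _ hx =>
  (mem_parabolic_iff π μ).2 fun χ hχ a => ((mem_unipotent_iff π μ).1 hx).1 χ hχ a

/-- `Z_H(μ)` normalizes `U_H(μ)`. -/
theorem conj_mem_unipotent {z u : Points O A S} (hz : z ∈ centralizer π μ S)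
    (hu : u ∈ unipotent π μ S) : z⁻¹ * u * z ∈ unipotent π μ S := by
  obtain ⟨y, hy0, hy⟩ := hu
  let c : Points O A S[X] := map (IsScalarTower.toAlgHom O S S[X]) z
  have hc : polyToLaurent S c = conjPoint π μ S z := by
    refine Eq.trans ?_ (Eq.symm hz)
    apply ext_hom
    ext a : 1
    exact Polynomial.toLaurent_C _
  refine ⟨c⁻¹ * y * c, ?_, ?_⟩
  · refine MonoidHom.mem_ker.2 ?_
    rw [map_mul, map_mul, map_inv, MonoidHom.mem_ker.1 hy0, mul_one, inv_mul_cancel]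
  · rw [map_mul, map_mul, map_inv, map_mul, map_mul, map_inv, hc, hy]

theorem centralizer_inf_unipotent : centralizer π μ S ⊓ unipotent π μ S = ⊥ := by
  refine (Subgroup.eq_bot_iff_forall _).2 fun x hx => eq_of_hom_weight π fun χ a => ?_
  rw [one_hom_apply]
  by_cases hχ : μ χ = 0
  · exact ((mem_unipotent_iff π μ).1 hx.2).2 χ hχ a
  · have : χ ≠ 0 := by
      rintro rfl
      simp at hχ
    rw [(mem_centralizer_iff π μ).1 hx.1 χ hχ a, counit_weight π this, map_zero]

theorem unipotent_neg_inf_parabolic : unipotent π (-μ) S ⊓ parabolic π μ S = ⊥ := by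
  refine (Subgroup.eq_bot_iff_forall _).2 fun x hx => eq_of_hom_weight π fun χ a => ?_
  obtain ⟨h1, h2⟩ := (mem_unipotent_iff π (-μ)).1 hx.1
  simp only [AddMonoidHom.neg_apply, Left.neg_neg_iff, neg_eq_zero] at h1 h2
  rw [one_hom_apply]
  by_cases hχ : μ χ = 0
  · exact h2 χ hχ a
  · have : χ ≠ 0 := by
      rintro rfl
      simp at hχ
    rw [counit_weight π this, map_zero]
    rcases lt_or_gt_of_ne hχ with h | h
    · exact (mem_parabolic_iff π μ).1 hx.2 χ h a
    · exact h1 χ h a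

end DynamicWeights

/-! ### Homogeneous coordinates at the identity section -/

section Coordinates

variable {O : Type u} [CommRing O] {A : Type u} [CommRing A] [HopfAlgebra O A] {n : ℕ}
  (π : A →ₐc[O] SplitTorus O n)

/-- The augmentation ideal: the regular functions that vanish at the identity. -/
abbrev augmentation (O : Type u) [CommRing O] (A : Type u) [CommRing A] [HopfAlgebra O A] :
    Ideal A :=
  RingHom.ker (Bialgebra.counitAlgHom O A)

theorem mem_augmentation {a : A} : a ∈ augmentation O A ↔ Coalgebra.counit (R := O) a = 0 :=
  Iff.rfl

theorem weight_one : weight π 0 (1 : A) = 1 := by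
  change (coaction O A π 1).coeff 0 = 1
  rw [map_one]
  simp

theorem weight_mem_augmentation {a : A} (ha : a ∈ augmentation O A) (χ : Fin n → ℤ) :
    weight π χ a ∈ augmentation O A := by
  by_cases hχ : χ = 0
  · subst hχ
    have h := congrArg (Coalgebra.counit (R := O)) (sum_weight π a)
    rw [mem_augmentation.1 ha, map_sum] at h
    rw [mem_augmentation, ← h]
    by_cases h0 : (0 : Fin n → ℤ) ∈ weights π a
    · rw [Finset.sum_eq_single_of_mem 0 h0]
      exact fun χ _ hχ => counit_weight π hχ a
    · rw [weight_eq_zero h0, map_zero, Finset.sum_eq_zero]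
      intro χ hχ
      exact counit_weight π (fun h' => h0 (h' ▸ hχ)) a
  · exact counit_weight π hχ a

theorem sub_counit_mem (a : A) :
    a - algebraMap O A (Coalgebra.counit a) ∈ augmentation O A := by
  rw [mem_augmentation, map_sub, Bialgebra.counit_algebraMap, sub_self]

/-- Regular functions that vanish at the identity, are homogeneous for the torus, and whose classes
form a basis of the cotangent space at the identity, together with the dual basis of the tangent
space, viewed as point derivations at the identity. -/
structure Coordinates where
  ι : Type u
  [fintype : Fintype ι]
  [decEq : DecidableEq ι]
  wt : ι → (Fin n → ℤ)
  y : ι → A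
  weight_y : ∀ i, weight π (wt i) (y i) = y i
  y_mem : ∀ i, y i ∈ augmentation O A
  deriv : ι → A →ₗ[O] O
  deriv_mul : ∀ i a b, deriv i (a * b) = Coalgebra.counit (R := O) a * deriv i b +
    Coalgebra.counit (R := O) b * deriv i a
  deriv_y : ∀ i j, deriv i (y j) = if i = j then 1 else 0
  sub_sum_mem : ∀ a ∈ augmentation O A, a - ∑ i, deriv i a • y i ∈ augmentation O A ^ 2

attribute [instance] Coordinates.fintype Coordinates.decEq

/-- The cotangent space of a smooth group at the identity is a direct summand of a base change
of the module of differentials. -/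
theorem cotangent_projective_finite [Algebra.Smooth O A] :
    Module.Projective O (augmentation O A).Cotangent ∧
      Module.Finite O (augmentation O A).Cotangent := by
  let : Algebra A O := (Bialgebra.counitAlgHom O A).toRingHom.toAlgebra
  have : IsScalarTower O A O := IsScalarTower.of_algebraMap_eq fun c => by
    change c = Bialgebra.counitAlgHom O A (algebraMap O A c)
    rw [AlgHom.commutes]
    rfl
  have hs : Function.Surjective (algebraMap A O) := fun c =>
    ⟨algebraMap O A c, (Bialgebra.counitAlgHom O A).commutes c⟩
  obtain ⟨l, hl⟩ := (Algebra.FormallySmooth.iff_split_injection (R := O) (P := A) (A := O) hs).1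
    inferInstance
  have hl' : (l.restrictScalars O).comp
      ((KaehlerDifferential.kerCotangentToTensor O A O).restrictScalars O) = LinearMap.id :=
    LinearMap.ext fun z => LinearMap.congr_fun hl z
  have h1 : Module.Projective O (TensorProduct A O Ω[A⁄O]) := inferInstance
  have h2 : Module.Finite O (TensorProduct A O Ω[A⁄O]) := inferInstance
  exact ⟨Module.Projective.of_split _ _ hl', Module.Finite.of_surjective (l.restrictScalars O)
    fun z => ⟨_, LinearMap.congr_fun hl z⟩⟩

/-- Over a local ring, the cotangent space at the identity is free, and it is spanned by the classes
of homogeneous functions; so some of these classes form a basis. -/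
theorem nonempty_coordinates [IsLocalRing O] [Algebra.Smooth O A] :
    Nonempty (Coordinates π) := by
  classical
  obtain ⟨hproj, hfin⟩ := cotangent_projective_finite (O := O) (A := A)
  have hfp : Module.FinitePresentation O (augmentation O A).Cotangent :=
    Module.finitePresentation_of_projective _ _
  let v : augmentation O A × (Fin n → ℤ) → (augmentation O A).Cotangent := fun q =>
    (augmentation O A).toCotangent ⟨weight π q.2 q.1, weight_mem_augmentation π q.1.2 q.2⟩
  have hv : Submodule.span O (Set.range v) = ⊤ := by
    refine eq_top_iff.2 fun z _ => ?_
    obtain ⟨a, rfl⟩ := (augmentation O A).toCotangent_surjective z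
    have ha : a = ∑ χ ∈ weights π (a : A), ⟨weight π χ a, weight_mem_augmentation π a.2 χ⟩ := by
      apply Subtype.ext
      rw [AddSubmonoidClass.coe_finsetSum]
      exact (sum_weight π (a : A)).symm
    rw [ha, map_sum]
    exact sum_mem fun χ _ => Submodule.subset_span ⟨(a, χ), rfl⟩
  obtain ⟨κ, q, b, hb⟩ := Module.exists_basis_of_span_of_flat v hv
  have := Module.Finite.finite_basis b
  have : Fintype κ := Fintype.ofFinite κ
  let τ : augmentation O A →ₗ[O] (augmentation O A).Cotangent :=
    (augmentation O A).toCotangent.restrictScalars O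
  -- the projection of the coordinate ring to the augmentation ideal
  let δ : A →ₗ[O] augmentation O A :=
    LinearMap.codRestrict ((augmentation O A).restrictScalars O)
      (LinearMap.id - (Algebra.linearMap O A).comp Coalgebra.counit) fun a => sub_counit_mem a
  have hδ : ∀ a : augmentation O A, δ a = a := fun a => Subtype.ext <| by
    change (a : A) - algebraMap O A (Coalgebra.counit (a : A)) = a
    rw [mem_augmentation.1 a.2, map_zero, sub_zero]
  -- modulo the square of the augmentation ideal, this projection is a derivation
  have hτ : ∀ a b : A, τ (δ (a * b)) = Coalgebra.counit (R := O) a • τ (δ b) +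
      Coalgebra.counit (R := O) b • τ (δ a) := by
    intro a b
    rw [← map_smul τ, ← map_smul τ, ← map_add τ]
    refine (Ideal.toCotangent_eq _).2 ?_
    have : ((δ (a * b) : augmentation O A) : A) -
        ((Coalgebra.counit (R := O) a • δ b + Coalgebra.counit (R := O) b • δ a :
          augmentation O A) : A) = (δ a : A) * (δ b : A) := by
      change a * b - algebraMap O A (Coalgebra.counit (a * b)) -
        (Coalgebra.counit (R := O) a • (b - algebraMap O A (Coalgebra.counit b)) +
        Coalgebra.counit (R := O) b • (a - algebraMap O A (Coalgebra.counit a))) =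
        (a - algebraMap O A (Coalgebra.counit a)) * (b - algebraMap O A (Coalgebra.counit b))
      rw [Algebra.smul_def, Algebra.smul_def, Bialgebra.counit_mul, map_mul]
      ring
    rw [this, sq]
    exact Ideal.mul_mem_mul (δ a).2 (δ b).2
  refine ⟨{
    ι := κ
    wt := fun i => (q i).2
    y := fun i => weight π (q i).2 (q i).1
    weight_y := fun i => weight_weight_self π _ _
    y_mem := fun i => weight_mem_augmentation π (q i).1.2 _
    deriv := fun i => (b.coord i).comp (τ.comp δ)
    deriv_mul := fun i a c => ?_
    deriv_y := fun i j => ?_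
    sub_sum_mem := fun a ha => ?_ }⟩
  · simp only [LinearMap.comp_apply]
    rw [hτ, map_add, map_smul, map_smul, smul_eq_mul, smul_eq_mul]
  · simp only [LinearMap.comp_apply]
    have h : τ (δ (weight π (q j).2 (q j).1)) = b j := by
      rw [hb]
      exact congrArg τ (hδ ⟨_, weight_mem_augmentation π (q j).1.2 _⟩)
    rw [h, Module.Basis.coord_apply, Module.Basis.repr_self, Finsupp.single_apply]
    simp only [eq_comm]
  · have h := b.sum_repr (τ (δ a))
    have h1 : δ a = ⟨a, ha⟩ := hδ ⟨a, ha⟩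
    have h2 : (augmentation O A).toCotangent (⟨a, ha⟩ - ∑ i, b.coord i (τ (δ a)) •
        ⟨weight π (q i).2 (q i).1, weight_mem_augmentation π (q i).1.2 _⟩) = 0 := by
      change τ _ = 0
      rw [map_sub, map_sum, sub_eq_zero, ← h1, ← h]
      refine Finset.sum_congr rfl fun i _ => ?_
      rw [map_smul, h, hb]
      rfl
    rw [Ideal.toCotangent_eq_zero] at h2
    convert h2 using 1
    rw [AddSubgroupClass.coe_sub, AddSubmonoidClass.coe_finsetSum]
    rfl

variable {π} in
theorem Coordinates.deriv_one (C : Coordinates π) (i : C.ι) : C.deriv i 1 = 0 := by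
  have h := C.deriv_mul i 1 1
  rw [Bialgebra.counit_one, one_mul, one_mul] at h
  exact left_eq_add.1 h

end Coordinates

/-! ### Formal points with prescribed coordinates -/

section FormalPoints

variable {O : Type u} [CommRing O] {A : Type u} [CommRing A] [HopfAlgebra O A] {n : ℕ}
  {π : A →ₐc[O] SplitTorus O n}

/-- A point that is infinitesimally near to the identity can be lifted, by smoothness, and the
lift can be corrected by a point derivation, so as to have prescribed coordinates. -/
theorem Coordinates.exists_lift [Algebra.FormallySmooth O A] (C : Coordinates π)
    {S : Type u} [CommRing S] [Algebra O S] {S' : Type u} [CommRing S'] [Algebra O S']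
    (f : S →ₐ[O] S') (hf : Function.Surjective f) (M : Ideal S)
    (hM : ∀ u ∈ M, ∀ v, f v = 0 → u * v = 0) (hk : ∀ v, f v = 0 → v ∈ M)
    (x' : A →ₐ[O] S')
    (hx' : ∀ a s, f s = x' a → s - algebraMap O S (Coalgebra.counit a) ∈ M)
    (c : C.ι → S) (hc : ∀ i, f (c i) = x' (C.y i)) :
    ∃ x : A →ₐ[O] S, f.comp x = x' ∧ ∀ i, x (C.y i) = c i := by
  have hnil : IsNilpotent (RingHom.ker (f : S →+* S')) := by
    refine ⟨2, ?_⟩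
    rw [sq, Ideal.zero_eq_bot, eq_bot_iff, Ideal.mul_le]
    exact fun r hr s hs => hM r (hk r hr) s hs
  let x₀ := Algebra.FormallySmooth.liftOfSurjective x' f hf hnil
  have hx₀ : ∀ a, f (x₀ a) = x' a := Algebra.FormallySmooth.liftOfSurjective_apply x' f hf hnil
  let e : C.ι → S := fun i => c i - x₀ (C.y i)
  have he : ∀ i, f (e i) = 0 := fun i => by rw [map_sub, hc, hx₀, sub_self]
  -- the correction of the lift, which moves the coordinates by `e`
  let δ : A →ₗ[O] S := ∑ i, (C.deriv i).smulRight (e i)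
  have hδ : ∀ a, δ a = ∑ i, C.deriv i a • e i := fun a => by simp [δ]
  have hδ0 : ∀ a, f (δ a) = 0 := fun a => by
    rw [hδ, map_sum]
    exact Finset.sum_eq_zero fun i _ => by rw [map_smul, he, smul_zero]
  have hmul : ∀ a b, x₀ a * δ b = Coalgebra.counit (R := O) a • δ b := by
    intro a b
    rw [Algebra.smul_def, ← sub_eq_zero, ← sub_mul]
    exact hM _ (hx' a _ (hx₀ a)) _ (hδ0 b)
  refine ⟨AlgHom.ofLinearMap (x₀.toLinearMap + δ) ?_ ?_, ?_, ?_⟩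
  · rw [LinearMap.add_apply, AlgHom.toLinearMap_apply, map_one, hδ]
    simp [C.deriv_one]
  · intro a b
    have h1 : δ (a * b) =
        Coalgebra.counit (R := O) a • δ b + Coalgebra.counit (R := O) b • δ a := by
      simp only [hδ, C.deriv_mul, Finset.smul_sum, add_smul, Finset.sum_add_distrib, smul_smul]
    have h2 : δ a * δ b = 0 := hM _ (hk _ (hδ0 a)) _ (hδ0 b)
    simp only [LinearMap.add_apply, AlgHom.toLinearMap_apply, map_mul, h1, mul_add, add_mul, h2,
      hmul, mul_comm (δ a) (x₀ b)]
    ring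
  · ext a
    change f (x₀ a + δ a) = x' a
    rw [map_add, hx₀, hδ0, add_zero]
  · intro i
    change x₀ (C.y i) + δ (C.y i) = c i
    simp [hδ, C.deriv_y, e]

/-- The formal group of `H` at the identity is formally an affine space, with the given coordinates:
a compatible system of points modulo the powers of an ideal, with prescribed coordinates in that
ideal. -/
theorem Coordinates.exists_formalPoint [Algebra.FormallySmooth O A] (C : Coordinates π)
    {P : Type u} [CommRing P] [Algebra O P] (J : Ideal P) (c : C.ι → P) (hc : ∀ i, c i ∈ J) :
    ∃ x : ∀ k : ℕ, A →ₐ[O] P ⧸ J ^ (k + 1),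
      (∀ k, (Ideal.Quotient.factorₐ O (Ideal.pow_le_pow_right (k + 1).le_succ)).comp (x (k + 1)) =
        x k) ∧
      (∀ k i, x k (C.y i) = Ideal.Quotient.mk _ (c i)) ∧
      ∀ k a p, Ideal.Quotient.mk _ p = x k a → p - algebraMap O P (Coalgebra.counit a) ∈ J := by
  let X : ∀ k : ℕ, Type u := fun k => {x : A →ₐ[O] P ⧸ J ^ (k + 1) //
    (∀ i, x (C.y i) = Ideal.Quotient.mk _ (c i)) ∧
      ∀ a p, Ideal.Quotient.mk _ p = x a → p - algebraMap O P (Coalgebra.counit a) ∈ J}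
  have h0 : Nonempty (X 0) := by
    refine ⟨(Algebra.ofId O _).comp (Bialgebra.counitAlgHom O A), fun i => ?_, fun a p hp => ?_⟩
    · have h1 : Bialgebra.counitAlgHom O A (C.y i) = 0 := C.y_mem i
      rw [AlgHom.comp_apply, h1, map_zero, eq_comm, Ideal.Quotient.eq_zero_iff_mem]
      simpa using hc i
    · have h1 : Ideal.Quotient.mk (J ^ (0 + 1)) p =
          Ideal.Quotient.mk _ (algebraMap O P (Coalgebra.counit a)) := hp
      rw [Ideal.Quotient.eq] at h1
      simpa using h1
  have hstep : ∀ k (x : X k), ∃ x' : X (k + 1),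
      (Ideal.Quotient.factorₐ O (Ideal.pow_le_pow_right (k + 1).le_succ)).comp x'.1 = x.1 := by
    rintro k ⟨x, hx1, hx2⟩
    let f : P ⧸ J ^ (k + 1 + 1) →ₐ[O] P ⧸ J ^ (k + 1) :=
      Ideal.Quotient.factorₐ O (Ideal.pow_le_pow_right (k + 1).le_succ)
    have hf : ∀ q : P,
        f (Ideal.Quotient.mk (J ^ (k + 1 + 1)) q) = Ideal.Quotient.mk (J ^ (k + 1)) q :=
      fun _ => rfl
    have hM : ∀ u ∈ J.map (Ideal.Quotient.mk (J ^ (k + 1 + 1))), ∀ v,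
        f v = 0 → u * v = 0 := by
      intro u hu v hv
      obtain ⟨v, rfl⟩ := Ideal.Quotient.mk_surjective v
      rw [hf, Ideal.Quotient.eq_zero_iff_mem] at hv
      obtain ⟨u, hu', rfl⟩ := (Ideal.mem_map_iff_of_surjective _ Ideal.Quotient.mk_surjective).1 hu
      rw [← map_mul, Ideal.Quotient.eq_zero_iff_mem, pow_succ']
      exact Ideal.mul_mem_mul hu' hv
    have hk : ∀ v, f v = 0 →
        v ∈ J.map (Ideal.Quotient.mk (J ^ (k + 1 + 1))) := by
      intro v hv
      obtain ⟨v, rfl⟩ := Ideal.Quotient.mk_surjective v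
      rw [hf, Ideal.Quotient.eq_zero_iff_mem] at hv
      exact Ideal.mem_map_of_mem _ (Ideal.pow_le_self k.succ_ne_zero hv)
    obtain ⟨x', h1, h2⟩ := C.exists_lift f
      (Ideal.Quotient.factor_surjective (Ideal.pow_le_pow_right (k + 1).le_succ))
      (J.map (Ideal.Quotient.mk (J ^ (k + 1 + 1)))) hM hk x
      (fun a s hs => by
        obtain ⟨s, rfl⟩ := Ideal.Quotient.mk_surjective s
        exact Ideal.mem_map_of_mem (Ideal.Quotient.mk (J ^ (k + 1 + 1))) (hx2 a s hs))
      (fun i => Ideal.Quotient.mk _ (c i)) (fun i => (hx1 i).symm)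
    refine ⟨⟨x', h2, fun a p hp => hx2 a p ?_⟩, h1⟩
    rw [← h1, AlgHom.comp_apply, ← hp, hf]
  choose next hnext using hstep
  let x : ∀ k, X k := fun k => Nat.rec h0.some next k
  exact ⟨fun k => (x k).1, fun k => hnext k (x k), fun k => (x k).2.1, fun k => (x k).2.2⟩

/-- Homogeneous form of `𝔪 = ⟨y_i⟩ + 𝔪²` for the augmentation ideal `𝔪`: its part of weight `χ` is
contained in a submodule that contains the coordinates of weight `χ`, and the products of weight `χ`
of two homogeneous functions. -/
theorem Coordinates.weight_mem (C : Coordinates π) {χ : Fin n → ℤ} (K : Submodule O A)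
    (h1 : ∀ i, C.wt i = χ → C.y i ∈ K)
    (h2 : ∀ ψ ψ', ψ + ψ' = χ → ∀ b ∈ augmentation O A, ∀ c ∈ augmentation O A,
      weight π ψ b * weight π ψ' c ∈ K) :
    ∀ a ∈ augmentation O A, weight π χ a ∈ K := by
  intro a ha
  have hsq : ∀ z ∈ augmentation O A ^ 2, weight π χ z ∈ K := by
    intro z hz
    rw [sq] at hz
    refine Submodule.mul_induction_on hz (fun b hb c hc => ?_) fun b c hb hc => ?_
    · rw [← sum_weight π b, ← sum_weight π c, Finset.sum_mul_sum, map_sum]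
      refine sum_mem fun ψ _ => ?_
      rw [map_sum]
      refine sum_mem fun ψ' _ => ?_
      rw [← weight_mul_weight, weight_weight]
      split_ifs with h
      · rw [weight_mul_weight]
        exact h2 ψ ψ' h.symm b hb c hc
      · exact zero_mem _
    · rw [map_add]
      exact add_mem hb hc
  have h := hsq _ (C.sub_sum_mem a ha)
  rw [map_sub, map_sum] at h
  refine (Submodule.sub_mem_iff_left _ (sum_mem fun i _ => ?_)).1 h
  rw [map_smul]
  refine K.smul_mem _ ?_
  rw [← C.weight_y, weight_weight]
  split_ifs with h'
  · rw [C.weight_y]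
    exact h1 i h'.symm
  · exact zero_mem _

/-- Suppose that `Q` is a set of weights such that, when a sum of two weights lies in it, so does
one of the summands. If a point near to the identity kills the coordinates with weight in `Q`, it
kills all homogeneous functions with weight in `Q` that vanish at the identity. -/
theorem Coordinates.hom_weight_eq_zero (C : Coordinates π) {Q : (Fin n → ℤ) → Prop}
    (hQ : ∀ ψ ψ', Q (ψ + ψ') → Q ψ ∨ Q ψ') {S : Type u} [CommRing S] [Algebra O S]
    (M : Ideal S) (hM : ∀ s, (∀ k, s ∈ M ^ k) → s = 0) (x : Points O A S)
    (hx : ∀ a ∈ augmentation O A, x.hom a ∈ M) (hy : ∀ i, Q (C.wt i) → x.hom (C.y i) = 0)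
    {χ : Fin n → ℤ} (hχ : Q χ) {a : A} (ha : a ∈ augmentation O A) :
    x.hom (weight π χ a) = 0 := by
  refine hM _ fun k => ?_
  induction k generalizing χ a with
  | zero => simp
  | succ k ih =>
    refine C.weight_mem (((M ^ (k + 1)).restrictScalars O).comap x.hom.toLinearMap) ?_ ?_ a ha
    · intro i hi
      change x.hom (C.y i) ∈ M ^ (k + 1)
      rw [hy i (hi ▸ hχ)]
      exact zero_mem _
    · intro ψ ψ' hψ b hb c hc
      change x.hom (_ * _) ∈ M ^ (k + 1)
      rw [map_mul]
      rcases hQ ψ ψ' (hψ ▸ hχ) with h | h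
      · rw [pow_succ]
        exact Ideal.mul_mem_mul (ih h hb) (hx _ (weight_mem_augmentation π hc ψ'))
      · rw [pow_succ']
        exact Ideal.mul_mem_mul (hx _ (weight_mem_augmentation π hb ψ)) (ih h hc)

/-- For the augmentation ideal, the conditions that define `U_H(μ)` become the vanishing of all
functions whose weight is not positive. -/
theorem mem_unipotent_of_augmentation (μ : (Fin n → ℤ) →+ ℤ) {S : Type u} [CommRing S]
    [Algebra O S] {x : Points O A S}
    (h : ∀ χ, μ χ ≤ 0 → ∀ a ∈ augmentation O A, x.hom (weight π χ a) = 0) :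
    x ∈ unipotent π μ S := by
  have h' : ∀ χ, μ χ ≤ 0 → ∀ a,
      x.hom (weight π χ a) = algebraMap O S (Coalgebra.counit (weight π χ a)) := by
    intro χ hχ a
    by_cases h0 : χ = 0
    · subst h0
      set c : O := Coalgebra.counit (weight π 0 a)
      have h1 := h 0 hχ (weight π 0 a - algebraMap O A c) (sub_counit_mem _)
      rw [map_sub, weight_weight_self, Algebra.algebraMap_eq_smul_one, map_smul, weight_one,
        ← Algebra.algebraMap_eq_smul_one, map_sub, AlgHom.commutes, sub_eq_zero] at h1
      exact h1
    · rw [counit_weight π h0, map_zero]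
      rw [← weight_weight_self]
      exact h χ hχ _ (counit_weight π h0 a)
  refine (mem_unipotent_iff π μ).2 ⟨fun χ hχ a => ?_, fun χ hχ a => h' χ hχ.le a⟩
  have h0 : χ ≠ 0 := by
    rintro rfl
    simp at hχ
  rw [h' χ hχ.le, counit_weight π h0, map_zero]

theorem hom_weight_of_mem_unipotent {μ : (Fin n → ℤ) →+ ℤ} {S : Type u} [CommRing S]
    [Algebra O S] {x : Points O A S} (hx : x ∈ unipotent π μ S) {χ : Fin n → ℤ} (hχ : μ χ ≤ 0)
    {a : A} (ha : a ∈ augmentation O A) : x.hom (weight π χ a) = 0 := by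
  obtain ⟨h1, h2⟩ := (mem_unipotent_iff π μ).1 hx
  rcases hχ.lt_or_eq with h | h
  · exact h1 χ h a
  · rw [h2 χ h, mem_augmentation.1 (weight_mem_augmentation π ha χ), map_zero]

/-- `U_H(μ)` is an affine space, with the coordinates of positive weight: hence all of its points
can be lifted along surjections. -/
theorem Coordinates.exists_unipotent_lift [Algebra.FormallySmooth O A] (C : Coordinates π)
    (μ : (Fin n → ℤ) →+ ℤ) {S : Type u} [CommRing S] [Algebra O S] {S' : Type u} [CommRing S']
    [Algebra O S'] (f : S →ₐ[O] S') (hf : Function.Surjective f) {u : Points O A S'}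
    (hu : u ∈ unipotent π μ S') : ∃ v ∈ unipotent π μ S, map f v = u := by
  classical
  let ι' := {i : C.ι // 0 < μ (C.wt i)}
  let ev : MvPolynomial ι' O →ₐ[O] A := MvPolynomial.aeval fun i => C.y i
  -- The ideal of `U_H(μ)`.
  let 𝔮 : Ideal A := Ideal.span {b | ∃ χ, μ χ ≤ 0 ∧ ∃ a ∈ augmentation O A, b = weight π χ a}
  have h𝔮 : ∀ {χ}, μ χ ≤ 0 → ∀ {a}, a ∈ augmentation O A → weight π χ a ∈ 𝔮 :=
    fun hχ a ha => Ideal.subset_span ⟨_, hχ, a, ha, rfl⟩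
  have kill : ∀ {T : Type u} [CommRing T] [Algebra O T] {x : Points O A T},
      x ∈ unipotent π μ T → ∀ b ∈ 𝔮, x.hom b = 0 := by
    intro T _ _ x hx b hb
    have : 𝔮 ≤ RingHom.ker x.hom := by
      refine Ideal.span_le.2 ?_
      rintro _ ⟨χ, hχ, a, ha, rfl⟩
      exact hom_weight_of_mem_unipotent hx hχ ha
    exact this hb
  let q : MvPolynomial ι' O →ₐ[O] A ⧸ 𝔮 := (Ideal.Quotient.mkₐ O 𝔮).comp ev
  -- Surjectivity: by induction on the weight, from `𝔪 = ⟨y_i⟩ + 𝔪²`.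
  have hsurj : Function.Surjective q := by
    let K : Subalgebra O A := q.range.comap (Ideal.Quotient.mkₐ O 𝔮)
    have hK𝔮 : ∀ b ∈ 𝔮, b ∈ K := fun b hb => ⟨0, by
      rw [map_zero]
      exact (Ideal.Quotient.eq_zero_iff_mem.2 hb).symm⟩
    have hw : ∀ k : ℕ, ∀ χ, μ χ < k → ∀ a ∈ augmentation O A, weight π χ a ∈ K := by
      intro k
      induction k with
      | zero => exact fun χ hχ a ha => hK𝔮 _ (h𝔮 (by simpa using hχ.le) ha)
      | succ k ih =>
        intro χ hχ a ha
        refine C.weight_mem (Subalgebra.toSubmodule K) (fun i hi => ?_) ?_ a ha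
        · by_cases hi' : 0 < μ (C.wt i)
          · exact ⟨MvPolynomial.X ⟨i, hi'⟩, by simp [q, ev]⟩
          · rw [← C.weight_y]
            exact hK𝔮 _ (h𝔮 (not_lt.1 hi') (C.y_mem i))
        · intro ψ ψ' hψ b hb c hc
          change _ ∈ K
          have hsum : μ ψ + μ ψ' = μ χ := by rw [← map_add, hψ]
          push_cast at hχ
          by_cases h1 : μ ψ ≤ 0
          · exact hK𝔮 _ (Ideal.mul_mem_right _ _ (h𝔮 h1 hb))
          by_cases h2 : μ ψ' ≤ 0
          · exact hK𝔮 _ (Ideal.mul_mem_left _ _ (h𝔮 h2 hc))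
          exact mul_mem (ih ψ (by omega) b hb) (ih ψ' (by omega) c hc)
    intro z
    obtain ⟨a, rfl⟩ := Ideal.Quotient.mk_surjective z
    have ha : a - algebraMap O A (Coalgebra.counit a) ∈ K := by
      rw [← sum_weight π (a - algebraMap O A (Coalgebra.counit a))]
      refine sum_mem fun χ _ => hw ((μ χ).toNat + 1) χ ?_ _ (sub_counit_mem a)
      push_cast
      have := Int.self_le_toNat (μ χ)
      omega
    have ha' : a ∈ K := by simpa using add_mem ha (K.algebraMap_mem (Coalgebra.counit a))
    exact ha'
  -- Injectivity: test on the formal point whose coordinates are the variables.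
  have hinj : Function.Injective q := by
    refine (injective_iff_map_eq_zero q).2 fun P hP => ?_
    have hP' : ev P ∈ 𝔮 := Ideal.Quotient.eq_zero_iff_mem.1 hP
    let J := MvPolynomial.idealOfVars ι' O
    obtain ⟨x, -, hx, hx'⟩ := C.exists_formalPoint J
      (fun i => if h : 0 < μ (C.wt i) then MvPolynomial.X ⟨i, h⟩ else 0) fun i => by
        split_ifs
        · exact Ideal.subset_span ⟨_, rfl⟩
        · exact zero_mem _
    have hPk : ∀ k, P ∈ J ^ (k + 1) := by
      intro k
      have hU : Points.mk (x k) ∈ unipotent π μ (MvPolynomial ι' O ⧸ J ^ (k + 1)) := by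
        refine mem_unipotent_of_augmentation μ fun χ hχ a ha => ?_
        refine C.hom_weight_eq_zero (Q := fun χ => μ χ ≤ 0) (fun ψ ψ' h => ?_)
          (J.map (Ideal.Quotient.mk _)) (fun s hs => ?_) _ (fun a ha => ?_) (fun i hi => ?_) hχ ha
        · rw [map_add] at h
          omega
        · have := hs (k + 1)
          rw [← Ideal.map_pow] at this
          simpa using this
        · obtain ⟨s, hs⟩ := Ideal.Quotient.mk_surjective (x k a)
          change x k a ∈ _
          rw [← hs]
          have := hx' k a s hs
          rw [mem_augmentation.1 ha, map_zero, sub_zero] at this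
          exact Ideal.mem_map_of_mem _ this
        · refine (hx k i).trans ?_
          rw [dif_neg (not_lt.2 hi), map_zero]
      have h1 := kill hU (ev P) hP'
      have h2 : (x k).comp ev = Ideal.Quotient.mkₐ O (J ^ (k + 1)) := by
        refine MvPolynomial.algHom_ext fun i => ?_
        rw [AlgHom.comp_apply, MvPolynomial.aeval_X, hx, dif_pos i.2]
        rfl
      have h3 : Ideal.Quotient.mkₐ O (J ^ (k + 1)) P = 0 := by
        rw [← h2]
        exact h1
      exact Ideal.Quotient.eq_zero_iff_mem.1 h3
    ext m
    exact MvPolynomial.mem_pow_idealOfVars_iff' _ _ |>.1 (hPk m.degree) m (Nat.lt_succ_self _)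
  let e : MvPolynomial ι' O ≃ₐ[O] A ⧸ 𝔮 := AlgEquiv.ofBijective q ⟨hinj, hsurj⟩
  let ubar : A ⧸ 𝔮 →ₐ[O] S' := Ideal.Quotient.liftₐ 𝔮 u.hom (kill hu)
  choose c hc using fun i => hf (ubar (e (MvPolynomial.X i)))
  let v : Points O A S :=
    Points.mk ((MvPolynomial.aeval c).comp ((e.symm : _ →ₐ[O] _).comp (Ideal.Quotient.mkₐ O 𝔮)))
  refine ⟨v, ?_, ?_⟩
  · refine mem_unipotent_of_augmentation μ fun χ hχ a ha => ?_
    change MvPolynomial.aeval c (e.symm (Ideal.Quotient.mk 𝔮 _)) = 0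
    rw [Ideal.Quotient.eq_zero_iff_mem.2 (h𝔮 hχ ha), map_zero, map_zero]
  · have h : f.comp (MvPolynomial.aeval c) = ubar.comp (e : _ →ₐ[O] _) := by
      refine MvPolynomial.algHom_ext fun i => ?_
      rw [AlgHom.comp_apply, MvPolynomial.aeval_X, hc]
      rfl
    apply ext_hom
    ext a
    change f (MvPolynomial.aeval c (e.symm (Ideal.Quotient.mk 𝔮 a))) = _
    refine (AlgHom.congr_fun h _).trans ?_
    change ubar (e (e.symm (Ideal.Quotient.mk 𝔮 a))) = _
    rw [AlgEquiv.apply_symm_apply]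
    rfl

end FormalPoints
end Points

/-! ### Compact `p`-adic rings -/

/-- The topology of `O` is the `p`-adic one, and `p` is neither a unit nor a zero divisor. -/
structure IsPAdicRing (p : ℕ) (O : Type u) [CommRing O] [TopologicalSpace O] : Prop where
  eq_of_mul_eq : ∀ x y : O, (p : O) * x = p * y → x = y
  not_isUnit : ¬ IsUnit (p : O)
  exists_pow_dvd : ∀ U ∈ nhds (0 : O), ∃ k : ℕ, ∀ x : O, (p : O) ^ k ∣ x → x ∈ U
  isOpen_dvd : ∀ k : ℕ, IsOpen {x : O | (p : O) ^ k ∣ x}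

namespace IsPAdicRing

variable {p : ℕ} {O : Type u} [CommRing O] [TopologicalSpace O] (hO : IsPAdicRing p O)

include hO

theorem dvd_of_mul_dvd {k : ℕ} {x : O} (h : (p : O) ^ (k + 1) ∣ p * x) : (p : O) ^ k ∣ x := by
  obtain ⟨y, hy⟩ := h
  exact ⟨y, hO.eq_of_mul_eq _ _ (by rw [hy]; ring)⟩

theorem eq_zero_of_forall_dvd [T2Space O] {x : O} (h : ∀ k, (p : O) ^ k ∣ x) : x = 0 := by
  by_contra hx
  obtain ⟨k, hk⟩ := hO.exists_pow_dvd {x}ᶜ (isOpen_compl_singleton.mem_nhds (Ne.symm hx))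
  exact hk x (h k) rfl

theorem isClosed_dvd [IsTopologicalRing O] (k : ℕ) : IsClosed {x : O | (p : O) ^ k ∣ x} := by
  have : {x : O | (p : O) ^ k ∣ x} =
      ((Ideal.span {(p : O) ^ k}).toAddSubgroup : Set O) := by
    ext x
    exact Ideal.mem_span_singleton.symm
  rw [this]
  refine AddSubgroup.isClosed_of_isOpen _ ?_
  rw [← this]
  exact hO.isOpen_dvd k

/-- By compactness: a compatible sequence of residues is the intersection of a sequence of closed
sets. -/
theorem isAdicComplete [IsTopologicalRing O] [CompactSpace O] [T2Space O] :
    IsAdicComplete (Ideal.span {(p : O)}) O := by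
  have hmem : ∀ k (x : O), x ∈ (Ideal.span {(p : O)} ^ k • ⊤ : Submodule O O) ↔
      (p : O) ^ k ∣ x := by
    intro k x
    rw [Ideal.smul_top_eq_map]
    simp [Ideal.span_singleton_pow, Ideal.mem_span_singleton]
  have haus : IsHausdorff (Ideal.span {(p : O)}) O := ⟨fun x hx =>
    hO.eq_zero_of_forall_dvd fun k => by
      rw [← hmem]
      exact SModEq.zero.1 (hx k)⟩
  have prec : IsPrecomplete (Ideal.span {(p : O)}) O := ⟨fun f hf => by
    let V : ℕ → Set O := fun k => {x | (p : O) ^ k ∣ f k - x}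
    have hV : ∀ k, V (k + 1) ⊆ V k := by
      intro k x hx
      have h1 : (p : O) ^ k ∣ f k - f (k + 1) := by
        rw [← hmem]
        exact SModEq.sub_mem.1 (hf k.le_succ)
      have h2 := dvd_add h1 ((pow_dvd_pow (p : O) k.le_succ).trans hx)
      rwa [sub_add_sub_cancel] at h2
    have hc : ∀ k, IsClosed (V k) := fun k =>
      (hO.isClosed_dvd k).preimage (continuous_const.sub continuous_id)
    obtain ⟨x, hx⟩ := (hc 0).isCompact.nonempty_iInter_of_sequence_nonempty_isCompact_isClosed V hV
      (fun k => ⟨f k, by simp [V]⟩) hc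
    refine ⟨x, fun k => SModEq.sub_mem.2 ?_⟩
    rw [hmem]
    exact Set.mem_iInter.1 hx k⟩
  exact ⟨⟩

end IsPAdicRing

section RingOfIntegers

variable (p : ℕ) [Fact p.Prime] (L : Type u) [NormedField L] [IsUltrametricDist L]
  [NormedAlgebra ℚ_[p] L]

theorem norm_natCast_p (p : ℕ) [Fact p.Prime] (L : Type u) [NormedField L]
    [NormedAlgebra ℚ_[p] L] :
    ‖(p : L)‖ = (p : ℝ)⁻¹ := by
  have h : (p : L) = algebraMap ℚ_[p] L p := by simp
  rw [h, norm_algebraMap', Padic.norm_p]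

omit [IsUltrametricDist L] in
theorem natCast_p_ne_zero : (p : L) ≠ 0 := by
  have hp : (0 : ℝ) < p := Nat.cast_pos.2 (Fact.out : p.Prime).pos
  rw [← norm_pos_iff, norm_natCast_p p L]
  positivity

theorem RingOfIntegers.pow_dvd_iff (k : ℕ) (x : RingOfIntegers L) :
    (p : RingOfIntegers L) ^ k ∣ x ↔ ‖(x : L)‖ ≤ ‖(p : L)‖ ^ k := by
  have hp := natCast_p_ne_zero p L
  constructor
  · rintro ⟨z, rfl⟩
    have hz : ‖(z : L)‖ ≤ 1 := z.2
    simpa using mul_le_of_le_one_right (pow_nonneg (norm_nonneg (p : L)) k) hz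
  · intro h
    refine ⟨⟨(x : L) / (p : L) ^ k, ?_⟩, ?_⟩
    · change ‖(x : L) / (p : L) ^ k‖ ≤ 1
      rw [norm_div, norm_pow]
      exact (div_le_one (pow_pos (norm_pos_iff.2 hp) k)).2 h
    · ext
      simp [mul_div_cancel₀, hp]

theorem RingOfIntegers.isPAdicRing : IsPAdicRing p (RingOfIntegers L) where
  eq_of_mul_eq x y h := by
    have h' : (p : L) * x = p * y := by
      simpa using congrArg (Subtype.val : RingOfIntegers L → L) h
    exact Subtype.ext (mul_left_cancel₀ (natCast_p_ne_zero p L) h')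
  not_isUnit h := by
    have h1 : (p : RingOfIntegers L) ^ 1 ∣ 1 := by
      rw [pow_one]
      exact isUnit_iff_dvd_one.1 h
    rw [RingOfIntegers.pow_dvd_iff, norm_natCast_p] at h1
    have h2 : (1 : ℝ) < p := Nat.one_lt_cast.2 (Fact.out : p.Prime).one_lt
    have h3 := inv_lt_one_of_one_lt₀ h2
    simp at h1
    linarith
  exists_pow_dvd U hU := by
    rw [nhds_induced, Filter.mem_comap] at hU
    obtain ⟨V, hV, hVU⟩ := hU
    obtain ⟨δ, hδ, hδV⟩ := Metric.mem_nhds_iff.1 hV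
    have h2 : (1 : ℝ) < p := Nat.one_lt_cast.2 (Fact.out : p.Prime).one_lt
    have h3 := inv_lt_one_of_one_lt₀ h2
    rw [← norm_natCast_p p L] at h3
    obtain ⟨k, hk⟩ := exists_pow_lt_of_lt_one hδ h3
    refine ⟨k, fun x hx => hVU (hδV ?_)⟩
    have : ‖(x : L)‖ < δ := ((RingOfIntegers.pow_dvd_iff p L k x).1 hx).trans_lt hk
    simpa using this
  isOpen_dvd k := by
    have h : {x : RingOfIntegers L | (p : RingOfIntegers L) ^ k ∣ x} =
        Subtype.val ⁻¹' Metric.closedBall (0 : L) (‖(p : L)‖ ^ k) := by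
      ext x
      simp only [Set.mem_preimage, mem_closedBall_zero_iff]
      exact RingOfIntegers.pow_dvd_iff p L k x
    rw [h]
    refine (IsUltrametricDist.isOpen_closedBall _ ?_).preimage continuous_subtype_val
    exact pow_ne_zero _ (norm_ne_zero_iff.2 (natCast_p_ne_zero p L))

theorem RingOfIntegers.compactSpace [FiniteDimensional ℚ_[p] L] :
    CompactSpace (RingOfIntegers L) := by
  have : ProperSpace L := FiniteDimensional.proper ℚ_[p] L
  refine isCompact_iff_compactSpace.1 ?_
  have h : ((RingOfIntegers L : Subring L) : Set L) = Metric.closedBall 0 1 := by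
    ext x
    rw [mem_closedBall_zero_iff]
    rfl
  rw [h]
  exact isCompact_closedBall 0 1

theorem RingOfIntegers.isLocalRing (L : Type u) [NormedField L] [IsUltrametricDist L] :
    IsLocalRing (RingOfIntegers L) :=
  inferInstanceAs (IsLocalRing (NormedField.valuation (K := L)).valuationSubring)

end RingOfIntegers

/-! ### Powers and commutators in a `p`-adically filtered ring -/

/-- A filtration of a ring by subgroups `E k` that behaves like the filtration by the multiples
of `p ^ k` in a `p`-torsion free ring. -/
structure PFiltration (p : ℕ) (B : Type*) [Ring B] where
  E : ℕ → AddSubgroup B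
  zero : E 0 = ⊤
  anti : Antitone E
  mul : ∀ {i j a b}, a ∈ E i → b ∈ E j → a * b ∈ E (i + j)
  p_mem : (p : B) ∈ E 1
  of_p_mul : ∀ {k a}, (p : B) * a ∈ E (k + 1) → a ∈ E k

namespace PFiltration

variable {p : ℕ} {B : Type*} [Ring B] (E : PFiltration p B)

include E

theorem mul_mem_left {k : ℕ} {b : B} (a : B) (hb : b ∈ E.E k) : a * b ∈ E.E k := by
  have h := E.mul (i := 0) (a := a) (by rw [E.zero]; trivial) hb
  rwa [zero_add] at h

theorem mul_mem_right {k : ℕ} {a : B} (b : B) (ha : a ∈ E.E k) : a * b ∈ E.E k :=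
  E.mul (j := 0) (b := b) ha (by rw [E.zero]; trivial)

theorem pow_sub_pow_mem {e k : ℕ} {a b : B} (ha : a ∈ E.E e) (hb : b ∈ E.E e)
    (hab : a - b ∈ E.E k) (j : ℕ) : a ^ (j + 1) - b ^ (j + 1) ∈ E.E (k + j * e) := by
  induction j with
  | zero => simpa using hab
  | succ j ih =>
    have hpow : ∀ j : ℕ, a ^ j ∈ E.E (j * e) := by
      intro j
      induction j with
      | zero => simp [E.zero]
      | succ j ih =>
        rw [pow_succ, add_mul, one_mul]
        exact E.mul ih ha
    have h : a ^ (j + 1 + 1) - b ^ (j + 1 + 1) =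
        a ^ (j + 1) * (a - b) + (a ^ (j + 1) - b ^ (j + 1)) * b := by
      rw [pow_succ a (j + 1), pow_succ b (j + 1)]
      noncomm_ring
    rw [h]
    refine add_mem ?_ ?_
    · rw [add_comm k]
      exact E.mul (hpow (j + 1)) hab
    · rw [add_mul, one_mul, ← add_assoc]
      exact E.mul ih hb

/-- The `p`-th power map on `1 + E e` is multiplication by `p` up to terms of higher order. Here
`e ≥ 1`, and `e ≥ 2` if `p = 2`. -/
theorem one_add_pow_sub_mem (hp : p.Prime) {e k : ℕ} (he : 2 ≤ (p - 1) * e) (he1 : 1 ≤ e)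
    {a b : B} (ha : a ∈ E.E e) (hb : b ∈ E.E e) (hab : a - b ∈ E.E k) :
    (1 + a) ^ p - (1 + b) ^ p - p * (a - b) ∈ E.E (k + 2) := by
  obtain ⟨m, rfl⟩ : ∃ m, p = m + 1 := ⟨p - 1, by have := hp.one_lt; omega⟩
  have expand : ∀ c : B, (1 + c) ^ (m + 1) =
      1 + ∑ j ∈ Finset.range (m + 1), c ^ (j + 1) * ((m + 1).choose (j + 1) : B) := by
    intro c
    rw [add_comm 1 c, (Commute.one_right c).add_pow, Finset.sum_range_succ']
    simp [add_comm]
  rw [expand, expand, add_sub_add_left_eq_sub, ← Finset.sum_sub_distrib,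
    Finset.sum_range_succ']
  have h0 : a ^ (0 + 1) * (((m + 1).choose (0 + 1) : ℕ) : B) -
      b ^ (0 + 1) * (((m + 1).choose (0 + 1) : ℕ) : B) = ((m + 1 : ℕ) : B) * (a - b) := by
    rw [← sub_mul, zero_add, pow_one, pow_one, Nat.choose_one_right, Nat.cast_comm]
  rw [h0, add_sub_cancel_right]
  refine sum_mem fun j hj => ?_
  rw [Finset.mem_range] at hj
  rw [← sub_mul]
  have h1 := E.pow_sub_pow_mem ha hb hab (j + 1)
  -- the last binomial coefficient is `1`: this is where `(p - 1) * e ≥ 2` is used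
  by_cases hjm : j + 1 = m
  · refine E.mul_mem_right _ (E.anti ?_ h1)
    rw [hjm]
    exact Nat.add_le_add_left he k
  · obtain ⟨q, hq⟩ := hp.dvd_choose_self (k := j + 1 + 1) (by omega) (by omega)
    rw [hq, Nat.cast_mul, ← mul_assoc]
    refine E.mul_mem_right _ (E.anti ?_ (E.mul h1 E.p_mem))
    nlinarith

/-- The `p`-th power map on `1 + E e` shifts the filtration by one. -/
theorem pow_sub_pow_mem_iff (hp : p.Prime) {e k : ℕ} (he : 2 ≤ (p - 1) * e) (he1 : 1 ≤ e)
    {u v : B} (hu : u - 1 ∈ E.E e) (hv : v - 1 ∈ E.E e) :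
    u ^ p - v ^ p ∈ E.E (k + 1) ↔ u - v ∈ E.E k := by
  have key : ∀ j, u - v ∈ E.E j → u ^ p - v ^ p - p * (u - v) ∈ E.E (j + 2) := by
    intro j hj
    have h := E.one_add_pow_sub_mem hp he he1 hu hv (k := j) (by simpa using hj)
    simpa using h
  constructor
  · intro h
    have : ∀ j ≤ k, u - v ∈ E.E j := by
      intro j
      induction j with
      | zero => simp [E.zero]
      | succ j ih =>
        intro hj
        refine E.of_p_mul ?_
        have h1 := sub_mem (E.anti (by omega : j + 2 ≤ k + 1) h) (key j (ih (by omega)))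
        simpa using h1
    exact this k le_rfl
  · intro h
    have h1 := add_mem (E.anti (Nat.le_succ _) (key k h))
      (E.anti (by omega : k + 1 ≤ 1 + k) (E.mul E.p_mem h))
    simpa using h1

/-- The `p`-th power map is multiplicative up to terms of higher order. -/
theorem mul_pow_sub_mem (hp : p.Prime) {e s : ℕ} (he : 2 ≤ (p - 1) * e) (he1 : 1 ≤ e)
    (hs : e ≤ s) {u v : B} (hu : u - 1 ∈ E.E s) (hv : v - 1 ∈ E.E s) :
    (u * v) ^ p - u ^ p * v ^ p ∈ E.E (s + 2) := by
  have key : ∀ w : B, w - 1 ∈ E.E s → w ^ p - 1 - p * (w - 1) ∈ E.E (s + 2) := by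
    intro w hw
    have h := E.one_add_pow_sub_mem hp he he1 (E.anti hs hw) (zero_mem _) (k := s)
      (by simpa using hw)
    simpa using h
  have huv : u * v - 1 ∈ E.E s := by
    have : u * v - 1 = u * (v - 1) + (u - 1) := by noncomm_ring
    rw [this]
    exact add_mem (E.mul_mem_left _ hv) hu
  have hu' : u ^ p - 1 ∈ E.E (s + 1) := by
    have h := (E.pow_sub_pow_mem_iff hp he he1 (E.anti hs hu) (v := 1) (by simp)).2 hu
    simpa using h
  have hcross : (p : B) * ((u - 1) * (v - 1)) ∈ E.E (s + 2) :=
    E.anti (by omega) (E.mul E.p_mem (E.mul hu hv))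
  have hcross' : (u ^ p - 1) * (v ^ p - 1) ∈ E.E (s + 2) := by
    have hv' : v ^ p - 1 ∈ E.E (s + 1) := by
      have h := (E.pow_sub_pow_mem_iff hp he he1 (E.anti hs hv) (v := 1) (by simp)).2 hv
      simpa using h
    exact E.anti (by omega) (E.mul hu' hv')
  have h : (u * v) ^ p - u ^ p * v ^ p =
      ((u * v) ^ p - 1 - p * (u * v - 1)) - (u ^ p - 1 - p * (u - 1)) -
        (v ^ p - 1 - p * (v - 1)) + p * ((u - 1) * (v - 1)) - (u ^ p - 1) * (v ^ p - 1) := by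
    noncomm_ring
  rw [h]
  exact sub_mem (add_mem (sub_mem (sub_mem (key _ huv) (key _ hu)) (key _ hv)) hcross) hcross'

/-- An approximate `p`-th root `u` of `u ^ p * w` is improved by a factor `v` such that `p (v - 1)`
approximates `w - 1`. -/
theorem mul_pow_sub_pow_mul_mem (hp : p.Prime) {e k : ℕ} (he : 2 ≤ (p - 1) * e) (he1 : 1 ≤ e)
    (hk : e ≤ k) {u v w : B} (hu : u - 1 ∈ E.E e) (hv : v - 1 ∈ E.E k)
    (hw : w - 1 ∈ E.E (k + 1)) (hvw : w - 1 - p * (v - 1) ∈ E.E (k + 2)) :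
    (u * v) ^ p - u ^ p * w ∈ E.E (k + 2) := by
  have huv : u * v - u ∈ E.E k := by
    have : u * v - u = u * (v - 1) := by noncomm_ring
    rw [this]
    exact E.mul_mem_left _ hv
  have huv1 : u * v - 1 ∈ E.E e := by
    have : u * v - 1 = (u * v - u) + (u - 1) := by noncomm_ring
    rw [this]
    exact add_mem (E.anti hk huv) hu
  have h1 : (u * v) ^ p - u ^ p - p * (u * v - u) ∈ E.E (k + 2) := by
    have h := E.one_add_pow_sub_mem hp he he1 huv1 hu (k := k) (by simpa using huv)
    simpa using h
  have h2 : (p : B) * ((u - 1) * (v - 1)) ∈ E.E (k + 2) :=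
    E.anti (by omega) (E.mul E.p_mem (E.mul hu hv))
  have hup : u ^ p - 1 ∈ E.E (e + 1) := by
    have h := (E.pow_sub_pow_mem_iff hp he he1 hu (v := 1) (by simp)).2 hu
    simpa using h
  have h3 : (u ^ p - 1) * (w - 1) ∈ E.E (k + 2) := E.anti (by omega) (E.mul hup hw)
  have h : (u * v) ^ p - u ^ p * w =
      ((u * v) ^ p - u ^ p - p * (u * v - u)) + p * ((u - 1) * (v - 1)) - (u ^ p - 1) * (w - 1) -
        (w - 1 - p * (v - 1)) := by
    noncomm_ring
  rw [h]
  exact sub_mem (sub_mem (add_mem h1 h2) h3) hvw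

end PFiltration

namespace Points

/-! ### Congruence subgroups -/

section Congruence

variable {p : ℕ} {O : Type u} [CommRing O] [TopologicalSpace O]
  {A : Type u} [CommRing A] [HopfAlgebra O A]

/-- The kernel of reduction modulo `p ^ k`. -/
def level (p : ℕ) (O : Type u) [CommRing O] (A : Type u) [CommRing A] [HopfAlgebra O A] (k : ℕ) :
    Subgroup (Points O A O) :=
  (map (A := A) (Ideal.Quotient.mkₐ O (Ideal.span {(p : O) ^ k}))).ker

omit [TopologicalSpace O] in
theorem mem_level_iff {k : ℕ} {x : Points O A O} :
    x ∈ level p O A k ↔ ∀ a, (p : O) ^ k ∣ x.hom a - Coalgebra.counit a := by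
  have h : ∀ a, (map (Ideal.Quotient.mkₐ O (Ideal.span {(p : O) ^ k})) x).hom a =
      (1 : Points O A (O ⧸ Ideal.span {(p : O) ^ k})).hom a ↔
      (p : O) ^ k ∣ x.hom a - Coalgebra.counit a := by
    intro a
    rw [one_hom_apply, ← Ideal.mem_span_singleton, ← Ideal.Quotient.eq]
    rfl
  rw [level, MonoidHom.mem_ker]
  constructor
  · intro hx a
    rw [← h, hx]
  · intro hx
    exact ext_hom (AlgHom.ext fun a => (h a).2 (hx a))

/-- A point, viewed as an element of the convolution algebra of linear functionals on the
coordinate ring. -/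
def functional : Points O A O →* WithConv (A →ₗ[O] O) where
  toFun x := WithConv.toConv x.hom.toLinearMap
  map_one' := rfl
  map_mul' x y := AlgHom.toLinearMap_convMul (R := O) (C := A) (A := O) x y

/-- The convolution algebra, filtered by the divisibility of functionals by powers of `p`. -/
def functionalFiltration (hO : IsPAdicRing p O) (A : Type u) [CommRing A] [HopfAlgebra O A] :
    PFiltration p (WithConv (A →ₗ[O] O)) where
  E k :=
    { carrier := {φ | ∀ a, (p : O) ^ k ∣ φ a}
      add_mem' := fun h h' a => dvd_add (h a) (h' a)
      zero_mem' := fun _ => dvd_zero _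
      neg_mem' := fun h a => (dvd_neg (α := O)).2 (h a) }
  zero := by
    refine eq_top_iff.2 fun φ _ a => ?_
    rw [pow_zero]
    exact one_dvd _
  anti i j hij φ h a := (pow_dvd_pow _ hij).trans (h a)
  mul {i j φ ψ} hφ hψ a := by
    rw [(Coalgebra.Repr.arbitrary O a).convMul_apply, pow_add]
    exact Finset.dvd_sum fun _ _ => mul_dvd_mul (hφ _) (hψ _)
  p_mem a := by
    have : ((p : ℕ) : WithConv (A →ₗ[O] O)) a = (p : O) * Coalgebra.counit (R := O) a :=
      (congrArg (fun φ : WithConv (A →ₗ[O] O) => φ a) (nsmul_one p).symm).trans (nsmul_eq_mul _ _)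
    rw [pow_one, this]
    exact dvd_mul_right _ _
  of_p_mul {k φ} h a := by
    have h1 := h a
    have : (((p : ℕ) : WithConv (A →ₗ[O] O)) * φ) a = (p : O) * φ a :=
      (congrArg (fun φ : WithConv (A →ₗ[O] O) => φ a) (nsmul_eq_mul p φ).symm).trans
        (nsmul_eq_mul _ _)
    rw [this] at h1
    exact hO.dvd_of_mul_dvd h1

variable (hO : IsPAdicRing p O)

theorem mem_level_iff_functional {k : ℕ} {x : Points O A O} :
    x ∈ level p O A k ↔ functional x - 1 ∈ (functionalFiltration hO A).E k :=
  mem_level_iff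

theorem inv_mul_mem_level_iff {k : ℕ} {x y : Points O A O} :
    x⁻¹ * y ∈ level p O A k ↔ functional x - functional y ∈ (functionalFiltration hO A).E k := by
  rw [mem_level_iff_functional hO]
  constructor
  · intro h
    have h1 := (functionalFiltration hO A).mul_mem_left (functional x) (neg_mem h)
    rwa [neg_sub, mul_sub, mul_one, ← map_mul, mul_inv_cancel_left] at h1
  · intro h
    have h1 := (functionalFiltration hO A).mul_mem_left (functional x⁻¹) (neg_mem h)
    rwa [neg_sub, mul_sub, ← map_mul, ← map_mul, inv_mul_cancel, map_one] at h1

omit [TopologicalSpace O] in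
theorem level_anti {i j : ℕ} (h : i ≤ j) : level p O A j ≤ level p O A i := fun _ hx =>
  mem_level_iff.2 fun a => (pow_dvd_pow _ h).trans (mem_level_iff.1 hx a)

include hO in
/-- In the convolution algebra, the commutator minus `1` is the ring commutator of `x - 1` and
`y - 1`, up to a unit. -/
theorem commutator_mem_level {i j : ℕ} {x y : Points O A O} (hx : x ∈ level p O A i)
    (hy : y ∈ level p O A j) : x * y * x⁻¹ * y⁻¹ ∈ level p O A (i + j) := by
  rw [mem_level_iff_functional hO] at hx hy ⊢
  have h : functional (x * y * x⁻¹ * y⁻¹) - 1 = ((functional x - 1) * (functional y - 1) -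
      (functional y - 1) * (functional x - 1)) * functional (x⁻¹ * y⁻¹) := by
    have h1 : (functional x - 1) * (functional y - 1) - (functional y - 1) * (functional x - 1) =
        functional (x * y) - functional (y * x) := by
      rw [map_mul, map_mul]
      simp only [sub_mul, mul_sub, one_mul, mul_one]
      abel
    rw [h1, sub_mul, ← map_mul, ← map_mul, ← map_one functional]
    congr 2
    group
  rw [h]
  refine (functionalFiltration hO A).mul_mem_right _ (sub_mem ?_ ?_)
  · exact (functionalFiltration hO A).mul hx hy
  · rw [add_comm]
    exact (functionalFiltration hO A).mul hy hx

include hO in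
theorem pow_inv_mul_pow_mem_level_iff (hp : p.Prime) {e k : ℕ} (he : 2 ≤ (p - 1) * e)
    (he1 : 1 ≤ e) {x y : Points O A O} (hx : x ∈ level p O A e) (hy : y ∈ level p O A e) :
    (x ^ p)⁻¹ * y ^ p ∈ level p O A (k + 1) ↔ x⁻¹ * y ∈ level p O A k := by
  rw [inv_mul_mem_level_iff hO, inv_mul_mem_level_iff hO, map_pow, map_pow]
  exact (functionalFiltration hO A).pow_sub_pow_mem_iff hp he he1
    ((mem_level_iff_functional hO).1 hx) ((mem_level_iff_functional hO).1 hy)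

include hO in
theorem mul_pow_inv_mul_mem_level (hp : p.Prime) {e s : ℕ} (he : 2 ≤ (p - 1) * e)
    (he1 : 1 ≤ e) (hs : e ≤ s) {x y : Points O A O} (hx : x ∈ level p O A s)
    (hy : y ∈ level p O A s) :
    ((x * y) ^ p)⁻¹ * (x ^ p * y ^ p) ∈ level p O A (s + 2) := by
  rw [inv_mul_mem_level_iff hO]
  simp only [map_pow, map_mul]
  exact (functionalFiltration hO A).mul_pow_sub_mem hp he he1 hs
    ((mem_level_iff_functional hO).1 hx) ((mem_level_iff_functional hO).1 hy)

end Congruence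


/-! ### The topology of the group of integral points -/

section Topology

variable {O : Type u} [CommRing O] [TopologicalSpace O]
  {A : Type u} [CommRing A] [HopfAlgebra O A]

theorem isEmbedding_hom : Topology.IsEmbedding fun (x : Points O A O) (a : A) => x.hom a :=
  ⟨⟨rfl⟩, fun _ _ h => ext_hom (AlgHom.ext (congrFun h))⟩

instance [T2Space O] : T2Space (Points O A O) := isEmbedding_hom.t2Space

instance [IsTopologicalRing O] : IsTopologicalGroup (Points O A O) where
  continuous_inv := continuous_of_hom_apply fun a =>
    continuous_hom_apply (HopfAlgebra.antipode O a)

instance [IsTopologicalRing O] [T2Space O] [CompactSpace O] : CompactSpace (Points O A O) := by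
  -- the homomorphisms of algebras form a closed subset of the product, by their defining equations
  refine Topology.IsClosedEmbedding.compactSpace (f := fun (x : Points O A O) (a : A) => x.hom a)
    ⟨isEmbedding_hom, ?_⟩
  have h : Set.range (fun (x : Points O A O) (a : A) => x.hom a) =
      {f | (f 1 = 1) ∧ (∀ a b, f (a * b) = f a * f b) ∧ (∀ a b, f (a + b) = f a + f b) ∧
        ∀ c, f (algebraMap O A c) = c} := by
    ext f
    constructor
    · rintro ⟨x, rfl⟩
      exact ⟨map_one _, map_mul _, map_add _, x.hom.commutes⟩
    · rintro ⟨h1, hmul, hadd, hc⟩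
      exact ⟨mk
        { toFun := f
          map_one' := h1
          map_mul' := hmul
          map_zero' := by simpa using hc 0
          map_add' := hadd
          commutes' := hc }, rfl⟩
  rw [h]
  have hf : ∀ a : A, Continuous fun f : A → O => f a := continuous_apply
  simp only [Set.ofPred_and, Set.ofPred_forall]
  refine ((isClosed_eq (hf _) continuous_const).inter ((isClosed_iInter fun a => isClosed_iInter
    fun b => isClosed_eq (hf _) ((hf a).mul (hf b))).inter ((isClosed_iInter fun a =>
    isClosed_iInter fun b => isClosed_eq (hf _) ((hf a).add (hf b))).inter
    (isClosed_iInter fun c => isClosed_eq (hf _) continuous_const))))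

variable {n : ℕ} (π : A →ₐc[O] SplitTorus O n) (μ : (Fin n → ℤ) →+ ℤ)

theorem isClosed_centralizer [T2Space O] : IsClosed (centralizer π μ O : Set (Points O A O)) := by
  have h : (centralizer π μ O : Set (Points O A O)) =
      ⋂ χ, ⋂ (_ : μ χ ≠ 0), ⋂ a, {x | x.hom (weight π χ a) = 0} := by
    ext x
    simp only [SetLike.mem_coe, mem_centralizer_iff, Set.mem_iInter, Set.mem_ofPred_eq]
  rw [h]
  exact isClosed_iInter fun χ => isClosed_iInter fun _ => isClosed_iInter fun a =>
    isClosed_eq (continuous_hom_apply _) continuous_const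

theorem isClosed_unipotent [T2Space O] : IsClosed (unipotent π μ O : Set (Points O A O)) := by
  have h : (unipotent π μ O : Set (Points O A O)) =
      (⋂ χ, ⋂ (_ : μ χ < 0), ⋂ a, {x | x.hom (weight π χ a) = 0}) ∩
      ⋂ χ, ⋂ (_ : μ χ = 0), ⋂ a,
        {x | x.hom (weight π χ a) = algebraMap O O (Coalgebra.counit (weight π χ a))} := by
    ext x
    simp only [SetLike.mem_coe, mem_unipotent_iff, Set.mem_inter_iff, Set.mem_iInter,
      Set.mem_ofPred_eq]
  rw [h]
  exact (isClosed_iInter fun χ => isClosed_iInter fun _ => isClosed_iInter fun a =>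
    isClosed_eq (continuous_hom_apply _) continuous_const).inter
    (isClosed_iInter fun χ => isClosed_iInter fun _ => isClosed_iInter fun a =>
    isClosed_eq (continuous_hom_apply _) continuous_const)

variable {p : ℕ} (hO : IsPAdicRing p O)

include hO in
theorem isClosed_level [IsTopologicalRing O] (k : ℕ) :
    IsClosed (level p O A k : Set (Points O A O)) := by
  have h : (level p O A k : Set (Points O A O)) =
      ⋂ a, {x | (p : O) ^ k ∣ x.hom a - Coalgebra.counit a} := by
    ext x
    simp only [SetLike.mem_coe, mem_level_iff, Set.mem_iInter, Set.mem_ofPred_eq]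
  rw [h]
  exact isClosed_iInter fun a => (hO.isClosed_dvd k).preimage
    ((continuous_hom_apply a).sub continuous_const)

include hO in
theorem inv_mul_mem_level_iff_dvd {k : ℕ} {x y : Points O A O} :
    x⁻¹ * y ∈ level p O A k ↔ ∀ a, (p : O) ^ k ∣ x.hom a - y.hom a :=
  inv_mul_mem_level_iff hO

include hO in
/-- The congruence subgroups form a basis of the neighbourhoods of the identity. -/
theorem exists_level_subset [IsTopologicalRing O] {U : Set (Points O A O)} (hU : U ∈ nhds 1) :
    ∃ k, (level p O A k : Set (Points O A O)) ⊆ U := by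
  by_contra! h
  choose x hx hxU using fun k => Set.not_subset.1 (h k)
  have hlim : Filter.Tendsto x Filter.atTop (nhds 1) := by
    rw [isEmbedding_hom.isInducing.tendsto_nhds_iff, tendsto_pi_nhds]
    intro a
    rw [← tendsto_sub_nhds_zero_iff]
    intro V hV
    obtain ⟨k, hk⟩ := hO.exists_pow_dvd V hV
    refine Filter.mem_map.2 ((Filter.eventually_ge_atTop k).mono fun j hj => hk _ ?_)
    have h1 := mem_level_iff.1 (level_anti hj (hx j)) a
    rwa [← Algebra.algebraMap_self_apply (Coalgebra.counit a), ← one_hom_apply] at h1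
  obtain ⟨k, hk⟩ := (hlim.eventually_mem hU).exists
  exact hxU k hk

include hO in
theorem mem_of_forall_inv_mul_mem_level [IsTopologicalRing O] {K : Set (Points O A O)}
    (hK : IsClosed K) {x : Points O A O} (h : ∀ k, ∃ z ∈ K, z⁻¹ * x ∈ level p O A k) :
    x ∈ K := by
  rw [← hK.closure_eq, mem_closure_iff_nhds]
  intro U hU
  have hc : (fun z : Points O A O => x * z⁻¹) ⁻¹' U ∈ nhds 1 := by
    refine ContinuousAt.preimage_mem_nhds (by fun_prop) ?_
    simpa using hU
  obtain ⟨k, hk⟩ := exists_level_subset hO hc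
  obtain ⟨z, hz, hzx⟩ := h k
  exact ⟨z, by simpa using hk hzx, hz⟩

end Topology

/-! ### Coordinates on the congruence subgroups -/

section PAdicCoordinates

variable {p : ℕ} {O : Type u} [CommRing O] [TopologicalSpace O]
  {A : Type u} [CommRing A] [HopfAlgebra O A] {n : ℕ} {π : A →ₐc[O] SplitTorus O n}

omit [TopologicalSpace O]

theorem dvd_hom_of_mem_augmentation {k : ℕ} {x : Points O A O} (hx : x ∈ level p O A k) {a : A}
    (ha : a ∈ augmentation O A) : (p : O) ^ k ∣ x.hom a := by
  have h := mem_level_iff.1 hx a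
  rwa [mem_augmentation.1 ha, sub_zero] at h

/-- Congruences between points of the first congruence subgroup can be tested on coordinates. -/
theorem Coordinates.dvd_hom_sub (C : Coordinates π) {k : ℕ} {x x' : Points O A O}
    (hx : x ∈ level p O A 1) (hx' : x' ∈ level p O A 1)
    (h : ∀ i, (p : O) ^ k ∣ x.hom (C.y i) - x'.hom (C.y i)) (a : A) :
    (p : O) ^ k ∣ x.hom a - x'.hom a := by
  -- induct on `k`: on the square of the augmentation ideal, the congruence gains a factor `p`
  induction k generalizing a with
  | zero => simp
  | succ k ih =>
    replace ih := ih fun i => (pow_dvd_pow _ k.le_succ).trans (h i)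
    have hsq : ∀ z ∈ augmentation O A ^ 2, (p : O) ^ (k + 1) ∣ x.hom z - x'.hom z := by
      intro z hz
      rw [sq] at hz
      refine Submodule.mul_induction_on hz (fun b hb c hc => ?_) fun b c hb hc => ?_
      · have e : x.hom (b * c) - x'.hom (b * c) =
            (x.hom b - x'.hom b) * x.hom c + (x.hom c - x'.hom c) * x'.hom b := by
          rw [map_mul, map_mul]
          ring
        have h1 := dvd_hom_of_mem_augmentation hx hc
        have h2 := dvd_hom_of_mem_augmentation hx' hb
        rw [pow_one] at h1 h2
        rw [e, pow_succ]
        exact dvd_add (mul_dvd_mul (ih b) h1) (mul_dvd_mul (ih c) h2)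
      · rw [map_add, map_add, add_sub_add_comm]
        exact dvd_add hb hc
    have hb := hsq _ (C.sub_sum_mem _ (sub_counit_mem (O := O) a))
    set s := ∑ i, C.deriv i (a - algebraMap O A (Coalgebra.counit a)) • C.y i with hs
    have hs' : (p : O) ^ (k + 1) ∣ x.hom s - x'.hom s := by
      rw [hs, map_sum, map_sum, ← Finset.sum_sub_distrib]
      refine Finset.dvd_sum fun i _ => ?_
      rw [map_smul, map_smul, ← smul_sub]
      exact (h i).mul_left _
    have e : x.hom a - x'.hom a = (x.hom (a - algebraMap O A (Coalgebra.counit a) - s) -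
        x'.hom (a - algebraMap O A (Coalgebra.counit a) - s)) + (x.hom s - x'.hom s) := by
      simp only [map_sub, AlgHom.commutes]
      ring
    rw [e]
    exact dvd_add hb hs'

theorem Coordinates.mem_level (C : Coordinates π) {k : ℕ} {x : Points O A O}
    (hx : x ∈ level p O A 1) (h : ∀ i, (p : O) ^ k ∣ x.hom (C.y i)) : x ∈ level p O A k := by
  refine mem_level_iff.2 fun a => ?_
  have := C.dvd_hom_sub hx (one_mem _) (k := k) (fun i => ?_) a
  · rwa [one_hom_apply] at this
  · rw [one_hom_apply, mem_augmentation.1 (C.y_mem i), map_zero, sub_zero]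
    exact h i

variable [TopologicalSpace O] (hO : IsPAdicRing p O)

section Unipotent

variable [T2Space O]

include hO

theorem Coordinates.hom_weight_eq_zero_of_mem_level (C : Coordinates π)
    {Q : (Fin n → ℤ) → Prop} (hQ : ∀ ψ ψ', Q (ψ + ψ') → Q ψ ∨ Q ψ') {x : Points O A O}
    (hx : x ∈ level p O A 1) (hy : ∀ i, Q (C.wt i) → x.hom (C.y i) = 0) {χ : Fin n → ℤ}
    (hχ : Q χ) {a : A} (ha : a ∈ augmentation O A) : x.hom (weight π χ a) = 0 := by
  refine C.hom_weight_eq_zero hQ (Ideal.span {(p : O)}) (fun s hs => ?_) x (fun a ha => ?_) hy hχ ha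
  · refine hO.eq_zero_of_forall_dvd fun k => ?_
    have h := hs k
    rwa [Ideal.span_singleton_pow, Ideal.mem_span_singleton] at h
  · have h := dvd_hom_of_mem_augmentation hx ha
    rwa [pow_one, ← Ideal.mem_span_singleton] at h

theorem Coordinates.mem_unipotent (C : Coordinates π) {μ : (Fin n → ℤ) →+ ℤ} {x : Points O A O}
    (hx : x ∈ level p O A 1) (hy : ∀ i, μ (C.wt i) ≤ 0 → x.hom (C.y i) = 0) :
    x ∈ unipotent π μ O := by
  refine mem_unipotent_of_augmentation μ fun χ hχ a ha => ?_
  refine C.hom_weight_eq_zero_of_mem_level hO (Q := fun χ => μ χ ≤ 0) (fun ψ ψ' h => ?_) hx hy hχ ha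
  rw [map_add] at h
  by_contra! h'
  linarith [h'.1, h'.2]

theorem Coordinates.mem_centralizer (C : Coordinates π) {μ : (Fin n → ℤ) →+ ℤ} {x : Points O A O}
    (hx : x ∈ level p O A 1) (hy : ∀ i, μ (C.wt i) ≠ 0 → x.hom (C.y i) = 0) :
    x ∈ centralizer π μ O := by
  refine (mem_centralizer_iff π μ).2 fun χ hχ a => ?_
  have h0 : χ ≠ 0 := by
    rintro rfl
    exact hχ (map_zero μ)
  rw [← weight_weight_self]
  refine C.hom_weight_eq_zero_of_mem_level hO (Q := fun χ => μ χ ≠ 0) (fun ψ ψ' h => ?_) hx hy hχ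
    (counit_weight π h0 a)
  rw [map_add] at h
  by_contra! h'
  rw [h'.1, h'.2] at h
  exact h (add_zero 0)

end Unipotent

omit [TopologicalSpace O] in
theorem Coordinates.hom_y_eq_zero (C : Coordinates π) {μ : (Fin n → ℤ) →+ ℤ} {S : Type u}
    [CommRing S] [Algebra O S] {x : Points O A S} (hx : x ∈ unipotent π μ S) {i : C.ι}
    (hi : μ (C.wt i) ≤ 0) : x.hom (C.y i) = 0 := by
  rw [← C.weight_y]
  exact hom_weight_of_mem_unipotent hx hi (C.y_mem i)

variable [IsTopologicalRing O] [T2Space O] [CompactSpace O] [Algebra.FormallySmooth O A]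

include hO

/-- All systems of coordinates that are divisible by `p` are taken by a point. -/
theorem Coordinates.exists_mem_level_one (C : Coordinates π) (c : C.ι → O)
    (hc : ∀ i, (p : O) ∣ c i) : ∃ x ∈ level p O A 1, ∀ i, x.hom (C.y i) = c i := by
  let J : Ideal O := Ideal.span {(p : O)}
  have : IsAdicComplete J O := hO.isAdicComplete
  have hJ : ∀ k (z : O), z ∈ J ^ k ↔ (p : O) ^ k ∣ z := fun k z => by
    rw [Ideal.span_singleton_pow, Ideal.mem_span_singleton]
  obtain ⟨x, hx, hxc, hx1⟩ := C.exists_formalPoint J c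
    fun i => Ideal.mem_span_singleton.2 (hc i)
  -- The formal point is a compatible system of points modulo `p ^ (k + 1)`, which has a limit.
  let f : ∀ k : ℕ, A →ₐ[O] O ⧸ J ^ k := fun k =>
    (Ideal.Quotient.factorₐ O (Ideal.pow_le_pow_right k.le_succ)).comp (x k)
  have hf : ∀ {m k : ℕ} (hle : m ≤ k),
      (Ideal.Quotient.factorₐ O (Ideal.pow_le_pow_right hle)).comp (f k) = f m := by
    intro m k hle
    induction k, hle using Nat.le_induction with
    | base =>
      ext a
      obtain ⟨z, hz⟩ := Ideal.Quotient.mk_surjective (f m a)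
      change Ideal.Quotient.factorₐ O (Ideal.pow_le_pow_right le_rfl) (f m a) = f m a
      rw [← hz]
      rfl
    | succ k hle ih =>
      rw [← ih]
      have h1 : f k = (Ideal.Quotient.factorₐ O (Ideal.pow_le_pow_right k.le_succ)).comp
          (f (k + 1)) := by
        change (Ideal.Quotient.factorₐ O _).comp (x k) = _
        rw [← hx k]
      rw [h1]
      ext a
      obtain ⟨z, hz⟩ := Ideal.Quotient.mk_surjective (f (k + 1) a)
      change Ideal.Quotient.factorₐ O (Ideal.pow_le_pow_right (hle.trans k.le_succ)) (f (k + 1) a) =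
        Ideal.Quotient.factorₐ O (Ideal.pow_le_pow_right hle)
          (Ideal.Quotient.factorₐ O (Ideal.pow_le_pow_right k.le_succ) (f (k + 1) a))
      rw [← hz]
      rfl
  let X : A →ₐ[O] O := IsAdicComplete.liftAlgHom J f hf
  have hX : ∀ k a, Ideal.Quotient.mk (J ^ k) (X a) = f k a := fun k a =>
    IsAdicComplete.mk_liftAlgHom J f hf k a
  refine ⟨Points.mk X, mem_level_iff.2 fun a => ?_, fun i => ?_⟩
  · obtain ⟨z, hz⟩ := Ideal.Quotient.mk_surjective (x 1 a)
    have h1 : Ideal.Quotient.mk (J ^ 1) (X a) = Ideal.Quotient.mk (J ^ 1) z := by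
      rw [hX]
      change (Ideal.Quotient.factorₐ O (Ideal.pow_le_pow_right (Nat.le_succ 1))) (x 1 a) = _
      rw [← hz]
      rfl
    rw [Ideal.Quotient.eq, hJ] at h1
    have h2 := hx1 1 a z hz
    rw [← pow_one J, hJ] at h2
    have h3 := dvd_add h1 h2
    rwa [sub_add_sub_cancel] at h3
  · refine sub_eq_zero.1 (hO.eq_zero_of_forall_dvd fun k => ?_)
    rw [← hJ, ← Ideal.Quotient.eq, hom_mk, hX]
    change (Ideal.Quotient.factorₐ O (Ideal.pow_le_pow_right k.le_succ)) (x k (C.y i)) = _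
    rw [hxc]
    rfl

theorem Coordinates.exists_mem_level (C : Coordinates π) {k : ℕ} (hk : 1 ≤ k) (c : C.ι → O)
    (hc : ∀ i, (p : O) ^ k ∣ c i) : ∃ x ∈ level p O A k, ∀ i, x.hom (C.y i) = c i := by
  obtain ⟨x, hx, hxc⟩ := C.exists_mem_level_one hO c fun i =>
    (dvd_pow_self _ (by omega)).trans (hc i)
  exact ⟨x, C.mem_level hx fun i => hxc i ▸ hc i, hxc⟩

/-- Division by `p` in the Lie algebra of a unipotent group, performed by dividing coordinates:
`w - 1` and `p (v - 1)` agree to first order. -/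
theorem Coordinates.exists_sub_mul_mem (C : Coordinates π) {μ : (Fin n → ℤ) →+ ℤ} {k : ℕ}
    (hk : 1 ≤ k) {w : Points O A O} (hw : w ∈ unipotent π μ O) (hwk : w ∈ level p O A (k + 1)) :
    ∃ v ∈ unipotent π μ O, v ∈ level p O A k ∧
      functional w - 1 - p * (functional v - 1) ∈ (functionalFiltration hO A).E (k + 2) := by
  have hdvd : ∀ i, ∃ c, w.hom (C.y i) = p * c ∧ (p : O) ^ k ∣ c := by
    intro i
    obtain ⟨c, hc⟩ := dvd_hom_of_mem_augmentation hwk (C.y_mem i)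
    exact ⟨(p : O) ^ k * c, by rw [hc]; ring, dvd_mul_right _ _⟩
  choose c hc hcd using hdvd
  obtain ⟨v, hv, hvc⟩ := C.exists_mem_level hO hk c hcd
  refine ⟨v, C.mem_unipotent hO (level_anti hk hv) fun i hi => ?_, hv, ?_⟩
  · rw [hvc]
    refine hO.eq_of_mul_eq _ _ ?_
    rw [mul_zero, ← hc]
    exact C.hom_y_eq_zero hw hi
  · let φ : A →ₗ[O] O := w.hom.toLinearMap - (p : O) • v.hom.toLinearMap
    have hφ : ∀ a, φ a = w.hom a - p * v.hom a := fun _ => rfl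
    have hsq : ∀ z ∈ augmentation O A ^ 2, (p : O) ^ (k + 2) ∣ φ z := by
      intro z hz
      rw [sq] at hz
      refine Submodule.mul_induction_on hz (fun b hb d hd => ?_) fun b d hb hd => ?_
      · rw [hφ, map_mul, map_mul]
        refine dvd_sub ?_ ?_
        · refine (pow_dvd_pow _ (by omega : k + 2 ≤ (k + 1) + (k + 1))).trans ?_
          rw [pow_add]
          exact mul_dvd_mul (dvd_hom_of_mem_augmentation hwk hb)
            (dvd_hom_of_mem_augmentation hwk hd)
        · refine (pow_dvd_pow _ (by omega : k + 2 ≤ 1 + (k + k))).trans ?_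
          rw [pow_add, pow_add, pow_one]
          exact mul_dvd_mul_left _ (mul_dvd_mul (dvd_hom_of_mem_augmentation hv hb)
            (dvd_hom_of_mem_augmentation hv hd))
      · rw [map_add]
        exact dvd_add hb hd
    have haug : ∀ a ∈ augmentation O A, (p : O) ^ (k + 2) ∣ φ a := by
      intro a ha
      have h1 := hsq _ (C.sub_sum_mem a ha)
      have h2 : φ (∑ i, C.deriv i a • C.y i) = 0 := by
        rw [map_sum]
        refine Finset.sum_eq_zero fun i _ => ?_
        rw [map_smul, hφ, hvc, hc, sub_self, smul_zero]
      rwa [map_sub, h2, sub_zero] at h1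
    intro a
    have h1 := haug _ (sub_counit_mem (O := O) a)
    have h2 : (functional w - 1 - p * (functional v - 1)) a =
        φ (a - algebraMap O A (Coalgebra.counit a)) := by
      rw [hφ, map_sub, map_sub, AlgHom.commutes, AlgHom.commutes, ← nsmul_eq_mul]
      change w.hom a - Coalgebra.counit a - p • (v.hom a - Coalgebra.counit a) = _
      rw [nsmul_eq_mul, Algebra.algebraMap_self_apply]
    rw [h2]
    exact h1

/-- The elements of `U_H(μ)` that are congruent to `1` modulo `p ^ (k + 1)` are `p`-th powers: an
approximate root is improved step by step, and the set of `p`-th powers is closed. -/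
theorem Coordinates.exists_pow_eq (C : Coordinates π) (hp : p.Prime) {μ : (Fin n → ℤ) →+ ℤ}
    {e k : ℕ} (he : 2 ≤ (p - 1) * e) (he1 : 1 ≤ e) (hk : e ≤ k) {w : Points O A O}
    (hw : w ∈ unipotent π μ O) (hwk : w ∈ level p O A (k + 1)) :
    ∃ u ∈ unipotent π μ O, u ∈ level p O A k ∧ u ^ p = w := by
  let U : Subgroup (Points O A O) := unipotent π μ O ⊓ level p O A k
  have hU : IsCompact (U : Set (Points O A O)) :=
    ((isClosed_unipotent π μ).inter (isClosed_level hO k)).isCompact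
  have hK : IsClosed ((fun u => u ^ p) '' (U : Set (Points O A O))) :=
    (hU.image (continuous_pow p)).isClosed
  have happrox : ∀ j, ∃ u ∈ U, (u ^ p)⁻¹ * w ∈ level p O A (k + 1 + j) := by
    intro j
    induction j with
    | zero => exact ⟨1, one_mem _, by simpa using hwk⟩
    | succ j ih =>
      obtain ⟨u, hu, huw⟩ := ih
      have hw' : (u ^ p)⁻¹ * w ∈ unipotent π μ O := mul_mem (inv_mem (pow_mem hu.1 p)) hw
      rw [show k + 1 + j = (k + j) + 1 by omega] at huw
      obtain ⟨v, hv, hvk, hvw⟩ := C.exists_sub_mul_mem hO (by omega) hw' huw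
      refine ⟨u * v, mul_mem hu ⟨hv, level_anti (by omega) hvk⟩, ?_⟩
      have h := (functionalFiltration hO A).mul_pow_sub_pow_mul_mem hp he he1
        (by omega : e ≤ k + j) ((mem_level_iff_functional hO).1 (level_anti hk hu.2))
        ((mem_level_iff_functional hO).1 hvk) ((mem_level_iff_functional hO).1 huw) hvw
      rw [← map_mul, ← map_pow, ← map_pow, ← map_mul, mul_inv_cancel_left,
        ← inv_mul_mem_level_iff hO] at h
      rwa [show k + 1 + (j + 1) = k + j + 2 by omega]
  obtain ⟨u, hu, huw⟩ := mem_of_forall_inv_mul_mem_level hO hK (x := w) fun j => by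
    obtain ⟨u, hu, huw⟩ := happrox j
    exact ⟨_, ⟨u, hu, rfl⟩, level_anti (by omega) huw⟩
  exact ⟨u, hu.1, hu.2, huw⟩

end PAdicCoordinates


/-! ### The Iwahori decomposition -/

section Iwahori

variable {p : ℕ} {O : Type u} [CommRing O] [TopologicalSpace O]
  {A : Type u} [CommRing A] [HopfAlgebra O A] {n : ℕ} {π : A →ₐc[O] SplitTorus O n}

instance (k : ℕ) : (level p O A k).Normal := by
  unfold level
  infer_instance

/-- Characters of a free abelian group can be lifted along local homomorphisms. -/
theorem exists_monoidHom_lift {S S' : Type*} [CommRing S] [CommRing S'] (f : S →+* S')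
    [IsLocalHom f] (hf : Function.Surjective f) (t : Multiplicative (Fin n → ℤ) →* S') :
    ∃ s : Multiplicative (Fin n → ℤ) →* S, (f : S →* S').comp s = t := by
  let e : Fin n → Multiplicative (Fin n → ℤ) := fun i => Multiplicative.ofAdd (Pi.single i 1)
  have h : ∀ i, ∃ w : Sˣ, f w = t (e i) := by
    intro i
    obtain ⟨w, hw⟩ := hf (t (e i))
    have hu : IsUnit w := by
      refine isUnit_of_map_unit f w ?_
      rw [hw]
      exact (Group.isUnit (e i)).map t
    exact ⟨hu.unit, hw⟩
  choose w hw using h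
  let s : Multiplicative (Fin n → ℤ) →* Sˣ :=
    { toFun := fun χ => ∏ i, w i ^ (χ.toAdd i)
      map_one' := by simp
      map_mul' := fun a b => by simp [zpow_add, Finset.prod_mul_distrib] }
  refine ⟨(Units.coeHom S).comp s, ?_⟩
  refine MonoidHom.ext fun χ => ?_
  have hχ : χ = ∏ i, e i ^ (χ.toAdd i) := by
    refine Multiplicative.toAdd.injective ?_
    rw [toAdd_prod]
    ext j
    simp [e, Finset.sum_apply, Pi.single_apply]
  have h1 : Units.map (f : S →* S') (s χ) = t.toHomUnits χ := by
    conv_rhs => rw [hχ]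
    rw [map_prod]
    change Units.map (f : S →* S') (∏ i, w i ^ (χ.toAdd i)) = _
    rw [map_prod]
    refine Finset.prod_congr rfl fun i _ => ?_
    rw [map_zpow, map_zpow]
    congr 1
    exact Units.ext (hw i)
  exact congrArg Units.val h1

variable (hO : IsPAdicRing p O) [IsTopologicalRing O] [T2Space O] [CompactSpace O]
  [Algebra.FormallySmooth O A] (C : Coordinates π) (μ : (Fin n → ℤ) →+ ℤ)

include hO C

/-- To first order, a point of a congruence subgroup is decomposed by sorting its coordinates by the
sign of their weights. -/
theorem Coordinates.exists_decomposition_step {k : ℕ} (hk : 1 ≤ k) {z : Points O A O}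
    (hz : z ∈ level p O A k) :
    ∃ a ∈ unipotent π (-μ) O ⊓ level p O A k, ∃ t ∈ centralizer π μ O ⊓ level p O A k,
      ∃ b ∈ unipotent π μ O ⊓ level p O A k, (a * t * b)⁻¹ * z ∈ level p O A (k + 1) := by
  classical
  have hdvd : ∀ i, (p : O) ^ k ∣ z.hom (C.y i) := fun i =>
    dvd_hom_of_mem_augmentation hz (C.y_mem i)
  have key : ∀ Q : (Fin n → ℤ) → Prop, ∃ x ∈ level p O A k,
      ∀ i, x.hom (C.y i) = if Q (C.wt i) then z.hom (C.y i) else 0 := by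
    intro Q
    refine C.exists_mem_level hO hk _ fun i => ?_
    split_ifs
    · exact hdvd i
    · exact dvd_zero _
  obtain ⟨a, ha, hay⟩ := key fun χ => μ χ < 0
  obtain ⟨t, ht, hty⟩ := key fun χ => μ χ = 0
  obtain ⟨b, hb, hby⟩ := key fun χ => 0 < μ χ
  refine ⟨a, ⟨C.mem_unipotent hO (level_anti hk ha) fun i hi => ?_, ha⟩, t,
    ⟨C.mem_centralizer hO (level_anti hk ht) fun i hi => ?_, ht⟩, b,
    ⟨C.mem_unipotent hO (level_anti hk hb) fun i hi => ?_, hb⟩, ?_⟩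
  · rw [hay, if_neg]
    simpa using hi
  · rw [hty, if_neg hi]
  · rw [hby, if_neg (not_lt.2 hi)]
  · rw [inv_mul_mem_level_iff_dvd hO]
    refine C.dvd_hom_sub (level_anti hk (mul_mem (mul_mem ha ht) hb)) (level_anti hk hz) fun i => ?_
    -- Modulo `p ^ (2 * k)`, the coordinates are additive.
    let E := functionalFiltration hO A
    have h1 : functional (a * t * b) - 1 - ((functional a - 1) + (functional t - 1) +
        (functional b - 1)) ∈ E.E (k + 1) := by
      have e : functional (a * t * b) - 1 - ((functional a - 1) + (functional t - 1) +
          (functional b - 1)) = (functional a - 1) * (functional t - 1) +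
          (functional (a * t) - 1) * (functional b - 1) := by
        rw [map_mul, map_mul]
        simp only [sub_mul, mul_sub, one_mul, mul_one]
        abel
      rw [e]
      refine E.anti (by omega : k + 1 ≤ k + k) (add_mem (E.mul ?_ ?_) (E.mul ?_ ?_))
      · exact (mem_level_iff_functional hO).1 ha
      · exact (mem_level_iff_functional hO).1 ht
      · exact (mem_level_iff_functional hO).1 (mul_mem ha ht)
      · exact (mem_level_iff_functional hO).1 hb
    have h2 := h1 (C.y i)
    have hε : Coalgebra.counit (R := O) (C.y i) = 0 := C.y_mem i
    have h3 : (functional (a * t * b) - 1 - ((functional a - 1) + (functional t - 1) +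
        (functional b - 1))) (C.y i) = (a * t * b).hom (C.y i) - z.hom (C.y i) := by
      change (a * t * b).hom (C.y i) - Coalgebra.counit (R := O) (C.y i) -
        ((a.hom (C.y i) - Coalgebra.counit (R := O) (C.y i)) +
        (t.hom (C.y i) - Coalgebra.counit (R := O) (C.y i)) +
        (b.hom (C.y i) - Coalgebra.counit (R := O) (C.y i))) = _
      rw [hε, hay, hty, hby]
      rcases lt_trichotomy (μ (C.wt i)) 0 with h | h | h
      · simp [h, h.ne, h.not_gt]
      · simp [h]
      · simp [h, h.ne', h.not_gt]
    rwa [h3] at h2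

/-- The first congruence subgroup is the product of its intersections with the subgroups of the
triangular decomposition. -/
theorem Coordinates.exists_level_decomposition {x : Points O A O} (hx : x ∈ level p O A 1) :
    ∃ a ∈ unipotent π (-μ) O ⊓ level p O A 1, ∃ t ∈ centralizer π μ O ⊓ level p O A 1,
      ∃ b ∈ unipotent π μ O ⊓ level p O A 1, x = a * t * b := by
  let KA := unipotent π (-μ) O ⊓ level p O A 1
  let KT := centralizer π μ O ⊓ level p O A 1
  let KB := unipotent π μ O ⊓ level p O A 1
  have hA : IsCompact (KA : Set (Points O A O)) :=
    ((isClosed_unipotent π _).inter (isClosed_level hO 1)).isCompact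
  have hT : IsCompact (KT : Set (Points O A O)) :=
    ((isClosed_centralizer π μ).inter (isClosed_level hO 1)).isCompact
  have hB : IsCompact (KB : Set (Points O A O)) :=
    ((isClosed_unipotent π μ).inter (isClosed_level hO 1)).isCompact
  have hK := ((hA.mul hT).mul hB).isClosed
  have happrox : ∀ j, ∃ a ∈ KA, ∃ t ∈ KT, ∃ b ∈ KB, (a * t * b)⁻¹ * x ∈ level p O A (j + 1) := by
    intro j
    induction j with
    | zero => exact ⟨1, one_mem _, 1, one_mem _, 1, one_mem _, by simpa using hx⟩
    | succ j ih =>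
      obtain ⟨a, ha, t, ht, b, hb, h⟩ := ih
      have hle : level p O A (j + 1) ≤ level p O A 1 := level_anti (by omega)
      set z := (t * b) * ((a * t * b)⁻¹ * x) * (t * b)⁻¹ with hz
      have hzk : z ∈ level p O A (j + 1) := Subgroup.Normal.conj_mem inferInstance _ h _
      obtain ⟨a', ha', t', ht', b', hb', h'⟩ := C.exists_decomposition_step hO μ (by omega) hzk
      -- The correction of `t * b` on the left moves to its place: the torus part by normality, and
      -- the unipotent part by conjugation with `t`.
      refine ⟨a * a', mul_mem ha ⟨ha'.1, hle ha'.2⟩, t' * t, mul_mem ⟨ht'.1, hle ht'.2⟩ ht,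
        t⁻¹ * b' * t * b, mul_mem ⟨conj_mem_unipotent π μ ht.1 hb'.1, ?_⟩ hb, ?_⟩
      · have := Subgroup.Normal.conj_mem (H := level p O A 1) inferInstance _ (hle hb'.2) t⁻¹
        rwa [inv_inv] at this
      · have e : (a * a' * (t' * t) * (t⁻¹ * b' * t * b))⁻¹ * x =
            (t * b)⁻¹ * ((a' * t' * b')⁻¹ * z) * ((t * b)⁻¹)⁻¹ := by
          rw [hz]
          group
        rw [e]
        exact Subgroup.Normal.conj_mem inferInstance _ h' _
  obtain ⟨_, ⟨a, ha, t, ht, rfl⟩, b, hb, e⟩ := mem_of_forall_inv_mul_mem_level hO hK (x := x)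
    fun j => by
      obtain ⟨a, ha, t, ht, b, hb, h⟩ := happrox j
      exact ⟨_, Set.mul_mem_mul (Set.mul_mem_mul ha ht) hb, level_anti j.le_succ h⟩
  exact ⟨a, ha, t, ht, b, hb, e.symm⟩

/-- The Iwahori decomposition. The reduction of `x` is a product of a point of the torus and a
unipotent point, which can be lifted; then the decomposition of the first congruence subgroup
applies. -/
theorem Coordinates.exists_iwahori_decomposition [IsLocalRing O]
    (hreg : centralizer π μ (O ⧸ Ideal.span {(p : O) ^ 1}) =
      torus π (O ⧸ Ideal.span {(p : O) ^ 1}))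
    (hreg' : centralizer π μ O = torus π O) {x : Points O A O}
    (hx : map (Ideal.Quotient.mkₐ O (Ideal.span {(p : O) ^ 1})) x ∈
      parabolic π μ (O ⧸ Ideal.span {(p : O) ^ 1})) :
    ∃ a ∈ unipotent π (-μ) O ⊓ level p O A 1, ∃ t ∈ centralizer π μ O,
      ∃ b ∈ unipotent π μ O, x = a * t * b := by
  let I : Ideal O := Ideal.span {(p : O) ^ 1}
  have hI : I ≠ ⊤ := by
    intro h
    rw [Ideal.span_singleton_eq_top, pow_one] at h
    exact hO.not_isUnit h
  have : Nontrivial (O ⧸ I) := Ideal.Quotient.nontrivial_iff.2 hI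
  have : IsLocalHom (Ideal.Quotient.mk I) :=
    IsLocalHom.of_surjective _ Ideal.Quotient.mk_surjective
  obtain ⟨z', hz', u', hu', e⟩ := exists_centralizer_mul_unipotent π μ hx
  rw [hreg, mem_torus_iff] at hz'
  obtain ⟨s', rfl⟩ := hz'
  obtain ⟨s, hs⟩ := exists_monoidHom_lift (Ideal.Quotient.mk I) Ideal.Quotient.mk_surjective s'
  obtain ⟨u, hu, hu''⟩ := C.exists_unipotent_lift μ (Ideal.Quotient.mkₐ O I)
    Ideal.Quotient.mk_surjective hu'
  let z := torusPoint (O := O) π s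
  have hz : z ∈ centralizer π μ O := by
    rw [hreg', mem_torus_iff]
    exact ⟨s, rfl⟩
  have hl : x * (z * u)⁻¹ ∈ level p O A 1 := by
    change map (Ideal.Quotient.mkₐ O I) (x * (z * u)⁻¹) = 1
    rw [map_mul, map_inv, map_mul, hu'', map_torusPoint]
    refine mul_inv_eq_one.2 (e.trans ?_)
    rw [← hs]
    rfl
  obtain ⟨a, ha, t, ht, b, hb, e'⟩ := C.exists_level_decomposition hO μ hl
  refine ⟨a, ha, t * z, mul_mem ht.1 hz, z⁻¹ * b * z * u,
    mul_mem (conj_mem_unipotent π μ hz hb.1) hu, ?_⟩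
  rw [mul_inv_eq_iff_eq_mul.1 e']
  group

/-- Conjugation by an element of the torus that maps the first congruence subgroup of `U_H(μ)` into
deeper ones has the same effect on all congruence subgroups: it multiplies the `i`-th coordinate by
the value of a character, whose divisibility is seen from the action on the point whose only nonzero
coordinate is the `i`-th one, with the value `p`. -/
theorem Coordinates.mem_level_of_conj {K : Type u} [CommRing K] [Algebra O K]
    (hK : Function.Injective (algebraMap O K)) {g : Points O A K} (hg : g ∈ torus π K) {j : ℕ}
    (hj : ∀ x ∈ unipotent π μ O ⊓ level p O A 1, ∃ x' ∈ level p O A (1 + j),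
      map (IsScalarTower.toAlgHom O O K) x' = g * map (IsScalarTower.toAlgHom O O K) x * g⁻¹)
    {k : ℕ} {x x' : Points O A O}
    (hx : x ∈ level p O A k) (hx' : x' ∈ level p O A 1) (hxU' : x' ∈ unipotent π μ O)
    (e : map (IsScalarTower.toAlgHom O O K) x' =
      g * map (IsScalarTower.toAlgHom O O K) x * g⁻¹) : x' ∈ level p O A (k + j) := by
  classical
  obtain ⟨t, rfl⟩ := (mem_torus_iff π).1 hg
  refine C.mem_level hx' fun i => ?_
  by_cases hi : μ (C.wt i) ≤ 0
  · rw [C.hom_y_eq_zero hxU' hi]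
    exact dvd_zero _
  obtain ⟨x₀, hx₀, hx₀y⟩ := C.exists_mem_level_one hO (fun i' => if i' = i then (p : O) else 0)
    fun i' => by
      split_ifs
      · exact dvd_rfl
      · exact dvd_zero _
  have hx₀U : x₀ ∈ unipotent π μ O := C.mem_unipotent hO hx₀ fun i' hi' => by
    rw [hx₀y, if_neg]
    rintro rfl
    exact hi hi'
  obtain ⟨x₁, hx₁, e₁⟩ := hj x₀ ⟨hx₀U, hx₀⟩
  have act : ∀ w w' : Points O A O, map (IsScalarTower.toAlgHom O O K) w' =
      torusPoint π t * map (IsScalarTower.toAlgHom O O K) w * (torusPoint π t)⁻¹ →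
      algebraMap O K (w'.hom (C.y i)) =
        algebraMap O K (w.hom (C.y i)) * t (Multiplicative.ofAdd (C.wt i)) := by
    intro w w' h
    have h1 := conj_torusPoint_hom_weight π t (map (IsScalarTower.toAlgHom O O K) w) (C.wt i)
      (C.y i)
    rw [← h, C.weight_y] at h1
    exact h1
  have h0 := act _ _ e₁
  have h1 := act _ _ e
  rw [hx₀y, if_pos rfl] at h0
  have h2 : (p : O) * x'.hom (C.y i) = x.hom (C.y i) * x₁.hom (C.y i) := by
    apply hK
    rw [map_mul, map_mul, h0, h1]
    ring
  refine hO.dvd_of_mul_dvd ?_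
  rw [h2, add_assoc, add_comm j, pow_add]
  exact mul_dvd_mul (dvd_hom_of_mem_augmentation hx (C.y_mem i))
    (dvd_hom_of_mem_augmentation hx₁ (C.y_mem i))

end Iwahori

end Points

/-! ### Uniform filtrations -/

/-- A filtration of a topological group that behaves like the filtration of a uniform pro-`p`-group
by the subgroups of `p ^ k`-th powers, with commutators that lie `e` steps deeper than in a general
filtered group. -/
structure UniformFiltration (p e : ℕ) (N : Type*) [Group N] [TopologicalSpace N] where
  one_le : 1 ≤ e
  F : ℕ → Subgroup N
  zero : F 0 = ⊤
  anti : Antitone F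
  normal : ∀ k, (F k).Normal
  isOpen : ∀ k, IsOpen (F k : Set N)
  exists_subset : ∀ U ∈ nhds (1 : N), ∃ k, (F k : Set N) ⊆ U
  commutator : ∀ {i j x y}, x ∈ F i → y ∈ F j → x * y * x⁻¹ * y⁻¹ ∈ F (i + j + e)
  pow_iff : ∀ {k} {x y : N}, (x ^ p)⁻¹ * y ^ p ∈ F (k + 1) ↔ x⁻¹ * y ∈ F k
  mul_pow : ∀ {k x y}, x ∈ F k → y ∈ F k → ((x * y) ^ p)⁻¹ * (x ^ p * y ^ p) ∈ F (k + 2)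
  root : ∀ {k w}, w ∈ F (k + 1) → ∃ u ∈ F k, u ^ p = w

/-! ### The `p`-adic groups -/

namespace GroupDatum

variable {p : ℕ} [Fact p.Prime] (D : GroupDatum.{u} p)

theorem isPAdicRing (v : D.places) : IsPAdicRing p (D.O v) := RingOfIntegers.isPAdicRing p (D.L v)

instance (v : D.places) : CompactSpace (D.O v) := RingOfIntegers.compactSpace p (D.L v)

instance (v : D.places) : IsLocalRing (D.O v) := RingOfIntegers.isLocalRing (D.L v)

instance (v : D.places) : Algebra.Smooth (D.O v) (D.H v).A := (D.H v).smooth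

/-- A choice of homogeneous coordinates at the identity. -/
def coordinates (v : D.places) : Points.Coordinates (D.H v).π :=
  (Points.nonempty_coordinates (D.H v).π).some

theorem mem_ker_red_iff {k : ℕ} {x : D.G₀} :
    x ∈ (D.red k).ker ↔ ∀ v, x v ∈ Points.level p (D.O v) (D.H v).A k := by
  rw [MonoidHom.mem_ker, funext_iff]
  rfl

theorem mem_Nbar_iff {k : ℕ} {x : D.G₀} : x ∈ D.Nbar k ↔
    ∀ v, x v ∈ Points.unipotent (D.H v).π (-(D.H v).μ) (D.O v) ⊓
      Points.level p (D.O v) (D.H v).A k := by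
  rw [Nbar, Subgroup.mem_inf, mem_ker_red_iff, Subgroup.mem_pi]
  simp only [Set.mem_univ, true_imp_iff, Subgroup.mem_inf, forall_and]
  rfl

theorem mem_N₀_iff {x : D.G₀} : x ∈ D.N₀ ↔
    ∀ v, x v ∈ Points.unipotent (D.H v).π (D.H v).μ (D.O v) := by
  rw [N₀, Subgroup.mem_pi]
  simp only [Set.mem_univ, true_imp_iff]
  rfl

theorem mem_T₀_iff {x : D.G₀} : x ∈ D.T₀ ↔
    ∀ v, x v ∈ Points.centralizer (D.H v).π (D.H v).μ (D.O v) := by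
  rw [T₀, Subgroup.mem_pi]
  simp only [Set.mem_univ, true_imp_iff, (D.H _).regular]
  rfl

theorem isClosed_Nbar (k : ℕ) : IsClosed (D.Nbar k : Set D.G₀) := by
  have h : (D.Nbar k : Set D.G₀) = ⋂ v, (fun x : D.G₀ => x v) ⁻¹'
      (Points.unipotent (D.H v).π (-(D.H v).μ) (D.O v) ∩ Points.level p (D.O v) (D.H v).A k) := by
    ext x
    rw [SetLike.mem_coe, mem_Nbar_iff, Set.mem_iInter]
    rfl
  rw [h]
  exact isClosed_iInter fun v => ((Points.isClosed_unipotent _ _).inter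
    (Points.isClosed_level (D.isPAdicRing v) k)).preimage (continuous_apply v)

theorem isClosed_N₀ : IsClosed (D.N₀ : Set D.G₀) := by
  have h : (D.N₀ : Set D.G₀) = ⋂ v, (fun x : D.G₀ => x v) ⁻¹'
      (Points.unipotent (D.H v).π (D.H v).μ (D.O v)) := by
    ext x
    rw [SetLike.mem_coe, mem_N₀_iff, Set.mem_iInter]
    rfl
  rw [h]
  exact isClosed_iInter fun v => (Points.isClosed_unipotent _ _).preimage (continuous_apply v)

theorem isClosed_T₀ : IsClosed (D.T₀ : Set D.G₀) := by
  have h : (D.T₀ : Set D.G₀) = ⋂ v, (fun x : D.G₀ => x v) ⁻¹'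
      (Points.centralizer (D.H v).π (D.H v).μ (D.O v)) := by
    ext x
    rw [SetLike.mem_coe, mem_T₀_iff, Set.mem_iInter]
    rfl
  rw [h]
  exact isClosed_iInter fun v => (Points.isClosed_centralizer _ _).preimage (continuous_apply v)

instance (k : ℕ) : CompactSpace (D.Nbar k) :=
  isCompact_iff_compactSpace.1 (D.isClosed_Nbar k).isCompact

instance : CompactSpace D.N₀ := isCompact_iff_compactSpace.1 D.isClosed_N₀.isCompact

instance : CompactSpace D.T₀ := isCompact_iff_compactSpace.1 D.isClosed_T₀.isCompact

instance : CompactSpace D.NbarEps :=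
  isCompact_iff_compactSpace.1 D.isClopen_NbarEps.isClosed.isCompact

theorem exists_ker_red_subset {U : Set D.G₀} (hU : U ∈ nhds 1) :
    ∃ k, ((D.red k).ker : Set D.G₀) ⊆ U := by
  obtain ⟨J, W, hW, hWU⟩ := (Filter.mem_pi' (f := fun v => nhds (1 : (D.H v).Pts (D.O v)))).1
    (by rwa [nhds_pi] at hU)
  choose k hk using fun v => Points.exists_level_subset (D.isPAdicRing v) (hW v)
  refine ⟨∑ v, k v, fun x hx => hWU fun v _ =>
    hk v (Points.level_anti ?_ (D.mem_ker_red_iff.1 hx v))⟩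
  exact Finset.single_le_sum (f := k) (fun _ _ => Nat.zero_le _) (Finset.mem_univ v)

/-! ### The uniform filtration of the unipotent group -/

theorem two_le_mul_eps : 2 ≤ (p - 1) * eps p := by
  unfold eps
  split_ifs with h
  · rw [h]
  · have := (Fact.out : p.Prime).two_le
    omega

variable {D} {i j k : ℕ} {x y : D.G₀}

theorem conj_mem_Nbar (hx : x ∈ D.Nbar j) (hy : y ∈ D.Nbar k) : x * y * x⁻¹ ∈ D.Nbar k := by
  rw [mem_Nbar_iff] at hx hy ⊢
  exact fun v => ⟨Subgroup.mul_mem _ (Subgroup.mul_mem _ (hx v).1 (hy v).1)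
      (Subgroup.inv_mem _ (hx v).1),
    Subgroup.Normal.conj_mem inferInstance _ (hy v).2 _⟩

theorem commutator_mem_Nbar (hx : x ∈ D.Nbar i) (hy : y ∈ D.Nbar j) :
    x * y * x⁻¹ * y⁻¹ ∈ D.Nbar (i + j) := by
  rw [mem_Nbar_iff] at hx hy ⊢
  exact fun v => ⟨Subgroup.mul_mem _
      (Subgroup.mul_mem _ (Subgroup.mul_mem _ (hx v).1 (hy v).1) (Subgroup.inv_mem _ (hx v).1))
      (Subgroup.inv_mem _ (hy v).1),
    Points.commutator_mem_level (D.isPAdicRing v) (hx v).2 (hy v).2⟩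

theorem pow_inv_mul_pow_mem_Nbar_iff (hx : x ∈ D.Nbar (eps p)) (hy : y ∈ D.Nbar (eps p)) :
    (x ^ p)⁻¹ * y ^ p ∈ D.Nbar (k + 1) ↔ x⁻¹ * y ∈ D.Nbar k := by
  rw [mem_Nbar_iff] at hx hy ⊢
  rw [mem_Nbar_iff]
  refine forall_congr' fun v => ?_
  have h1 := Subgroup.mul_mem _ (Subgroup.inv_mem _ (Subgroup.pow_mem _ (hx v).1 p))
    (Subgroup.pow_mem _ (hy v).1 p)
  have h2 := Subgroup.mul_mem _ (Subgroup.inv_mem _ (hx v).1) (hy v).1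
  have h3 := Points.pow_inv_mul_pow_mem_level_iff (D.isPAdicRing v) (k := k) Fact.out two_le_mul_eps
    (one_le_eps p) (hx v).2 (hy v).2
  exact ⟨fun h => ⟨h2, h3.1 h.2⟩, fun h => ⟨h1, h3.2 h.2⟩⟩

theorem mul_pow_inv_mul_mem_Nbar (hk : eps p ≤ k) (hx : x ∈ D.Nbar k) (hy : y ∈ D.Nbar k) :
    ((x * y) ^ p)⁻¹ * (x ^ p * y ^ p) ∈ D.Nbar (k + 2) := by
  rw [mem_Nbar_iff] at hx hy ⊢
  exact fun v => ⟨Subgroup.mul_mem _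
      (Subgroup.inv_mem _ (Subgroup.pow_mem _ (Subgroup.mul_mem _ (hx v).1 (hy v).1) p))
      (Subgroup.mul_mem _ (Subgroup.pow_mem _ (hx v).1 p) (Subgroup.pow_mem _ (hy v).1 p)),
    Points.mul_pow_inv_mul_mem_level (D.isPAdicRing v) Fact.out two_le_mul_eps (one_le_eps p) hk
      (hx v).2 (hy v).2⟩

theorem exists_pow_eq_of_mem_Nbar (hk : eps p ≤ k) (hx : x ∈ D.Nbar (k + 1)) :
    ∃ u ∈ D.Nbar k, u ^ p = x := by
  rw [mem_Nbar_iff] at hx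
  choose u hu hu' hux using fun v => (D.coordinates v).exists_pow_eq (D.isPAdicRing v) Fact.out
    two_le_mul_eps (one_le_eps p) hk (hx v).1 (hx v).2
  exact ⟨u, D.mem_Nbar_iff.2 fun v => ⟨hu v, hu' v⟩, funext hux⟩

variable (D)

/-- The filtration of `N̄_ε` by the congruence subgroups `N̄_{ε + k}`. -/
def filtration : UniformFiltration p (eps p) D.NbarEps where
  one_le := one_le_eps p
  F k := ((D.Nbar (eps p + k)).subgroupOf (D.Nbar 1)).subgroupOf D.NbarEps
  zero := by
    refine eq_top_iff.2 fun x _ => ?_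
    exact x.2
  anti i j hij x hx := D.Nbar_anti (by omega) hx
  normal k := ⟨fun x hx y => conj_mem_Nbar y.2 hx⟩
  isOpen k := by
    have h : (((D.Nbar (eps p + k)).subgroupOf (D.Nbar 1)).subgroupOf D.NbarEps : Set D.NbarEps) =
        (fun x : D.NbarEps => ((x : D.Nbar 1) : D.G₀)) ⁻¹'
          ((D.red (eps p + k)).ker : Set D.G₀) := by
      ext x
      exact ⟨fun h => h.2, fun h => ⟨x.2.1, h⟩⟩
    rw [h]
    exact (D.isOpen_ker_red _).preimage (continuous_subtype_val.comp continuous_subtype_val)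
  exists_subset U hU := by
    rw [nhds_subtype_eq_comap, Filter.mem_comap] at hU
    obtain ⟨V, hV, hVU⟩ := hU
    rw [OneMemClass.coe_one, nhds_subtype_eq_comap, Filter.mem_comap] at hV
    obtain ⟨W, hW, hWV⟩ := hV
    obtain ⟨k, hk⟩ := D.exists_ker_red_subset hW
    exact ⟨k, fun x hx => hVU (hWV (hk (D.ker_red_anti (Nat.le_add_left _ _) hx.2)))⟩
  commutator {i j x y} hx hy := D.Nbar_anti (by omega : eps p + (i + j + eps p) ≤
    (eps p + i) + (eps p + j)) (commutator_mem_Nbar hx hy)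
  pow_iff {k x y} := pow_inv_mul_pow_mem_Nbar_iff (k := eps p + k) x.2 y.2
  mul_pow {k x y} hx hy := mul_pow_inv_mul_mem_Nbar (Nat.le_add_right _ _) hx hy
  root {k w} hw := by
    obtain ⟨u, hu, e⟩ := exists_pow_eq_of_mem_Nbar (by omega : eps p ≤ eps p + k) hw
    have h1 : u ∈ D.Nbar (eps p) := D.Nbar_anti (Nat.le_add_right _ _) hu
    exact ⟨⟨⟨u, D.Nbar_anti (one_le_eps p) h1⟩, h1⟩, hu, Subtype.ext (Subtype.ext e)⟩

theorem mem_filtration_iff {k : ℕ} {x : D.NbarEps} :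
    x ∈ D.filtration.F k ↔ ((x : D.Nbar 1) : D.G₀) ∈ D.Nbar (eps p + k) := Iff.rfl

/-- Contraction on `N̄₁` propagates to the deeper congruence subgroups. -/
theorem conjFun_mem {t : D.G} (htT : t ∈ D.T) {j : ℕ} (hj : D.ConjMapsInto t (1 + j))
    (ht : D.ConjMapsInto t 1) {k : ℕ} {x : D.Nbar 1} (hx : (x : D.G₀) ∈ D.Nbar k) :
    (D.conjFun ht x : D.G₀) ∈ D.Nbar (k + j) := by
  classical
  have hconj := D.incl_conjFun ht x
  have hmem := (D.conjFun ht x).2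
  rw [mem_Nbar_iff] at hx hmem ⊢
  refine fun v => ⟨(hmem v).1, ?_⟩
  refine (D.coordinates v).mem_level_of_conj (D.isPAdicRing v) (-(D.H v).μ) (K := D.L v)
    Subtype.val_injective (g := t v) (htT v trivial) (fun z hz => ?_) (hx v).2 (hmem v).2 (hmem v).1
    (congrFun hconj v)
  have hz' : Function.update (1 : D.G₀) v z ∈ D.Nbar 1 := by
    refine D.mem_Nbar_iff.2 fun w => ?_
    by_cases hw : w = v
    · subst hw
      rwa [Function.update_self]
    · rw [Function.update_of_ne hw]
      exact one_mem _
  obtain ⟨m, hm, e⟩ := hj _ hz'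
  refine ⟨m v, (D.mem_Nbar_iff.1 hm v).2, ?_⟩
  have h := congrFun e v
  have h1 : D.incl (Function.update (1 : D.G₀) v z) v =
      Points.map (IsScalarTower.toAlgHom (D.O v) (D.O v) (D.L v)) z := by
    change Points.map _ (Function.update (1 : D.G₀) v z v) = _
    rw [Function.update_self]
  rw [Pi.mul_apply, Pi.mul_apply, h1] at h
  exact h

/-! ### Functions on the Iwahori subgroup -/

theorem exists_iwahori_decomposition {x : D.G₀} (hx : x ∈ D.Iwahori) :
    ∃ a ∈ D.Nbar 1, ∃ t ∈ D.T₀, ∃ b ∈ D.N₀, x = a * (t * b) := by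
  have h : ∀ v, _ := fun v => (D.coordinates v).exists_iwahori_decomposition (D.isPAdicRing v)
    (D.H v).μ ((D.H v).regular _) ((D.H v).regular _) (hx v trivial)
  choose a ha t ht b hb e using h
  refine ⟨a, D.mem_Nbar_iff.2 ha, t, D.mem_T₀_iff.2 ht, b, D.mem_N₀_iff.2 hb, ?_⟩
  rw [← mul_assoc]
  exact funext e

theorem iwahori_decomposition_unique {a a' t t' b b' : D.G₀} (ha : a ∈ D.Nbar 1)
    (ha' : a' ∈ D.Nbar 1) (ht : t ∈ D.T₀) (ht' : t' ∈ D.T₀) (hb : b ∈ D.N₀) (hb' : b' ∈ D.N₀)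
    (h : a * (t * b) = a' * (t' * b')) : a = a' ∧ t = t' ∧ b = b' := by
  rw [mem_Nbar_iff] at ha ha'
  rw [mem_T₀_iff] at ht ht'
  rw [mem_N₀_iff] at hb hb'
  have ha1 : a = a' := by
    funext v
    have e : (a' v)⁻¹ * a v = (t' v * b' v) * (t v * b v)⁻¹ := by
      have h1 : a v * (t v * b v) = a' v * (t' v * b' v) := congrFun h v
      rw [eq_mul_inv_iff_mul_eq, mul_assoc, h1, inv_mul_cancel_left]
    have h2 : (a' v)⁻¹ * a v ∈ (⊥ : Subgroup ((D.H v).Pts (D.O v))) := by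
      rw [← Points.unipotent_neg_inf_parabolic (D.H v).π (D.H v).μ]
      refine ⟨Subgroup.mul_mem _ (Subgroup.inv_mem _ (ha' v).1) (ha v).1, ?_⟩
      rw [e]
      refine Subgroup.mul_mem _ (Subgroup.mul_mem _ ?_ ?_)
        (Subgroup.inv_mem _ (Subgroup.mul_mem _ ?_ ?_))
      · exact Points.centralizer_le_parabolic _ _ (ht' v)
      · exact Points.unipotent_le_parabolic _ _ (hb' v)
      · exact Points.centralizer_le_parabolic _ _ (ht v)
      · exact Points.unipotent_le_parabolic _ _ (hb v)
    exact (inv_mul_eq_one.1 h2).symm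
  subst ha1
  have h' := mul_left_cancel h
  have ht1 : t = t' := by
    funext v
    have e : (t' v)⁻¹ * t v = b' v * (b v)⁻¹ := by
      have h1 : t v * b v = t' v * b' v := congrFun h' v
      rw [eq_mul_inv_iff_mul_eq, mul_assoc, h1, inv_mul_cancel_left]
    have h2 : (t' v)⁻¹ * t v ∈ (⊥ : Subgroup ((D.H v).Pts (D.O v))) := by
      rw [← Points.centralizer_inf_unipotent (D.H v).π (D.H v).μ]
      refine ⟨Subgroup.mul_mem _ (Subgroup.inv_mem _ (ht' v)) (ht v), ?_⟩
      rw [e]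
      exact Subgroup.mul_mem _ (hb' v) (Subgroup.inv_mem _ (hb v))
    exact (inv_mul_eq_one.1 h2).symm
  subst ht1
  exact ⟨rfl, rfl, mul_left_cancel h'⟩

theorem T₀_le_Iwahori : D.T₀ ≤ D.Iwahori := fun x hx v _ =>
  (Points.mem_parabolic_iff _ _).2 fun χ hχ a => by
    have h := (Points.mem_centralizer_iff _ _).1 (D.mem_T₀_iff.1 hx v) χ hχ.ne a
    exact (congrArg (Ideal.Quotient.mk _) h).trans (map_zero _)

theorem N₀_le_Iwahori : D.N₀ ≤ D.Iwahori := fun x hx v _ =>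
  (Points.mem_parabolic_iff _ _).2 fun χ hχ a => by
    have h := ((Points.mem_unipotent_iff _ _).1 (D.mem_N₀_iff.1 hx v)).1 χ hχ a
    exact (congrArg (Ideal.Quotient.mk _) h).trans (map_zero _)

theorem conj_mem_N₀ {t b : D.G₀} (ht : t ∈ D.T₀) (hb : b ∈ D.N₀) : t⁻¹ * b * t ∈ D.N₀ := by
  rw [mem_N₀_iff] at hb ⊢
  exact fun v => Points.conj_mem_unipotent _ _ (D.mem_T₀_iff.1 ht v) (hb v)

/-- The Iwahori decomposition `I = N̄₁ T₀ N₀`. -/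
def iwahoriHomeomorph : D.Nbar 1 × D.T₀ × D.N₀ ≃ₜ D.Iwahori :=
  Continuous.homeoOfEquivCompactToT2
    (f := Equiv.ofBijective
      (fun x : D.Nbar 1 × D.T₀ × D.N₀ => (⟨x.1 * (x.2.1 * x.2.2), mul_mem (D.Nbar_le_Iwahori x.1.2)
        (mul_mem (D.T₀_le_Iwahori x.2.1.2) (D.N₀_le_Iwahori x.2.2.2))⟩ : D.Iwahori))
      ⟨fun x y h => by
        obtain ⟨h1, h2, h3⟩ := D.iwahori_decomposition_unique x.1.2 y.1.2 x.2.1.2 y.2.1.2 x.2.2.2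
          y.2.2.2 (congrArg Subtype.val h)
        exact Prod.ext (Subtype.ext h1) (Prod.ext (Subtype.ext h2) (Subtype.ext h3)),
      fun x => by
        obtain ⟨a, ha, t, ht, b, hb, e⟩ := D.exists_iwahori_decomposition x.2
        exact ⟨(⟨a, ha⟩, ⟨t, ht⟩, ⟨b, hb⟩), Subtype.ext e.symm⟩⟩)
    (by
      refine Continuous.subtype_mk ?_ _
      fun_prop)

theorem iwahoriHomeomorph_apply (x : D.Nbar 1 × D.T₀ × D.N₀) :
    (D.iwahoriHomeomorph x : D.G₀) = x.1 * (x.2.1 * x.2.2) := rfl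

instance : CompactSpace D.Iwahori := D.iwahoriHomeomorph.compactSpace

end GroupDatum

section Restriction

variable {p : ℕ} [Fact p.Prime] {D : GroupDatum.{u} p} {R : Type v} [NormedCommRing R]

/-- The function in `𝒜_κ` with given restriction to `N̄₁`: `n̄ t n ↦ κ(t) f(n̄)`. -/
def extend (κ : D.T₀ →* Rˣ) (hκ : Continuous κ) (f : C(D.Nbar 1, R)) : AKappa D κ :=
  ⟨⟨fun x => κ (D.iwahoriHomeomorph.symm x).2.1 * f (D.iwahoriHomeomorph.symm x).1, by
    have h : Continuous fun t => (κ t : R) := Units.continuous_val.comp hκ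
    fun_prop⟩, fun g g' t n hg => by
    obtain ⟨⟨a, s, b⟩, rfl⟩ := D.iwahoriHomeomorph.surjective g
    have e : g' = D.iwahoriHomeomorph (a, s * t,
        ⟨(t : D.G₀)⁻¹ * b * t * n, mul_mem (D.conj_mem_N₀ t.2 b.2) n.2⟩) := by
      apply Subtype.ext
      rw [hg, D.iwahoriHomeomorph_apply, D.iwahoriHomeomorph_apply]
      simp only [Subgroup.coe_mul]
      group
    subst e
    simp only [ContinuousMap.coe_mk, Homeomorph.symm_apply_apply, map_mul, Units.val_mul]
    ring⟩

/-- Restriction of functions from `I` to `N̄₁`. -/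
def restriction (κ : D.T₀ →* Rˣ) (hκ : Continuous κ) : AKappa D κ ≃L[R] C(D.Nbar 1, R) where
  toFun f := (f : C(D.Iwahori, R)).comp (nbarToIwahori D)
  map_add' _ _ := rfl
  map_smul' _ _ := rfl
  invFun := extend κ hκ
  left_inv f := by
    apply Subtype.ext
    ext x
    obtain ⟨⟨a, t, b⟩, rfl⟩ := D.iwahoriHomeomorph.surjective x
    change κ (D.iwahoriHomeomorph.symm _).2.1 *
      (f : C(D.Iwahori, R)) (nbarToIwahori D (D.iwahoriHomeomorph.symm _).1) = _
    rw [Homeomorph.symm_apply_apply]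
    exact (f.2 _ _ t b rfl).symm
  right_inv f := by
    ext x
    change κ (D.iwahoriHomeomorph.symm _).2.1 * f (D.iwahoriHomeomorph.symm _).1 = f x
    have e : nbarToIwahori D x = D.iwahoriHomeomorph (x, 1, 1) := by
      apply Subtype.ext
      rw [D.iwahoriHomeomorph_apply]
      simp [nbarToIwahori]
    rw [e, Homeomorph.symm_apply_apply]
    simp
  continuous_toFun := (ContinuousMap.continuous_precomp _).comp continuous_subtype_val
  continuous_invFun := by
    refine Continuous.subtype_mk ?_ _
    let m : C(D.Iwahori, R) := ⟨fun x => κ (D.iwahoriHomeomorph.symm x).2.1, by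
      have h : Continuous fun t => (κ t : R) := Units.continuous_val.comp hκ
      fun_prop⟩
    let q : C(D.Iwahori, D.Nbar 1) := ⟨fun x => (D.iwahoriHomeomorph.symm x).1, by fun_prop⟩
    exact (continuous_const (y := m)).mul (ContinuousMap.continuous_precomp q)

end Restriction

namespace UniformFiltration

/-! ### Power maps in a uniform group -/

section Algebra

variable {p e : ℕ} {N : Type*} [Group N] [TopologicalSpace N] (𝓕 : UniformFiltration p e N)
  {k : ℕ}

instance : (𝓕.F k).Normal := 𝓕.normal k

theorem mem_zero (x : N) : x ∈ 𝓕.F 0 := by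
  rw [𝓕.zero]
  trivial

theorem pow_pow_iff (j : ℕ) {x y : N} :
    (x ^ p ^ j)⁻¹ * y ^ p ^ j ∈ 𝓕.F (k + j) ↔ x⁻¹ * y ∈ 𝓕.F k := by
  induction j with
  | zero => simp
  | succ j ih =>
    rw [pow_succ, pow_mul, pow_mul, ← add_assoc, 𝓕.pow_iff, ih]

theorem pow_pow_mem (j : ℕ) {x : N} (hx : x ∈ 𝓕.F k) : x ^ p ^ j ∈ 𝓕.F (k + j) := by
  have h := (𝓕.pow_pow_iff j (x := 1) (y := x)).2 (by simpa using hx)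
  simpa using h

theorem exists_pow_pow_eq (j : ℕ) {w : N} (hw : w ∈ 𝓕.F (k + j)) : ∃ u ∈ 𝓕.F k, u ^ p ^ j = w := by
  induction j generalizing w with
  | zero => exact ⟨w, hw, by simp⟩
  | succ j ih =>
    obtain ⟨u, hu, rfl⟩ := 𝓕.root hw
    obtain ⟨v, hv, rfl⟩ := ih hu
    exact ⟨v, hv, by rw [pow_succ, pow_mul]⟩

theorem mk_eq_iff {x y : N} : (x : N ⧸ 𝓕.F k) = y ↔ x⁻¹ * y ∈ 𝓕.F k := QuotientGroup.eq

/-- `F k` is central modulo `F (k + 1)`. -/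
theorem commute_mk {x : N} (hx : x ∈ 𝓕.F k) (y : N ⧸ 𝓕.F (k + 1)) :
    Commute (x : N ⧸ 𝓕.F (k + 1)) y := by
  obtain ⟨y, rfl⟩ := QuotientGroup.mk_surjective y
  have h := 𝓕.anti (by have := 𝓕.one_le; omega : k + 1 ≤ 0 + k + e)
    (𝓕.commutator (𝓕.mem_zero y⁻¹) (inv_mem hx))
  refine 𝓕.mk_eq_iff.2 ?_
  have e1 : (x * y)⁻¹ * (y * x) = y⁻¹ * x⁻¹ * y⁻¹⁻¹ * x⁻¹⁻¹ := by group
  rw [e1]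
  exact h

/-- The `p ^ k`-th power map is a homomorphism from the group to `F k / F (k + 1)`. -/
def powHom (k : ℕ) : N →* N ⧸ 𝓕.F (k + 1) where
  toFun x := ((x ^ p ^ k : N) : N ⧸ 𝓕.F (k + 1))
  map_one' := by simp
  map_mul' x y := by
    induction k with
    | zero => simp
    | succ k ih =>
      rw [← QuotientGroup.mk_mul, 𝓕.mk_eq_iff] at ih ⊢
      have h1 := 𝓕.pow_iff.2 ih
      have h2 := 𝓕.mul_pow (k := k) (by simpa using 𝓕.pow_pow_mem k (𝓕.mem_zero x))
        (by simpa using 𝓕.pow_pow_mem k (𝓕.mem_zero y))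
      have h3 := mul_mem h1 h2
      rw [pow_succ, pow_mul, pow_mul, pow_mul]
      convert h3 using 1
      group

theorem powHom_apply (x : N) : 𝓕.powHom k x = ((x ^ p ^ k : N) : N ⧸ 𝓕.F (k + 1)) := rfl

theorem commute_powHom (x : N) (y : N ⧸ 𝓕.F (k + 1)) : Commute (𝓕.powHom k x) y :=
  𝓕.commute_mk (by simpa using 𝓕.pow_pow_mem k (𝓕.mem_zero x)) y

theorem powHom_eq_iff {x y : N} : 𝓕.powHom k x = 𝓕.powHom k y ↔ (x : N ⧸ 𝓕.F 1) = y := by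
  rw [powHom_apply, powHom_apply, 𝓕.mk_eq_iff, 𝓕.mk_eq_iff, add_comm k, 𝓕.pow_pow_iff]

theorem exists_powHom_eq {x : N} (hx : x ∈ 𝓕.F k) :
    ∃ y, 𝓕.powHom k y = (x : N ⧸ 𝓕.F (k + 1)) := by
  obtain ⟨u, -, hu⟩ := 𝓕.exists_pow_pow_eq (k := 0) k (by rwa [zero_add])
  exact ⟨u, by rw [powHom_apply, hu]⟩

/-- The quotient `N / F 1`, which is an elementary abelian `p`-group. -/
abbrev Quot (𝓕 : UniformFiltration p e N) : Type _ := N ⧸ 𝓕.F 1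

instance : CommGroup 𝓕.Quot :=
  { (inferInstance : Group (N ⧸ 𝓕.F 1)) with
    mul_comm := fun x y => by
      obtain ⟨x, rfl⟩ := QuotientGroup.mk_surjective x
      exact 𝓕.commute_mk (k := 0) (𝓕.mem_zero x) y }

instance : Module (ZMod p) (Additive 𝓕.Quot) :=
  AddCommGroup.zmodModule fun x => by
    obtain ⟨x, rfl⟩ := Additive.ofMul.surjective x
    obtain ⟨x, rfl⟩ := QuotientGroup.mk_surjective x
    change Additive.ofMul ((x : N ⧸ 𝓕.F 1) ^ p) = Additive.ofMul 1
    congr 1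
    rw [← QuotientGroup.mk_pow, QuotientGroup.eq_one_iff]
    simpa using 𝓕.pow_pow_mem 1 (𝓕.mem_zero x)

/-- A subgroup that surjects onto `N / F 1` is dense: it surjects onto every `N / F k`, because the
graded pieces `F k / F (k + 1)` are the images of the `p ^ k`-th power maps. -/
theorem exists_inv_mul_mem_of_mk_surjective {H : Subgroup N}
    (h : ∀ x, ∃ w ∈ H, (w : 𝓕.Quot) = (x : 𝓕.Quot)) (k : ℕ) (x : N) :
    ∃ w ∈ H, w⁻¹ * x ∈ 𝓕.F k := by
  induction k with
  | zero => exact ⟨1, one_mem _, 𝓕.mem_zero _⟩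
  | succ k ih =>
    obtain ⟨w, hw, hwx⟩ := ih
    obtain ⟨y, hy⟩ := 𝓕.exists_powHom_eq hwx
    obtain ⟨v, hv, hvy⟩ := h y
    refine ⟨w * v ^ p ^ k, mul_mem hw (pow_mem hv _), ?_⟩
    rw [← 𝓕.powHom_eq_iff (k := k), hy, powHom_apply, 𝓕.mk_eq_iff] at hvy
    rwa [mul_inv_rev, mul_assoc]

/-! ### Ordered products of powers -/

variable {d : ℕ} (g : Fin d → N)

/-- The ordered product `g₁ ^ m₁ ⋯ g_d ^ m_d`. -/
def _root_.OverconvergentDistributions.orderedProd {M : Type*} [Monoid M] {d : ℕ} (g : Fin d → M)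
    (m : Fin d → ℕ) : M :=
  (List.ofFn fun i => g i ^ m i).prod

theorem _root_.OverconvergentDistributions.map_orderedProd {M M' : Type*} [Monoid M] [Monoid M']
    (f : M →* M') (g : Fin d → M) (m : Fin d → ℕ) :
    f (orderedProd g m) = orderedProd (fun i => f (g i)) m := by
  rw [orderedProd, map_list_prod, List.map_ofFn, orderedProd]
  congr 2
  funext i
  exact map_pow f _ _

/-- Central factors can be collected on the right of an ordered product. -/
theorem _root_.OverconvergentDistributions.prod_ofFn_mul {M : Type*} [Monoid M] {d : ℕ}
    (a z : Fin d → M) (hz : ∀ i x, Commute (z i) x) :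
    (List.ofFn fun i => a i * z i).prod = (List.ofFn a).prod * (List.ofFn z).prod := by
  induction d with
  | zero => simp
  | succ d ih =>
    simp only [List.ofFn_succ, List.prod_cons]
    rw [ih _ _ fun i x => hz i.succ x]
    have h := (hz 0 (List.ofFn fun i : Fin d => a i.succ).prod).eq
    simp only [mul_assoc]
    congr 1
    simp only [← mul_assoc]
    congr 1

/-- Changing the exponents by multiples of `p ^ k` changes an ordered product by a `p ^ k`-th power,
to first order: this reduces statements on `N / F (k + 1)` to statements on `N / F k` and on the
vector space `N / F 1`. -/
theorem mk_orderedProd_add (m l : Fin d → ℕ) :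
    ((orderedProd g (fun i => m i + p ^ k * l i) : N) : N ⧸ 𝓕.F (k + 1)) =
      ((orderedProd g m : N) : N ⧸ 𝓕.F (k + 1)) * 𝓕.powHom k (orderedProd g l) := by
  have h1 : ∀ m : Fin d → ℕ, ((orderedProd g m : N) : N ⧸ 𝓕.F (k + 1)) =
      (List.ofFn fun i => ((g i ^ m i : N) : N ⧸ 𝓕.F (k + 1))).prod := fun m =>
    map_orderedProd (QuotientGroup.mk' (𝓕.F (k + 1))) g m
  rw [h1, h1, orderedProd, map_list_prod, List.map_ofFn]
  refine Eq.trans ?_ (prod_ofFn_mul _ _ fun i x => 𝓕.commute_powHom (g i ^ l i) x)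
  congr 2
  funext i
  rw [Function.comp_apply, powHom_apply, ← QuotientGroup.mk_mul, pow_add, mul_comm (p ^ k), pow_mul]

theorem mk_orderedProd_eq {m m' : Fin d → ℕ} (h : ∀ i, m i ≡ m' i [MOD p ^ k]) :
    ((orderedProd g m : N) : N ⧸ 𝓕.F k) = (orderedProd g m' : N) := by
  refine (map_orderedProd (QuotientGroup.mk' (𝓕.F k)) g m).trans
    (Eq.trans ?_ (map_orderedProd (QuotientGroup.mk' (𝓕.F k)) g m').symm)
  rw [orderedProd, orderedProd]
  congr 2
  funext i
  refine pow_eq_pow_iff_modEq.2 ((h i).of_dvd ?_)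
  refine orderOf_dvd_of_pow_eq_one ?_
  rw [← map_pow]
  refine (QuotientGroup.eq_one_iff _).2 ?_
  simpa using 𝓕.pow_pow_mem k (𝓕.mem_zero (g i))

theorem ofMul_orderedProd (m : Fin d → ℕ) :
    Additive.ofMul ((orderedProd g m : N) : 𝓕.Quot) =
      ∑ i, (m i : ZMod p) • Additive.ofMul (g i : 𝓕.Quot) := by
  have h : ((orderedProd g m : N) : 𝓕.Quot) = ∏ i, (g i : 𝓕.Quot) ^ m i :=
    (map_orderedProd (QuotientGroup.mk' (𝓕.F 1)) g m).trans (List.prod_ofFn ..)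
  rw [h, ofMul_prod]
  refine Finset.sum_congr rfl fun i _ => ?_
  rw [ofMul_pow, Nat.cast_smul_eq_nsmul]

variable {g}

/-- The ordered products of topological generators represent all classes modulo `F k`. -/
theorem exists_mk_orderedProd_eq [Fact p.Prime]
    (hspan : Submodule.span (ZMod p) (Set.range fun i => Additive.ofMul (g i : 𝓕.Quot)) = ⊤)
    (k : ℕ) (x : N) : ∃ m : Fin d → ℕ, ((orderedProd g m : N) : N ⧸ 𝓕.F k) = x := by
  have hone : ∀ y : 𝓕.Quot, ∃ l : Fin d → ℕ, ((orderedProd g l : N) : 𝓕.Quot) = y := by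
    intro y
    obtain ⟨c, hc⟩ := (Submodule.mem_span_range_iff_exists_fun (ZMod p)).1
      (hspan.ge (Submodule.mem_top (x := Additive.ofMul y)))
    refine ⟨fun i => (c i).val, Additive.ofMul.injective ?_⟩
    rw [ofMul_orderedProd, ← hc]
    simp
  induction k with
  | zero => exact ⟨0, 𝓕.mk_eq_iff.2 (𝓕.mem_zero _)⟩
  | succ k ih =>
    obtain ⟨m, hm⟩ := ih
    obtain ⟨y, hy⟩ := 𝓕.exists_powHom_eq (𝓕.mk_eq_iff.1 hm)
    obtain ⟨l, hl⟩ := hone y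
    refine ⟨_, (𝓕.mk_orderedProd_add g m l).trans ?_⟩
    rw [𝓕.powHom_eq_iff.2 hl, hy, ← QuotientGroup.mk_mul, mul_inv_cancel_left]

/-- Modulo `F k`, the exponents of an ordered product are determined modulo `p ^ k`. -/
theorem mk_orderedProd_eq_iff [Fact p.Prime]
    (hli : LinearIndependent (ZMod p) fun i => Additive.ofMul (g i : 𝓕.Quot))
    (k : ℕ) (m m' : Fin d → ℕ) :
    ((orderedProd g m : N) : N ⧸ 𝓕.F k) = (orderedProd g m' : N) ↔ ∀ i, m i ≡ m' i [MOD p ^ k] := by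
  refine ⟨?_, 𝓕.mk_orderedProd_eq g⟩
  induction k with
  | zero =>
    intro _ i
    rw [pow_zero]
    exact Nat.modEq_one
  | succ k ih =>
    intro h
    have h0 := ih (𝓕.mk_eq_iff.2 (𝓕.anti k.le_succ (𝓕.mk_eq_iff.1 h)))
    -- The exponents agree modulo `p ^ k`; their common residues cancel, and the comparison of the
    -- next digits takes place in `N / F 1`.
    have hm : m = fun i => m i % p ^ k + p ^ k * (m i / p ^ k) := by
      funext i
      rw [Nat.mod_add_div]
    have hm' : m' = fun i => m i % p ^ k + p ^ k * (m' i / p ^ k) := by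
      funext i
      rw [show m i % p ^ k = m' i % p ^ k from h0 i, Nat.mod_add_div]
    rw [hm, hm', 𝓕.mk_orderedProd_add, 𝓕.mk_orderedProd_add, mul_right_inj, 𝓕.powHom_eq_iff] at h
    have h1 := congrArg Additive.ofMul h
    rw [ofMul_orderedProd, ofMul_orderedProd, ← sub_eq_zero, ← Finset.sum_sub_distrib] at h1
    simp only [← sub_smul] at h1
    intro i
    have h2 := Fintype.linearIndependent_iff.1 hli _ h1 i
    rw [sub_eq_zero, ZMod.natCast_eq_natCast_iff] at h2
    have h3 := (h2.mul_left' (p ^ k)).add_left (m i % p ^ k)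
    rw [← pow_succ] at h3
    rw [hm, hm']
    exact h3

end Algebra

end UniformFiltration

/-! ### Coordinates of the second kind -/

theorem isLocallyConstant_toZModPow (p : ℕ) [Fact p.Prime] (k : ℕ) :
    IsLocallyConstant (PadicInt.toZModPow (p := p) k) := by
  refine IsLocallyConstant.iff_eventually_eq _ |>.2 fun x => ?_
  have hp : (0 : ℝ) < (p : ℝ) ^ (-(k : ℤ)) :=
    zpow_pos (Nat.cast_pos.2 (Fact.out : p.Prime).pos) _
  filter_upwards [Metric.closedBall_mem_nhds x hp] with y hy
  rw [← sub_eq_zero, ← map_sub, ← RingHom.mem_ker, PadicInt.ker_toZModPow,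
    ← PadicInt.norm_le_pow_iff_mem_span_pow]
  simpa [dist_eq_norm] using hy

namespace UniformFiltration

section Coordinates

variable {p e : ℕ} [Fact p.Prime] {N : Type*} [Group N] [TopologicalSpace N]
  (𝓕 : UniformFiltration p e N) [IsTopologicalGroup N] {d : ℕ} {g : Fin d → N}

omit [Fact p.Prime] [IsTopologicalGroup N] in
theorem eq_one_of_forall_mem [T2Space N] {x : N} (h : ∀ k, x ∈ 𝓕.F k) : x = 1 := by
  by_contra hx
  obtain ⟨k, hk⟩ := 𝓕.exists_subset {x}ᶜ (isOpen_compl_singleton.mem_nhds (Ne.symm hx))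
  exact hk (h k) rfl

omit [Fact p.Prime] in
theorem exists_coset_subset {x : N} {U : Set N} (hU : U ∈ nhds x) :
    ∃ k, ∀ y : N, (x : N ⧸ 𝓕.F k) = y → y ∈ U := by
  have h : (fun y => x * y) ⁻¹' U ∈ nhds 1 :=
    (continuous_const_mul x).continuousAt.preimage_mem_nhds (by simpa using hU)
  obtain ⟨k, hk⟩ := 𝓕.exists_subset _ h
  refine ⟨k, fun y hy => ?_⟩
  simpa using hk (𝓕.mk_eq_iff.1 hy)

omit [Fact p.Prime] in
theorem isOpen_coset (k : ℕ) (y : N ⧸ 𝓕.F k) : IsOpen {x : N | (x : N ⧸ 𝓕.F k) = y} := by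
  obtain ⟨y, rfl⟩ := QuotientGroup.mk_surjective y
  have h : {x : N | (x : N ⧸ 𝓕.F k) = y} = (fun x => x⁻¹ * y) ⁻¹' (𝓕.F k : Set N) := by
    ext x
    exact 𝓕.mk_eq_iff
  rw [h]
  exact (𝓕.isOpen k).preimage (by fun_prop)

omit [Fact p.Prime] in
theorem dense_of_quot {H : Subgroup N} (h : ∀ x, ∃ w ∈ H, (w : 𝓕.Quot) = (x : 𝓕.Quot)) :
    Dense (H : Set N) := by
  intro x
  rw [mem_closure_iff_nhds]
  intro U hU
  obtain ⟨k, hk⟩ := 𝓕.exists_coset_subset hU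
  obtain ⟨w, hw, hwx⟩ := 𝓕.exists_inv_mul_mem_of_mk_surjective h k x
  exact ⟨w, hk w (𝓕.mk_eq_iff.2 hwx).symm, hw⟩

theorem span_eq_top (hg : Dense ((Subgroup.closure (Set.range g) : Subgroup N) : Set N)) :
    Submodule.span (ZMod p) (Set.range fun i => Additive.ofMul (g i : 𝓕.Quot)) = ⊤ := by
  refine eq_top_iff.2 fun x _ => ?_
  obtain ⟨x, rfl⟩ := Additive.ofMul.surjective x
  obtain ⟨x, rfl⟩ := QuotientGroup.mk_surjective x
  obtain ⟨w, hwx, hw⟩ := hg.exists_mem_open (𝓕.isOpen_coset 1 x) ⟨x, rfl⟩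
  have h1 : (w : 𝓕.Quot) = x := hw
  clear hw
  change Additive.ofMul (x : 𝓕.Quot) ∈ _
  rw [← h1]
  clear h1
  induction hwx using Subgroup.closure_induction with
  | mem y hy =>
    obtain ⟨i, rfl⟩ := hy
    exact Submodule.subset_span ⟨i, rfl⟩
  | one => exact zero_mem _
  | mul y z _ _ hy hz => exact add_mem hy hz
  | inv y _ hy => exact neg_mem hy

/-- A minimal system of topological generators gives a basis of `N / F 1`: a lift of a basis
generates a dense subgroup. -/
theorem linearIndependent_of_minimal
    (hg : Dense ((Subgroup.closure (Set.range g) : Subgroup N) : Set N))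
    (hmin : ∀ (d' : ℕ) (g' : Fin d' → N),
      Dense ((Subgroup.closure (Set.range g') : Subgroup N) : Set N) → d ≤ d') :
    LinearIndependent (ZMod p) fun i => Additive.ofMul (g i : 𝓕.Quot) := by
  have : Module.Finite (ZMod p) (Additive 𝓕.Quot) :=
    ⟨Submodule.fg_def.2 ⟨_, Set.finite_range _, 𝓕.span_eq_top hg⟩⟩
  let b := Module.finBasis (ZMod p) (Additive 𝓕.Quot)
  choose g' hg' using fun i => QuotientGroup.mk_surjective (b i).toMul
  refine linearIndependent_of_top_le_span_of_card_le_finrank (𝓕.span_eq_top hg).ge ?_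
  rw [Fintype.card_fin]
  refine hmin _ g' (𝓕.dense_of_quot fun x => ?_)
  let K : Submodule (ZMod p) (Additive 𝓕.Quot) := AddSubgroup.toZModSubmodule p
    (Subgroup.toAddSubgroup ((Subgroup.closure (Set.range g')).map (QuotientGroup.mk' (𝓕.F 1))))
  have hK : K = ⊤ := by
    rw [eq_top_iff, ← b.span_eq, Submodule.span_le]
    rintro _ ⟨i, rfl⟩
    exact ⟨g' i, Subgroup.subset_closure ⟨i, rfl⟩, hg' i⟩
  have hx : Additive.ofMul (x : 𝓕.Quot) ∈ K := hK ▸ Submodule.mem_top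
  exact hx

/-- The class modulo `F k` of `g₁ ^ x₁ ⋯ g_d ^ x_d`, for `p`-adic exponents. -/
def approx (g : Fin d → N) (k : ℕ) (x : Fin d → ℤ_[p]) : N ⧸ 𝓕.F k :=
  (orderedProd g (fun i => (PadicInt.toZModPow k (x i)).val) : N)

omit [IsTopologicalGroup N] in
theorem approx_natCast (k : ℕ) (m : Fin d → ℕ) :
    𝓕.approx g k (fun i => (m i : ℤ_[p])) = (orderedProd g m : N) := by
  refine 𝓕.mk_orderedProd_eq g fun i => ?_
  rw [map_natCast, ZMod.val_natCast]
  exact Nat.mod_modEq _ _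

omit [IsTopologicalGroup N] in
theorem approx_succ {k : ℕ} {x : Fin d → ℤ_[p]} {y : N} (h : 𝓕.approx g (k + 1) x = y) :
    𝓕.approx g k x = y := by
  have h1 := 𝓕.mk_eq_iff.2 (𝓕.anti k.le_succ (𝓕.mk_eq_iff.1 h))
  rw [← h1]
  refine 𝓕.mk_orderedProd_eq g fun i => ?_
  rw [← PadicInt.cast_toZModPow k (k + 1) k.le_succ, ZMod.cast_eq_val, ZMod.val_natCast]
  exact Nat.mod_modEq _ _

omit [IsTopologicalGroup N] in
theorem isLocallyConstant_approx (g : Fin d → N) (k : ℕ) :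
    IsLocallyConstant (𝓕.approx g k) := by
  refine IsLocallyConstant.iff_eventually_eq _ |>.2 fun x => ?_
  have h : ∀ i, ∀ᶠ x' in nhds x, PadicInt.toZModPow k (x' i) = PadicInt.toZModPow k (x i) :=
    fun i => (continuous_apply i).continuousAt.eventually
      ((IsLocallyConstant.iff_eventually_eq _).1 (isLocallyConstant_toZModPow p k) (x i))
  filter_upwards [Filter.eventually_all.2 h] with x' hx'
  rw [approx, approx]
  simp only [hx']

include 𝓕 in
/-- The map `x ↦ g₁ ^ x₁ ⋯ g_d ^ x_d`, for a minimal system of topological generators, is a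
homeomorphism. -/
theorem exists_homeomorph [CompactSpace N] [T2Space N]
    (hg : Dense ((Subgroup.closure (Set.range g) : Subgroup N) : Set N))
    (hmin : ∀ (d' : ℕ) (g' : Fin d' → N),
      Dense ((Subgroup.closure (Set.range g') : Subgroup N) : Set N) → d ≤ d') :
    ∃ c : (Fin d → ℤ_[p]) ≃ₜ N, ∀ m : Fin d → ℕ,
      c (fun i => (m i : ℤ_[p])) = (List.ofFn fun i => g i ^ m i).prod := by
  have hspan := 𝓕.span_eq_top hg
  have hli := 𝓕.linearIndependent_of_minimal hg hmin
  -- The compatible classes `approx g k x` have a common representative, by compactness.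
  have hex : ∀ x : Fin d → ℤ_[p], ∃ y : N, ∀ k, 𝓕.approx g k x = y := by
    intro x
    let V : ℕ → Set N := fun k => {y | (y : N ⧸ 𝓕.F k) = 𝓕.approx g k x}
    have hc : ∀ k, IsClosed (V k) := by
      intro k
      rw [← isOpen_compl_iff]
      have : (V k)ᶜ = ⋃ z ∈ {z | z ≠ 𝓕.approx g k x}, {y : N | (y : N ⧸ 𝓕.F k) = z} := by
        ext y
        simp [V]
      rw [this]
      exact isOpen_biUnion fun z _ => 𝓕.isOpen_coset k z
    obtain ⟨y, hy⟩ := (hc 0).isCompact.nonempty_iInter_of_sequence_nonempty_isCompact_isClosed V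
      (fun k y hy => (𝓕.approx_succ (Eq.symm hy)).symm)
      (fun k => QuotientGroup.mk_surjective (𝓕.approx g k x)) hc
    exact ⟨y, fun k => (Set.mem_iInter.1 hy k).symm⟩
  choose c hc using hex
  have hunique : ∀ {y y' : N}, (∀ k, (y : N ⧸ 𝓕.F k) = y') → y = y' := fun h =>
    inv_mul_eq_one.1 (𝓕.eq_one_of_forall_mem fun k => 𝓕.mk_eq_iff.1 (h k))
  have hinj : Function.Injective c := by
    intro x x' h
    funext i
    refine PadicInt.ext_of_toZModPow.1 fun k => ?_
    have h1 : 𝓕.approx g k x = 𝓕.approx g k x' := by rw [hc, hc, h]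
    have h2 := (𝓕.mk_orderedProd_eq_iff hli k _ _).1 h1 i
    rw [← ZMod.natCast_eq_natCast_iff, ZMod.natCast_zmod_val, ZMod.natCast_zmod_val] at h2
    exact h2
  have hsurj : Function.Surjective c := by
    intro y
    let V : ℕ → Set (Fin d → ℤ_[p]) := fun k => {x | 𝓕.approx g k x = y}
    have hV : ∀ k, IsClosed (V k) := fun k => (𝓕.isLocallyConstant_approx g k).isClosed_fiber _
    obtain ⟨x, hx⟩ := (hV 0).isCompact.nonempty_iInter_of_sequence_nonempty_isCompact_isClosed V
      (fun k x hx => 𝓕.approx_succ hx)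
      (fun k => by
        obtain ⟨m, hm⟩ := 𝓕.exists_mk_orderedProd_eq hspan k y
        exact ⟨_, (𝓕.approx_natCast k m).trans hm⟩) hV
    refine ⟨x, hunique fun k => ?_⟩
    rw [← hc]
    exact Set.mem_iInter.1 hx k
  have hcont : Continuous c := by
    rw [continuous_iff_continuousAt]
    intro x U hU
    obtain ⟨k, hk⟩ := 𝓕.exists_coset_subset hU
    refine Filter.mem_map.2 (((IsLocallyConstant.iff_eventually_eq _).1
      (𝓕.isLocallyConstant_approx g k) x).mono fun x' hx' => hk _ ?_)
    rw [← hc, ← hc, hx']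
  refine ⟨Continuous.homeoOfEquivCompactToT2 (f := Equiv.ofBijective c ⟨hinj, hsurj⟩) hcont,
    fun m => hunique fun k => ?_⟩
  change ((c _ : N) : N ⧸ 𝓕.F k) = _
  rw [← hc, approx_natCast]
  rfl

end Coordinates

end UniformFiltration

/-! ### Powers of the augmentation ideal -/

section Augmentation

variable {p : ℕ} {N A : Type*} [Group N] [Ring A] (ω : N →* A)

/-- The additive group generated by `p` and the elements `h - 1`, for the elements `h` of a group
that is mapped to a ring. If the ring is generated by the group, this is an ideal. -/
def augIdeal (p : ℕ) (ω : N →* A) : Submodule ℤ A :=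
  Submodule.span ℤ ({(p : A)} ∪ Set.range fun h => ω h - 1)

theorem natCast_mem_augIdeal : (p : A) ∈ augIdeal p ω :=
  Submodule.subset_span (Or.inl rfl)

theorem sub_one_mem_augIdeal (h : N) : ω h - 1 ∈ augIdeal p ω :=
  Submodule.subset_span (Or.inr ⟨h, rfl⟩)

variable {ω}

theorem mul_mem_augIdeal_pow {i j : ℕ} {x y : A} (hx : x ∈ augIdeal p ω ^ i)
    (hy : y ∈ augIdeal p ω ^ j) : x * y ∈ augIdeal p ω ^ (i + j) := by
  rw [pow_add]
  exact Submodule.mul_mem_mul hx hy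

theorem mul_mem_augIdeal_pow_succ {i : ℕ} {x y : A} (hx : x ∈ augIdeal p ω ^ i)
    (hy : y ∈ augIdeal p ω) : x * y ∈ augIdeal p ω ^ (i + 1) :=
  mul_mem_augIdeal_pow hx (by rwa [pow_one])

theorem mul_mem_augIdeal_pow_succ' {i : ℕ} {x y : A} (hx : x ∈ augIdeal p ω)
    (hy : y ∈ augIdeal p ω ^ i) : x * y ∈ augIdeal p ω ^ (i + 1) := by
  rw [add_comm]
  exact mul_mem_augIdeal_pow (by rwa [pow_one]) hy

theorem augIdeal_mul_le : augIdeal p ω * augIdeal p ω ≤ augIdeal p ω := by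
  rw [augIdeal, Submodule.span_mul_span, Submodule.span_le, ← augIdeal]
  rintro _ ⟨x, hx, y, hy, rfl⟩
  rcases hx with rfl | ⟨h, rfl⟩
  · change (p : A) * y ∈ augIdeal p ω
    rw [← nsmul_eq_mul]
    exact nsmul_mem (Submodule.subset_span hy) p
  · rcases hy with rfl | ⟨h', rfl⟩
    · change (ω h - 1) * (p : A) ∈ augIdeal p ω
      rw [(Nat.cast_commute p _).symm.eq, ← nsmul_eq_mul]
      exact nsmul_mem (sub_one_mem_augIdeal ω h) p
    · have e : (ω h - 1) * (ω h' - 1) = (ω (h * h') - 1) - (ω h - 1) - (ω h' - 1) := by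
        rw [map_mul]
        noncomm_ring
      change (ω h - 1) * (ω h' - 1) ∈ augIdeal p ω
      rw [e]
      exact sub_mem (sub_mem (sub_one_mem_augIdeal ω _) (sub_one_mem_augIdeal ω _))
        (sub_one_mem_augIdeal ω _)

theorem augIdeal_pow_anti {i j : ℕ} (hi : 1 ≤ i) (h : i ≤ j) :
    augIdeal p ω ^ j ≤ augIdeal p ω ^ i := by
  induction j, h using Nat.le_induction with
  | base => exact le_rfl
  | succ j hij ih =>
    refine le_trans ?_ ih
    obtain ⟨m, rfl⟩ : ∃ m, j = m + 1 := ⟨j - 1, by omega⟩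
    rw [pow_succ, pow_succ, mul_assoc]
    exact Submodule.mul_le.2 fun a ha b hb => Submodule.mul_mem_mul ha (augIdeal_mul_le hb)

/-- In the binomial expansion of `((u - 1) + 1) ^ p - 1`, all terms but the last are divisible by
`p`. -/
theorem exists_map_pow_sub_one (hp : p.Prime) (u : N) :
    ∃ y ∈ augIdeal p ω, ω (u ^ p) - 1 - p * y ∈ augIdeal p ω ^ p := by
  obtain ⟨m, hm⟩ : ∃ m, p = m + 1 := ⟨p - 1, by have := hp.one_lt; omega⟩
  set x := ω u - 1 with hx
  have hxJ : x ∈ augIdeal p ω := sub_one_mem_augIdeal ω u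
  have hpow : ∀ j, x ^ j ∈ augIdeal p ω ^ j := fun j => Submodule.pow_mem_pow _ hxJ j
  have e : ω (u ^ p) = (x + 1) ^ p := by rw [hx, sub_add_cancel, map_pow]
  refine ⟨∑ j ∈ Finset.range m, (p.choose (j + 1) / p) • x ^ (j + 1), sum_mem fun j _ => ?_, ?_⟩
  · refine nsmul_mem ?_ _
    have := augIdeal_pow_anti (p := p) (ω := ω) le_rfl (Nat.le_add_left 1 j) (hpow (j + 1))
    rwa [pow_one] at this
  · have h1 : ω (u ^ p) - 1 - p * ∑ j ∈ Finset.range m, (p.choose (j + 1) / p) • x ^ (j + 1) =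
        x ^ p := by
      rw [e, (Commute.one_right x).add_pow]
      conv_lhs => rw [hm]
      rw [Finset.sum_range_succ, Finset.sum_range_succ', ← hm, Finset.mul_sum]
      have h2 : ∀ j ∈ Finset.range m, x ^ (j + 1) * 1 ^ (p - (j + 1)) * (p.choose (j + 1) : A) =
          p * (p.choose (j + 1) / p) • x ^ (j + 1) := by
        intro j hj
        rw [Finset.mem_range] at hj
        rw [one_pow, mul_one, ← nsmul_eq_mul, smul_smul, Nat.mul_div_cancel'
          (hp.dvd_choose_self (by omega) (by omega)), nsmul_eq_mul, Nat.cast_comm]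
      rw [Finset.sum_congr rfl h2]
      simp
      abel
    rw [h1]
    exact hpow p

theorem map_pow_sub_one_mem (hp : p.Prime) (u : N) : ω (u ^ p) - 1 ∈ augIdeal p ω ^ 2 := by
  obtain ⟨y, hy, h⟩ := exists_map_pow_sub_one (ω := ω) hp u
  have h1 := augIdeal_pow_anti one_le_two hp.two_le h
  have h2 := mul_mem_augIdeal_pow_succ (i := 1)
    (by rw [pow_one]; exact natCast_mem_augIdeal ω) hy
  have h3 := add_mem h1 h2
  rwa [sub_add_cancel] at h3

/-- A commutator in a uniform group is a `p ^ ε`-th power, and this congruence modulo `J ^ 3` is the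
reason for `ε = 2` if `p = 2`: the square `(u - 1) ^ 2` in `u ^ 2 - 1` is not in `2 J + J ^ 3`. -/
theorem exists_map_pow_eps_sub_one (hp : p.Prime) (u : N) :
    ∃ y ∈ augIdeal p ω, ω (u ^ p ^ GroupDatum.eps p) - 1 - p * y ∈ augIdeal p ω ^ 3 := by
  unfold GroupDatum.eps
  split_ifs with h2
  · subst h2
    have hv := map_pow_sub_one_mem (ω := ω) hp u
    refine ⟨ω (u ^ 2) - 1, sub_one_mem_augIdeal ω _, ?_⟩
    have e : ω (u ^ 2 ^ 2) - 1 - ((2 : ℕ) : A) * (ω (u ^ 2) - 1) =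
        (ω (u ^ 2) - 1) * (ω (u ^ 2) - 1) := by
      rw [pow_two 2, pow_mul, pow_two (u ^ 2), map_mul, Nat.cast_two]
      noncomm_ring
    rw [e]
    exact augIdeal_pow_anti (by norm_num) (by norm_num) (mul_mem_augIdeal_pow hv hv)
  · obtain ⟨y, hy, h⟩ := exists_map_pow_sub_one (ω := ω) hp u
    have := hp.two_le
    exact ⟨y, hy, by rw [pow_one]; exact augIdeal_pow_anti (by norm_num) (by omega) h⟩

/-- Modulo `J ^ 2`, the ideal `J` is generated by `p` and the elements `g_i - 1`: the map
`h ↦ ω h - 1` to `J / J ^ 2` is a homomorphism that kills `p`-th powers. -/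
theorem exists_of_mem_augIdeal (hp : p.Prime) {d : ℕ} {g : Fin d → N}
    (hgen : ∀ h, ∃ m u, h = orderedProd g m * u ^ p) {x : A} (hx : x ∈ augIdeal p ω) :
    ∃ t ∈ Submodule.span ℤ (Set.range fun i => ω (g i) - 1), ∃ c : ℤ,
      x - t - p * (c : A) ∈ augIdeal p ω ^ 2 := by
  set T := Submodule.span ℤ (Set.range fun i => ω (g i) - 1)
  let K : Submonoid N :=
    { carrier := {h | ω h - 1 ∈ T ⊔ augIdeal p ω ^ 2}
      one_mem' := by simp
      mul_mem' := by
        intro a b ha hb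
        have e : ω (a * b) - 1 = (ω a - 1) * (ω b - 1) + ((ω a - 1) + (ω b - 1)) := by
          rw [map_mul]
          noncomm_ring
        change ω (a * b) - 1 ∈ T ⊔ augIdeal p ω ^ 2
        rw [e]
        refine add_mem (Submodule.mem_sup_right ?_) (add_mem ha hb)
        rw [pow_two]
        exact Submodule.mul_mem_mul (sub_one_mem_augIdeal ω a) (sub_one_mem_augIdeal ω b) }
  have hK : ∀ h, h ∈ K := by
    intro h
    obtain ⟨m, u, rfl⟩ := hgen h
    refine mul_mem (K.list_prod_mem fun z hz => ?_)
      (Submodule.mem_sup_right (map_pow_sub_one_mem hp u))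
    obtain ⟨i, rfl⟩ := List.mem_ofFn.1 hz
    have hi : g i ∈ K :=
      Submodule.mem_sup_left (Submodule.subset_span (s := Set.range fun i => ω (g i) - 1) ⟨i, rfl⟩)
    exact pow_mem hi _
  refine Submodule.span_induction (p := fun x _ => ∃ t ∈ T, ∃ c : ℤ,
    x - t - p * (c : A) ∈ augIdeal p ω ^ 2) ?_ ?_ ?_ ?_ hx
  · rintro x (rfl | ⟨h, rfl⟩)
    · exact ⟨0, zero_mem _, 1, by simp⟩
    · obtain ⟨t, ht, w, hw, e⟩ := Submodule.mem_sup.1 (hK h)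
      refine ⟨t, ht, 0, ?_⟩
      have e1 : ω h - 1 - t - p * ((0 : ℤ) : A) = w := by
        rw [← e]
        simp
      exact e1 ▸ hw
  · exact ⟨0, zero_mem _, 0, by simp⟩
  · rintro x y - - ⟨t, ht, c, h⟩ ⟨t', ht', c', h'⟩
    refine ⟨t + t', add_mem ht ht', c + c', ?_⟩
    convert add_mem h h' using 1
    push_cast
    noncomm_ring
  · rintro a x - ⟨t, ht, c, h⟩
    refine ⟨a • t, T.smul_mem a ht, a * c, ?_⟩
    convert (augIdeal p ω ^ 2).smul_mem a h using 1
    have e1 : (p : A) * ((a * c : ℤ) : A) = a • ((p : A) * (c : A)) := by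
      rw [zsmul_eq_mul, Int.cast_mul, ← mul_assoc, ← mul_assoc, (Int.cast_commute a (p : A)).eq]
    rw [e1, smul_sub, smul_sub]

variable {d : ℕ} {g : Fin d → N}

theorem prod_map_mem (l : List (Fin d)) :
    (l.map fun i => ω (g i) - 1).prod ∈ augIdeal p ω ^ l.length := by
  induction l with
  | nil => exact Submodule.mem_one.2 ⟨1, by simp⟩
  | cons i l ih =>
    rw [List.map_cons, List.prod_cons, List.length_cons]
    exact mul_mem_augIdeal_pow_succ' (sub_one_mem_augIdeal ω _) ih

/-- Words in the elements `g_i - 1`, and terms that are divisible by `p`, generate a power of the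
augmentation ideal modulo the next one. -/
theorem exists_of_mem_augIdeal_pow (hp : p.Prime)
    (hgen : ∀ h, ∃ m u, h = orderedProd g m * u ^ p) {n : ℕ} {x : A}
    (hx : x ∈ augIdeal p ω ^ (n + 1)) :
    ∃ t ∈ Submodule.span ℤ {w : A | ∃ l : List (Fin d), l.length = n + 1 ∧
        w = (l.map fun i => ω (g i) - 1).prod},
      ∃ z ∈ augIdeal p ω ^ n, x - t - p * z ∈ augIdeal p ω ^ (n + 2) := by
  induction n generalizing x with
  | zero =>
    rw [zero_add, pow_one] at hx
    obtain ⟨t, ht, c, h⟩ := exists_of_mem_augIdeal hp hgen hx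
    refine ⟨t, Submodule.span_mono ?_ ht, c, ?_, h⟩
    · rintro _ ⟨i, rfl⟩
      exact ⟨[i], rfl, by simp⟩
    · rw [pow_zero]
      exact Submodule.mem_one.2 ⟨c, by simp⟩
  | succ n ih =>
    have hT : ∀ {t}, t ∈ Submodule.span ℤ {w : A | ∃ l : List (Fin d), l.length = n + 1 ∧
        w = (l.map fun i => ω (g i) - 1).prod} → t ∈ augIdeal p ω ^ (n + 1) := by
      intro t ht
      refine (Submodule.span_le.2 ?_) ht
      rintro _ ⟨l, hl, rfl⟩
      rw [← hl]
      exact prod_map_mem l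
    rw [pow_succ] at hx
    refine Submodule.mul_induction_on hx (fun a ha b hb => ?_) ?_
    · obtain ⟨t, ht, z, hz, h⟩ := ih ha
      obtain ⟨t', ht', c, h'⟩ := exists_of_mem_augIdeal hp hgen hb
      refine ⟨t * t', ?_, c • t + z * b, add_mem (Submodule.smul_mem _ c (hT ht))
        (mul_mem_augIdeal_pow_succ hz hb), ?_⟩
      · have h1 := Submodule.mul_mem_mul ht ht'
        rw [Submodule.span_mul_span] at h1
        refine Submodule.span_mono ?_ h1
        rintro _ ⟨_, ⟨l, hl, rfl⟩, _, ⟨i, rfl⟩, rfl⟩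
        exact ⟨l ++ [i], by simp [hl], by simp⟩
      · have e : a * b - t * t' - p * (c • t + z * b) =
            (a - t - p * z) * b + t * (b - t' - p * (c : A)) := by
          have h1 : (p : A) * (c • t) = t * (p * (c : A)) := by
            rw [zsmul_eq_mul, ← mul_assoc, ← Int.cast_natCast, ← Int.cast_mul,
              (Int.cast_commute _ t).eq, Int.cast_mul]
          rw [mul_add, h1]
          noncomm_ring
        rw [e]
        exact add_mem (mul_mem_augIdeal_pow_succ h hb) (mul_mem_augIdeal_pow (hT ht) h')
    · rintro x y ⟨t, ht, z, hz, h⟩ ⟨t', ht', z', hz', h'⟩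
      refine ⟨t + t', add_mem ht ht', z + z', add_mem hz hz', ?_⟩
      convert add_mem h h' using 1
      noncomm_ring

/-- Up to terms that are divisible by `p`, the factors of a word may be permuted. For a
transposition the error is a multiple of `c - 1` for a commutator `c`, which is in `p J + J ^ 3`. -/
theorem exists_of_perm (hp : p.Prime)
    (hcomm : ∀ x y : N, ∃ u, x * y * x⁻¹ * y⁻¹ = u ^ p ^ GroupDatum.eps p)
    {l l' : List (Fin d)} (hl : l.Perm l') {n : ℕ} (hn : l.length = n + 1) :
    ∃ z ∈ augIdeal p ω ^ n, (l.map fun i => ω (g i) - 1).prod -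
      (l'.map fun i => ω (g i) - 1).prod - p * z ∈ augIdeal p ω ^ (n + 2) := by
  induction hl generalizing n with
  | nil => simp at hn
  | cons i h ih =>
    rename_i l l'
    rw [List.length_cons, add_left_inj] at hn
    rcases n with _ | n
    · obtain rfl := List.length_eq_zero_iff.1 hn
      obtain rfl := List.nil_perm.1 h
      exact ⟨0, zero_mem _, by simp⟩
    · obtain ⟨z, hz, h'⟩ := ih hn
      refine ⟨(ω (g i) - 1) * z, mul_mem_augIdeal_pow_succ' (sub_one_mem_augIdeal ω _) hz, ?_⟩
      convert mul_mem_augIdeal_pow_succ' (sub_one_mem_augIdeal ω (g i)) h' using 1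
      rw [List.map_cons, List.map_cons, List.prod_cons, List.prod_cons, mul_sub, mul_sub,
        ← mul_assoc, ← mul_assoc, Nat.cast_comm]
  | swap i j l =>
    obtain ⟨u, hu⟩ := hcomm (g j) (g i)
    obtain ⟨y, hy, h⟩ := exists_map_pow_eps_sub_one (ω := ω) hp u
    rw [← hu] at h
    set c := g j * g i * (g j)⁻¹ * (g i)⁻¹ with hc
    have hn' : n = l.length + 1 := by simpa using hn.symm
    subst hn'
    have hW := prod_map_mem (p := p) (ω := ω) (g := g) l
    set W := (l.map fun i => ω (g i) - 1).prod
    -- the commutator of `g_j - 1` and `g_i - 1`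
    have e1 : (ω (g j) - 1) * (ω (g i) - 1) - (ω (g i) - 1) * (ω (g j) - 1) =
        (ω c - 1) * (ω (g i * g j) - 1) + (ω c - 1) := by
      have h1 : ω c * ω (g i * g j) = ω (g j * g i) := by
        rw [← map_mul, hc]
        congr 1
        group
      have h2 : (ω c - 1) * (ω (g i * g j) - 1) + (ω c - 1) =
          ω c * ω (g i * g j) - ω (g i * g j) := by noncomm_ring
      rw [h2, h1, map_mul, map_mul]
      noncomm_ring
    have hc2 : ω c - 1 ∈ augIdeal p ω ^ 2 := by
      have h2 := mul_mem_augIdeal_pow_succ (i := 1)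
        (by rw [pow_one]; exact natCast_mem_augIdeal ω) hy
      have h3 := add_mem (augIdeal_pow_anti one_le_two (Nat.le_succ 2) h) h2
      rwa [sub_add_cancel] at h3
    refine ⟨y * W, mul_mem_augIdeal_pow_succ' hy hW, ?_⟩
    have e2 : (((j :: i :: l).map fun i => ω (g i) - 1).prod -
        ((i :: j :: l).map fun i => ω (g i) - 1).prod - p * (y * W)) =
        ((ω c - 1) * (ω (g i * g j) - 1) + (ω c - 1 - p * y)) * W := by
      rw [List.map_cons, List.map_cons, List.map_cons, List.map_cons, List.prod_cons,
        List.prod_cons, List.prod_cons, List.prod_cons, ← mul_assoc, ← mul_assoc, ← mul_assoc,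
        ← sub_mul, ← sub_mul, e1]
      congr 1
      abel
    rw [e2, show l.length + 1 + 2 = 3 + l.length by ring]
    exact mul_mem_augIdeal_pow (add_mem (mul_mem_augIdeal_pow_succ hc2
      (sub_one_mem_augIdeal ω _)) h) hW
  | trans h1 h2 ih1 ih2 =>
    obtain ⟨z, hz, h⟩ := ih1 hn
    obtain ⟨z', hz', h'⟩ := ih2 (h1.length_eq ▸ hn)
    refine ⟨z + z', add_mem hz hz', ?_⟩
    convert add_mem h h' using 1
    noncomm_ring

/-- A word can be sorted; the exponent of `b i` in the result is the number of occurrences of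
`i`. -/
theorem exists_perm_orderedProd {M : Type*} [Monoid M] {d : ℕ} (b : Fin d → M) (l : List (Fin d)) :
    ∃ l' : List (Fin d), l.Perm l' ∧ ∃ α : Fin d → ℕ, ∑ i, α i = l.length ∧
      (l'.map b).prod = orderedProd b α := by
  let l' := (List.ofFn fun i => List.replicate (l.count i) i).flatten
  have hperm : l.Perm l' := by
    rw [List.perm_iff_count]
    intro i
    rw [List.count_flatten, List.map_ofFn, List.sum_ofFn]
    simp [List.count_replicate]
  refine ⟨l', hperm, fun i => l.count i, ?_, ?_⟩
  · rw [hperm.length_eq, List.length_flatten, List.map_ofFn, List.sum_ofFn]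
    simp
  · rw [List.map_flatten, List.prod_flatten, List.map_map, List.map_ofFn, orderedProd]
    congr 2
    funext i
    simp

/-- The span of the monomials `p ^ i ∏ (g_j - 1) ^ α_j` with `i + |α| ≥ n`. -/
def monomialSpan (p : ℕ) (ω : N →* A) (g : Fin d → N) (n : ℕ) : Submodule ℤ A :=
  Submodule.span ℤ {w | ∃ (i : ℕ) (α : Fin d → ℕ), n ≤ i + ∑ j, α j ∧
    w = (p : A) ^ i * orderedProd (fun j => ω (g j) - 1) α}

theorem monomialSpan_anti {i j : ℕ} (h : i ≤ j) :
    monomialSpan p ω g j ≤ monomialSpan p ω g i := by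
  refine Submodule.span_mono ?_
  rintro _ ⟨k, α, hk, rfl⟩
  exact ⟨k, α, h.trans hk, rfl⟩

theorem mul_mem_monomialSpan {n : ℕ} {s : A} (hs : s ∈ monomialSpan p ω g n) :
    p * s ∈ monomialSpan p ω g (n + 1) := by
  refine Submodule.span_induction (p := fun s _ => (p : A) * s ∈ monomialSpan p ω g (n + 1))
    ?_ ?_ ?_ ?_ hs
  · rintro _ ⟨i, α, h, rfl⟩
    refine Submodule.subset_span ⟨i + 1, α, by omega, ?_⟩
    rw [pow_succ', mul_assoc]
  · rw [mul_zero]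
    exact zero_mem _
  · intro x y _ _ hx hy
    rw [mul_add]
    exact add_mem hx hy
  · intro a x _ hx
    rw [mul_smul_comm]
    exact Submodule.smul_mem _ a hx

/-- The monomials generate a power of the augmentation ideal modulo the next one: the words in the
`g_i - 1` can be sorted, and the terms `p z` are treated by induction. -/
theorem exists_monomialSpan_succ (hp : p.Prime)
    (hgen : ∀ h, ∃ m u, h = orderedProd g m * u ^ p)
    (hcomm : ∀ x y : N, ∃ u, x * y * x⁻¹ * y⁻¹ = u ^ p ^ GroupDatum.eps p)
    {n : ℕ} {x : A} (hx : x ∈ augIdeal p ω ^ n) :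
    ∃ s ∈ monomialSpan p ω g n, x - s ∈ augIdeal p ω ^ (n + 1) := by
  induction n generalizing x with
  | zero =>
    rw [pow_zero] at hx
    obtain ⟨c, rfl⟩ := Submodule.mem_one.1 hx
    refine ⟨algebraMap ℤ A c, ?_, by simp⟩
    rw [Algebra.algebraMap_eq_smul_one]
    exact Submodule.smul_mem _ c (Submodule.subset_span ⟨0, 0, by simp, by simp [orderedProd]⟩)
  | succ n ih =>
    have hpz : ∀ z ∈ augIdeal p ω ^ n,
        ∃ s ∈ monomialSpan p ω g (n + 1), p * z - s ∈ augIdeal p ω ^ (n + 2) := by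
      intro z hz
      obtain ⟨s, hs, h⟩ := ih hz
      refine ⟨p * s, mul_mem_monomialSpan hs, ?_⟩
      rw [← mul_sub]
      exact mul_mem_augIdeal_pow_succ' (natCast_mem_augIdeal ω) h
    have hword : ∀ t ∈ Submodule.span ℤ {w : A | ∃ l : List (Fin d), l.length = n + 1 ∧
        w = (l.map fun i => ω (g i) - 1).prod},
        ∃ s ∈ monomialSpan p ω g (n + 1), t - s ∈ augIdeal p ω ^ (n + 2) := by
      intro t ht
      refine Submodule.span_induction (p := fun t _ => ∃ s ∈ monomialSpan p ω g (n + 1),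
        t - s ∈ augIdeal p ω ^ (n + 2)) ?_ ⟨0, zero_mem _, by simp⟩ ?_ ?_ ht
      · rintro _ ⟨l, hl, rfl⟩
        obtain ⟨l', hl', α, hα, e⟩ := exists_perm_orderedProd (fun i => ω (g i) - 1) l
        obtain ⟨z, hz, h⟩ := exists_of_perm (ω := ω) (g := g) hp hcomm hl' hl
        obtain ⟨s, hs, h'⟩ := hpz z hz
        refine ⟨orderedProd (fun i => ω (g i) - 1) α + s,
          add_mem (Submodule.subset_span ⟨0, α, by omega, by simp⟩) hs, ?_⟩
        rw [← e]
        convert add_mem h h' using 1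
        abel
      · rintro x y - - ⟨s, hs, h⟩ ⟨s', hs', h'⟩
        refine ⟨s + s', add_mem hs hs', ?_⟩
        rw [add_sub_add_comm]
        exact add_mem h h'
      · rintro a x - ⟨s, hs, h⟩
        refine ⟨a • s, Submodule.smul_mem _ a hs, ?_⟩
        rw [← smul_sub]
        exact Submodule.smul_mem _ a h
    obtain ⟨t, ht, z, hz, h⟩ := exists_of_mem_augIdeal_pow hp hgen hx
    obtain ⟨s, hs, h1⟩ := hword t ht
    obtain ⟨s', hs', h2⟩ := hpz z hz
    refine ⟨s + s', add_mem hs hs', ?_⟩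
    convert add_mem h (add_mem h1 h2) using 1
    abel

/-- A power of the augmentation ideal is generated by monomials, up to arbitrarily high powers. -/
theorem exists_monomialSpan (hp : p.Prime)
    (hgen : ∀ h, ∃ m u, h = orderedProd g m * u ^ p)
    (hcomm : ∀ x y : N, ∃ u, x * y * x⁻¹ * y⁻¹ = u ^ p ^ GroupDatum.eps p)
    {n M : ℕ} (hM : n ≤ M) {x : A} (hx : x ∈ augIdeal p ω ^ n) :
    ∃ s ∈ monomialSpan p ω g n, x - s ∈ augIdeal p ω ^ M := by
  induction M, hM using Nat.le_induction with
  | base => exact ⟨0, zero_mem _, by simpa using hx⟩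
  | succ M hM ih =>
    obtain ⟨s, hs, h⟩ := ih
    obtain ⟨s', hs', h'⟩ := exists_monomialSpan_succ hp hgen hcomm h
    refine ⟨s + s', add_mem hs (monomialSpan_anti hM hs'), ?_⟩
    rwa [sub_add_eq_sub_sub]

end Augmentation

/-! ### Group rings of finite `p`-groups -/

section Nilpotent

variable {p : ℕ}

theorem map_mem_augIdeal_pow {N N' A B : Type*} [Group N] [Group N'] [Ring A] [Ring B]
    {ω : N →* A} {ω' : N' →* B} (φ : A →+* B) (ψ : N →* N') (h : ∀ x, φ (ω x) = ω' (ψ x))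
    {n : ℕ} {x : A} (hx : x ∈ augIdeal p ω ^ n) : φ x ∈ augIdeal p ω' ^ n := by
  have h1 : (augIdeal p ω).map φ.toIntAlgHom.toLinearMap ≤ augIdeal p ω' := by
    rw [augIdeal, Submodule.map_span_le]
    rintro _ (rfl | ⟨y, rfl⟩)
    · change φ (p : A) ∈ _
      rw [map_natCast]
      exact natCast_mem_augIdeal ω'
    · change φ (ω y - 1) ∈ _
      rw [map_sub, map_one, h]
      exact sub_one_mem_augIdeal ω' _
  have h2 := pow_le_pow_left' h1 n
  rw [← Submodule.map_pow] at h2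
  exact h2 ⟨x, hx, rfl⟩

/-- A finite `p`-group acting on a nontrivial finite abelian `p`-group has a fixed vector that is
killed by `p`. -/
theorem exists_fixed_of_isPGroup [Fact p.Prime] {Q : Type*} [Group Q] (hQ : IsPGroup p Q)
    {V : Type*} [AddCommGroup V] [Finite V] [Nontrivial V] [DistribMulAction Q V] {k : ℕ}
    (hV : ∀ v : V, p ^ k • v = 0) : ∃ v : V, v ≠ 0 ∧ (∀ q : Q, q • v = v) ∧ p • v = 0 := by
  have hcard : p ∣ Nat.card V := by
    obtain ⟨v, hv⟩ := exists_ne (0 : V)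
    obtain ⟨j, -, hj⟩ := (Nat.dvd_prime_pow Fact.out).1 (addOrderOf_dvd_of_nsmul_eq_zero (hV v))
    rcases j with _ | j
    · rw [pow_zero, AddMonoid.addOrderOf_eq_one_iff] at hj
      exact absurd hj hv
    · exact ((dvd_pow_self p j.succ_ne_zero).trans hj.symm.dvd).trans (addOrderOf_dvd_natCard v)
  obtain ⟨v, hv, hv0⟩ := hQ.exists_fixed_point_of_prime_dvd_card_of_fixed_point V hcard
    (a := (0 : V)) (fun q => smul_zero q)
  have hex : ∃ j, p ^ j • v = 0 := ⟨k, hV v⟩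
  classical
  obtain ⟨j, hj⟩ : ∃ j, Nat.find hex = j + 1 := by
    refine Nat.exists_eq_succ_of_ne_zero fun h => ?_
    have := Nat.find_spec hex
    rw [h, pow_zero, one_smul] at this
    exact hv0 this.symm
  refine ⟨p ^ j • v, Nat.find_min hex (by omega), fun q => ?_, ?_⟩
  · rw [smul_comm, hv q]
  · rw [smul_smul, ← pow_succ', ← hj]
    exact Nat.find_spec hex

/-- The augmentation ideal of the group ring of a finite `p`-group over `ℤ / p ^ k` is nilpotent. A
maximal submodule `W` of the group ring that is killed by a power of `J` is everything: otherwise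
the quotient by `W` contains a nonzero vector that is killed by `J`, and `W` can be enlarged. -/
theorem exists_augIdeal_pow_eq_zero [Fact p.Prime] {Q : Type*} [Group Q] [Finite Q]
    (hQ : IsPGroup p Q) (k : ℕ) :
    ∃ M, ∀ x ∈ augIdeal p (MonoidAlgebra.of (ZMod (p ^ k)) Q) ^ (M + 1), x = 0 := by
  have : NeZero (p ^ k) := ⟨pow_ne_zero k (Fact.out : p.Prime).ne_zero⟩
  let B := MonoidAlgebra (ZMod (p ^ k)) Q
  have : Finite (Q →₀ ZMod (p ^ k)) := Finite.of_injective _ DFunLike.coe_injective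
  have : Finite B :=
    Finite.of_injective _ (MonoidAlgebra.coeffEquiv (R := ZMod (p ^ k)) (M := Q)).injective
  let J := augIdeal p (MonoidAlgebra.of (ZMod (p ^ k)) Q)
  let S : Set (Submodule B B) := {W | ∃ M, ∀ x ∈ J ^ (M + 1), ∀ w ∈ W, x * w = 0}
  obtain ⟨W, hW⟩ := (Set.toFinite S).exists_maximal ⟨⊥, 0, fun x _ w hw => by
    rw [(Submodule.mem_bot B).1 hw, mul_zero]⟩
  have htop : W = ⊤ := by
    by_contra hne
    obtain ⟨M, hM⟩ := hW.prop
    have : Nontrivial (B ⧸ W) := Submodule.Quotient.nontrivial_iff.2 hne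
    have : Finite (B ⧸ W) := Finite.of_surjective _ W.mkQ_surjective
    let _ : DistribMulAction Q (B ⧸ W) :=
      DistribMulAction.compHom (B ⧸ W) (MonoidAlgebra.of (ZMod (p ^ k)) Q)
    have hkill : ∀ v : B ⧸ W, p ^ k • v = 0 := by
      intro v
      have h1 : ((p ^ k : ℕ) : B) = 0 := by
        have h2 := map_natCast (algebraMap (ZMod (p ^ k)) B) (p ^ k)
        rw [ZMod.natCast_self, map_zero] at h2
        exact h2.symm
      rw [← Nat.cast_smul_eq_nsmul B, h1, zero_smul]
    obtain ⟨v, hv0, hvQ, hvp⟩ := exists_fixed_of_isPGroup hQ hkill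
    have hvQ' : ∀ q, MonoidAlgebra.of (ZMod (p ^ k)) Q q • v = v := hvQ
    -- The group ring acts on `v` through integers.
    have hint : ∀ r : B, ∃ m : ℕ, r • v = m • v := by
      intro r
      refine MonoidAlgebra.induction_on (motive := fun r : B => ∃ m : ℕ, r • v = m • v) r
        (fun q => ⟨1, by rw [hvQ', one_smul]⟩) ?_ ?_
      · rintro r r' ⟨m, hm⟩ ⟨m', hm'⟩
        exact ⟨m + m', by rw [add_smul, hm, hm', add_smul]⟩
      · rintro c r ⟨m, hm⟩
        refine ⟨c.val * m, ?_⟩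
        have h1 : c • r = c.val • r := by
          conv_lhs => rw [← ZMod.natCast_zmod_val c]
          rw [Nat.cast_smul_eq_nsmul]
        rw [h1, smul_assoc, hm, smul_smul]
    have hJ : ∀ c ∈ J, c • v = 0 := by
      intro c hc
      refine Submodule.span_induction (p := fun c _ => c • v = 0) ?_ (zero_smul _ _) ?_ ?_ hc
      · rintro _ (rfl | ⟨q, rfl⟩)
        · rw [Nat.cast_smul_eq_nsmul, hvp]
        · change (_ - 1 : B) • v = 0
          rw [sub_smul, hvQ', one_smul, sub_self]
      · intro x y _ _ hx hy
        rw [add_smul, hx, hy, add_zero]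
      · intro a x _ hx
        rw [smul_assoc, hx, smul_zero]
    obtain ⟨b, rfl⟩ := W.mkQ_surjective v
    have hmem : W ⊔ Submodule.span B {b} ∈ S := by
      refine ⟨M + 1, fun x hx w hw => ?_⟩
      rw [pow_succ] at hx
      obtain ⟨w₁, hw₁, w₂, hw₂, rfl⟩ := Submodule.mem_sup.1 hw
      obtain ⟨r, rfl⟩ := Submodule.mem_span_singleton.1 hw₂
      refine Submodule.mul_induction_on hx (fun a ha c hc => ?_) fun x y hx hy => ?_
      · rw [mul_assoc]
        refine hM a ha _ ?_
        rw [mul_add]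
        refine add_mem (W.smul_mem c hw₁) ?_
        rw [← Submodule.Quotient.mk_eq_zero]
        change W.mkQ (c • r • b) = 0
        obtain ⟨m, hm⟩ := hint r
        rw [map_smul, map_smul, hm, smul_comm, hJ c hc, smul_zero]
      · rw [add_mul, hx, hy, add_zero]
    have hle := hW.le_of_ge hmem le_sup_left
    refine hv0 ?_
    change W.mkQ b = 0
    rw [Submodule.mkQ_apply, Submodule.Quotient.mk_eq_zero]
    exact hle (Submodule.mem_sup_right (Submodule.mem_span_singleton_self b))
  obtain ⟨M, hM⟩ := hW.prop
  refine ⟨M, fun x hx => ?_⟩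
  have h := hM x hx 1 (htop ▸ Submodule.mem_top)
  rwa [mul_one] at h

end Nilpotent

/-! ### Integration of functions against elements of the group ring -/

section Pairing

/-- The integral of a function on a group against an element of the group ring, which is viewed as
a finite combination of Dirac measures. -/
def pairing {N M : Type*} [AddCommGroup M] (f : N → M) : MonoidAlgebra ℤ N →ₗ[ℤ] M :=
  (Finsupp.linearCombination ℤ f).comp (MonoidAlgebra.coeffLinearEquiv ℤ).toLinearMap

variable {N M M' : Type*} [AddCommGroup M] [AddCommGroup M']

theorem pairing_of [Monoid N] (f : N → M) (h : N) : pairing f (MonoidAlgebra.of ℤ N h) = f h := by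
  change Finsupp.linearCombination ℤ f (Finsupp.single h 1) = f h
  simp

theorem linearMap_ext [Monoid N] {D D' : MonoidAlgebra ℤ N →+ M}
    (h : ∀ x, D (MonoidAlgebra.of ℤ N x) = D' (MonoidAlgebra.of ℤ N x)) : D = D' := by
  refine AddMonoidHom.ext fun a => ?_
  refine MonoidAlgebra.induction_on (motive := fun a => D a = D' a) a h ?_ ?_
  · intro a b ha hb
    rw [map_add, map_add, ha, hb]
  · intro c a ha
    rw [map_zsmul, map_zsmul, ha]

theorem map_pairing [Monoid N] (D : M →+ M') (f : N → M) (a : MonoidAlgebra ℤ N) :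
    D (pairing f a) = pairing (fun x => D (f x)) a := by
  refine DFunLike.congr_fun (linearMap_ext (D := D.comp (pairing f).toAddMonoidHom)
    (D' := (pairing fun x => D (f x)).toAddMonoidHom) fun x => ?_) a
  change D (pairing f _) = pairing _ _
  rw [pairing_of, pairing_of]

theorem pairing_sub [Monoid N] (f f' : N → M) (a : MonoidAlgebra ℤ N) :
    pairing (fun x => f x - f' x) a = pairing f a - pairing f' a := by
  refine DFunLike.congr_fun (linearMap_ext (D := (pairing fun x => f x - f' x).toAddMonoidHom)
    (D' := (pairing f - pairing f').toAddMonoidHom) fun x => ?_) a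
  change pairing _ _ = pairing f _ - pairing f' _
  rw [pairing_of, pairing_of, pairing_of]

theorem pairing_sum_mul [Monoid N] {A ι : Type*} [Ring A] (s : Finset ι) (c : ι → A)
    (f : ι → N → A) (a : MonoidAlgebra ℤ N) :
    pairing (fun x => ∑ i ∈ s, c i * f i x) a = ∑ i ∈ s, c i * pairing (f i) a := by
  have h : (pairing fun x => ∑ i ∈ s, c i * f i x).toAddMonoidHom =
      ∑ i ∈ s, (AddMonoidHom.mulLeft (c i)).comp (pairing (f i)).toAddMonoidHom := by
    refine linearMap_ext fun x => ?_
    rw [AddMonoidHom.finsetSum_apply]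
    change pairing _ _ = ∑ i ∈ s, c i * pairing (f i) _
    simp only [pairing_of]
  have h1 := DFunLike.congr_fun h a
  rw [AddMonoidHom.finsetSum_apply] at h1
  exact h1

theorem pairing_zero [Monoid N] (a : MonoidAlgebra ℤ N) : pairing (fun _ : N => (0 : M)) a = 0 := by
  simpa using pairing_sub (fun _ : N => (0 : M)) (fun _ => 0) a

/-- Functoriality for a homomorphism of groups, followed by a translation. -/
theorem pairing_comp [Monoid N] {N' : Type*} [Monoid N'] (f : N' → M) (n : N') (ψ : N →* N')
    (φ : MonoidAlgebra ℤ N →+* MonoidAlgebra ℤ N')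
    (hφ : ∀ x, φ (MonoidAlgebra.of ℤ N x) = MonoidAlgebra.of ℤ N' (ψ x)) (a : MonoidAlgebra ℤ N) :
    pairing (fun x => f (n * ψ x)) a = pairing f (MonoidAlgebra.of ℤ N' n * φ a) := by
  refine DFunLike.congr_fun (linearMap_ext (D := (pairing fun x => f (n * ψ x)).toAddMonoidHom)
    (D' := (pairing f).toAddMonoidHom.comp
      ((AddMonoidHom.mulLeft (MonoidAlgebra.of ℤ N' n)).comp φ.toAddMonoidHom)) fun x => ?_) a
  change pairing _ _ = pairing f (_ * φ _)
  rw [pairing_of, hφ, ← map_mul, pairing_of]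

end Pairing

namespace UniformFiltration

variable {p e : ℕ} [Fact p.Prime] {N : Type*} [Group N] [TopologicalSpace N]
  (𝓕 : UniformFiltration p e N) [IsTopologicalGroup N] [CompactSpace N]

omit [Fact p.Prime] [IsTopologicalGroup N] [CompactSpace N] in
theorem isPGroup (k : ℕ) : IsPGroup p (N ⧸ 𝓕.F k) := by
  intro x
  obtain ⟨x, rfl⟩ := QuotientGroup.mk_surjective x
  refine ⟨k, (QuotientGroup.eq_one_iff _).2 ?_⟩
  simpa using 𝓕.pow_pow_mem k (𝓕.mem_zero x)

omit [Fact p.Prime] in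
/-- Locally constant functions factor through a quotient of the filtration. -/
theorem exists_factor {X : Type*} {f : N → X} (hf : IsLocallyConstant f) :
    ∃ j, ∀ x y : N, (x : N ⧸ 𝓕.F j) = y → f x = f y := by
  have h : ∀ x : N, ∃ j, ∀ y : N, (x : N ⧸ 𝓕.F j) = y → f y = f x := fun x =>
    𝓕.exists_coset_subset ((IsLocallyConstant.iff_eventually_eq f).1 hf x)
  choose j hj using h
  obtain ⟨t, ht⟩ := CompactSpace.elim_nhds_subcover
    (fun x : N => {y : N | (y : N ⧸ 𝓕.F (j x)) = x})
    (fun x => (𝓕.isOpen_coset _ _).mem_nhds rfl)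
  refine ⟨t.sup j, fun x y hxy => ?_⟩
  obtain ⟨z, hz, hxz⟩ : ∃ z ∈ t, (x : N ⧸ 𝓕.F (j z)) = z := by
    have : x ∈ ⋃ z ∈ t, {y : N | (y : N ⧸ 𝓕.F (j z)) = z} := ht ▸ Set.mem_univ x
    simpa using this
  have hxy' : (x : N ⧸ 𝓕.F (j z)) = y :=
    𝓕.mk_eq_iff.2 (𝓕.anti (Finset.le_sup hz) (𝓕.mk_eq_iff.1 hxy))
  rw [hj z x hxz.symm, hj z y (hxz.symm.trans hxy')]

include 𝓕 in
/-- The powers of the augmentation ideal tend to zero weakly. -/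
theorem exists_pairing_eq_zero {f : N → ℤ_[p]} (hf : Continuous f) (k : ℕ) :
    ∃ M, ∀ a ∈ augIdeal p (MonoidAlgebra.of ℤ N) ^ (M + 1), (p : ℤ_[p]) ^ k ∣ pairing f a := by
  have hloc : IsLocallyConstant fun x => PadicInt.toZModPow k (f x) :=
    (isLocallyConstant_toZModPow p k).comp_continuous hf
  obtain ⟨j, hj⟩ := 𝓕.exists_factor hloc
  have : Finite (N ⧸ 𝓕.F j) := Subgroup.quotient_finite_of_isOpen _ (𝓕.isOpen j)
  obtain ⟨M, hM⟩ := exists_augIdeal_pow_eq_zero (𝓕.isPGroup j) k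
  let ψ : N →* N ⧸ 𝓕.F j := QuotientGroup.mk' _
  let φ : MonoidAlgebra ℤ N →ₐ[ℤ] MonoidAlgebra (ZMod (p ^ k)) (N ⧸ 𝓕.F j) :=
    MonoidAlgebra.lift ℤ _ N ((MonoidAlgebra.of (ZMod (p ^ k)) (N ⧸ 𝓕.F j)).comp ψ)
  have hφ : ∀ x, φ (MonoidAlgebra.of ℤ N x) = MonoidAlgebra.of _ _ (ψ x) := fun x => by
    simp [φ]
  let f' : N ⧸ 𝓕.F j → ZMod (p ^ k) := fun q => PadicInt.toZModPow k (f q.out)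
  let D : MonoidAlgebra (ZMod (p ^ k)) (N ⧸ 𝓕.F j) →+ ZMod (p ^ k) :=
    ((Finsupp.linearCombination (ZMod (p ^ k)) f').comp
      (MonoidAlgebra.coeffLinearEquiv (ZMod (p ^ k))).toLinearMap).toAddMonoidHom
  have hD : ∀ q, D (MonoidAlgebra.of _ _ q) = f' q := fun q => by
    change Finsupp.linearCombination (ZMod (p ^ k)) f' (Finsupp.single q 1) = f' q
    simp
  refine ⟨M, fun a ha => ?_⟩
  have h0 : φ a = 0 := hM _ (map_mem_augIdeal_pow φ.toRingHom ψ hφ ha)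
  rw [← Ideal.mem_span_singleton, ← PadicInt.ker_toZModPow, RingHom.mem_ker]
  have h1 : (PadicInt.toZModPow k).toAddMonoidHom.comp (pairing f).toAddMonoidHom =
      D.comp φ.toRingHom.toAddMonoidHom := by
    refine linearMap_ext fun x => ?_
    change PadicInt.toZModPow k (pairing f _) = D (φ _)
    rw [pairing_of, hφ, hD]
    exact hj _ _ (Quotient.out_eq (ψ x)).symm
  have h2 := DFunLike.congr_fun h1 a
  change PadicInt.toZModPow k (pairing f a) = D (φ a) at h2
  rw [h2, h0, map_zero]

end UniformFiltration

/-! ### Duality between binomial functions and monomials -/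

section Duality

variable {p : ℕ} [Fact p.Prime] {N : Type*} [Group N] {d : ℕ}

/-- The functional on polynomials that takes `X ^ m` to the binomial coefficient `m.choose n`. -/
def binomialFunctional (n : ℕ) : ℤ[X] →ₗ[ℤ] ℤ :=
  (Polynomial.lcoeff ℤ n).comp (Polynomial.taylor 1)

theorem binomialFunctional_X_pow (n m : ℕ) :
    binomialFunctional n (Polynomial.X ^ m) = m.choose n := by
  simp [binomialFunctional, Polynomial.coeff_X_add_one_pow]

theorem binomialFunctional_sub_one_pow (n m : ℕ) :
    binomialFunctional n ((Polynomial.X - 1) ^ m) = if n = m then 1 else 0 := by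
  simp [binomialFunctional, Polynomial.coeff_X_pow]

/-- The product of polynomials in the elements `b 0, b 1, …`, in this order. -/
def polynomialProd {A : Type*} [Ring A] (b : Fin d → A) :
    MultilinearMap ℤ (fun _ : Fin d => ℤ[X]) A :=
  (MultilinearMap.mkPiAlgebraFin ℤ d A).compLinearMap fun i => (Polynomial.aeval (b i)).toLinearMap

theorem polynomialProd_pow {A : Type*} [Ring A] (b : Fin d → A) (q : Fin d → ℤ[X])
    (m : Fin d → ℕ) : polynomialProd b (fun i => q i ^ m i) =
      orderedProd (fun i => Polynomial.aeval (b i) (q i)) m := by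
  simp only [polynomialProd, MultilinearMap.compLinearMap_apply,
    MultilinearMap.mkPiAlgebraFin_apply, orderedProd]
  simp

theorem polynomialProd_basisMonomials {A : Type*} [Ring A] (b : Fin d → A) (m : Fin d → ℕ) :
    polynomialProd b (fun i => Polynomial.basisMonomials ℤ (m i)) = orderedProd b m := by
  simp only [Polynomial.coe_basisMonomials, Polynomial.monomial_one_right_eq_X_pow]
  rw [polynomialProd_pow]
  simp only [Polynomial.aeval_X]

/-- The binomial functions are dual to the monomials in `g i - 1`. The integral of `f` against
`∏ q_i(g_i)`, for polynomials `q_i`, is multilinear in the `q_i`; it is known for powers of `X`,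
which form a basis, and it is evaluated at powers of `X - 1`. -/
theorem pairing_orderedProd_sub_one {g : Fin d → N} {α : Fin d → ℕ} {f : N → ℤ_[p]}
    (hf : ∀ m, f (orderedProd g m) = ∏ i, ((m i).choose (α i) : ℤ_[p])) (β : Fin d → ℕ) :
    pairing f (orderedProd (fun i => MonoidAlgebra.of ℤ N (g i) - 1) β) =
      if α = β then 1 else 0 := by
  let b : Fin d → MonoidAlgebra ℤ N := fun i => MonoidAlgebra.of ℤ N (g i)
  let R : MultilinearMap ℤ (fun _ : Fin d => ℤ[X]) ℤ_[p] :=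
    (Int.castAddHom ℤ_[p]).toIntLinearMap.compMultilinearMap
      ((MultilinearMap.mkPiAlgebra ℤ (Fin d) ℤ).compLinearMap fun i => binomialFunctional (α i))
  have hR : ∀ q, R q = ((∏ i, binomialFunctional (α i) (q i) : ℤ) : ℤ_[p]) := fun q => by
    simp only [R, LinearMap.compMultilinearMap_apply, MultilinearMap.compLinearMap_apply,
      MultilinearMap.mkPiAlgebra_apply]
    rfl
  have hLR : (pairing f).compMultilinearMap (polynomialProd b) = R := by
    refine Module.Basis.ext_multilinear (fun _ => Polynomial.basisMonomials ℤ) fun m => ?_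
    rw [LinearMap.compMultilinearMap_apply, polynomialProd_basisMonomials, hR, ← map_orderedProd,
      pairing_of, hf, Int.cast_prod]
    refine Finset.prod_congr rfl fun i _ => ?_
    simp only [Polynomial.coe_basisMonomials, Polynomial.monomial_one_right_eq_X_pow,
      binomialFunctional_X_pow, Int.cast_natCast]
  have h := DFunLike.congr_fun hLR fun i => (Polynomial.X - 1) ^ β i
  rw [LinearMap.compMultilinearMap_apply, polynomialProd_pow, hR] at h
  simp only [map_sub, map_one, Polynomial.aeval_X, binomialFunctional_sub_one_pow] at h
  rw [h, Finset.prod_ite_zero]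
  simp [funext_iff]

/-- The ordered products of the `g i` are integral combinations of the monomials in `g i - 1`. -/
theorem of_orderedProd_mem_span (g : Fin d → N) (m : Fin d → ℕ) :
    MonoidAlgebra.of ℤ N (orderedProd g m) ∈ Submodule.span ℤ (Set.range
      (orderedProd fun i => MonoidAlgebra.of ℤ N (g i) - 1)) := by
  set b : Fin d → MonoidAlgebra ℤ N := fun i => MonoidAlgebra.of ℤ N (g i) - 1
  set W := Submodule.span ℤ (Set.range (orderedProd b))
  have h0 : W.mkQ.compMultilinearMap (polynomialProd b) = 0 := by
    refine Module.Basis.ext_multilinear (fun _ => Polynomial.basisMonomials ℤ) fun m => ?_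
    rw [LinearMap.compMultilinearMap_apply, polynomialProd_basisMonomials]
    exact (Submodule.Quotient.mk_eq_zero W).2 (Submodule.subset_span ⟨m, rfl⟩)
  have h := DFunLike.congr_fun h0 fun i => (Polynomial.X + 1) ^ m i
  rw [LinearMap.compMultilinearMap_apply, polynomialProd_pow] at h
  simp only [map_add, map_one, Polynomial.aeval_X, b, sub_add_cancel] at h
  rw [← map_orderedProd] at h
  exact (Submodule.Quotient.mk_eq_zero W).1 h

end Duality

/-! ### Estimates for Mahler coefficients -/

theorem orderedProd_mem {A : Type*} [Ring A] {d : ℕ} {K : ℕ → Submodule ℤ A} (h0 : 1 ∈ K 0)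
    (hmul : ∀ {i j x y}, x ∈ K i → y ∈ K j → x * y ∈ K (i + j)) {b : Fin d → A}
    (hb : ∀ i, b i ∈ K 1) (α : Fin d → ℕ) : orderedProd b α ∈ K (∑ i, α i) := by
  have hpow : ∀ x ∈ K 1, ∀ n, x ^ n ∈ K n := by
    intro x hx n
    induction n with
    | zero => simpa using h0
    | succ n ih =>
      rw [pow_succ]
      exact hmul ih hx
  have hprod : ∀ (n : ℕ) (c : Fin n → A) (m : Fin n → ℕ), (∀ i, c i ∈ K (m i)) →
      (List.ofFn c).prod ∈ K (∑ i, m i) := by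
    intro n
    induction n with
    | zero => exact fun c m _ => by simpa using h0
    | succ n ih =>
      intro c m h
      rw [List.ofFn_succ, List.prod_cons, Fin.sum_univ_succ]
      exact hmul (h 0) (ih _ _ fun i => h i.succ)
  exact hprod d _ α fun i => hpow _ (hb i) _

namespace UniformFiltration

variable {p : ℕ} [Fact p.Prime] {N : Type*} [Group N] [TopologicalSpace N]
  (𝓕 : UniformFiltration p (GroupDatum.eps p) N) [IsTopologicalGroup N] [CompactSpace N]
  {d : ℕ} {g : Fin d → N}

include 𝓕 in
/-- Integrating a binomial function of degree `|α|` against an element of the `n`-th power of the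
augmentation ideal, one gains a factor `p ^ (n - |α|)`, which is at most `s ^ (n - |α|)`. The reason
is that the power is generated by the monomials `p ^ i ∏ (g_j - 1) ^ β_j` with `i + |β| ≥ n`, up to
elements that are arbitrarily small in the weak topology, and that these monomials are dual to the
binomial functions. -/
theorem norm_pairing_le (hg : Dense ((Subgroup.closure (Set.range g) : Subgroup N) : Set N))
    {f : N → ℤ_[p]} (hfc : Continuous f) {α : Fin d → ℕ}
    (hf : ∀ m, f (orderedProd g m) = ∏ i, ((m i).choose (α i) : ℤ_[p]))
    {s : ℝ} (hs : (p : ℝ)⁻¹ ≤ s) (hs1 : s ≤ 1) {n : ℕ} {a : MonoidAlgebra ℤ N}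
    (ha : a ∈ augIdeal p (MonoidAlgebra.of ℤ N) ^ n) :
    s ^ (∑ i, α i) * ‖pairing f a‖ ≤ s ^ n := by
  have hs0 : 0 < s := (inv_pos.2 (Nat.cast_pos.2 (Fact.out : p.Prime).pos)).trans_le hs
  obtain ⟨M, hM⟩ := 𝓕.exists_pairing_eq_zero hfc n
  have hgen : ∀ h : N, ∃ m u, h = orderedProd g m * u ^ p := by
    intro h
    obtain ⟨m, hm⟩ := 𝓕.exists_mk_orderedProd_eq (𝓕.span_eq_top hg) 1 h
    obtain ⟨u, -, hu⟩ := 𝓕.root (k := 0) (𝓕.mk_eq_iff.1 hm)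
    exact ⟨m, u, by rw [hu, mul_inv_cancel_left]⟩
  have hcomm : ∀ x y : N, ∃ u, x * y * x⁻¹ * y⁻¹ = u ^ p ^ GroupDatum.eps p := by
    intro x y
    obtain ⟨u, -, hu⟩ := 𝓕.exists_pow_pow_eq (k := 0) (GroupDatum.eps p)
      (𝓕.commutator (𝓕.mem_zero x) (𝓕.mem_zero y))
    exact ⟨u, hu.symm⟩
  obtain ⟨b, hb, hab⟩ := exists_monomialSpan (g := g) Fact.out hgen hcomm
    (le_max_left n (M + 1)) ha
  have hpk : ∀ k : ℕ, ‖(p : ℤ_[p]) ^ k‖ ≤ s ^ k := fun k => by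
    rw [norm_pow, PadicInt.norm_p]
    exact pow_le_pow_left₀ (by positivity) hs k
  have hsmall : ‖pairing f (a - b)‖ ≤ s ^ n := by
    obtain ⟨z, hz⟩ := hM _ (augIdeal_pow_anti (Nat.le_add_left 1 M) (le_max_right n (M + 1)) hab)
    rw [hz, norm_mul]
    exact (mul_le_of_le_one_right (norm_nonneg _) (PadicInt.norm_le_one _)).trans (hpk n)
  have hmono : s ^ (∑ i, α i) * ‖pairing f b‖ ≤ s ^ n := by
    refine Submodule.span_induction
      (p := fun b _ => s ^ (∑ i, α i) * ‖pairing f b‖ ≤ s ^ n) ?_ ?_ ?_ ?_ hb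
    · rintro _ ⟨i, β, hi, rfl⟩
      rw [← Nat.cast_pow, ← nsmul_eq_mul, map_nsmul, pairing_orderedProd_sub_one hf]
      split_ifs with h
      · subst h
        rw [nsmul_eq_mul, mul_one, Nat.cast_pow]
        refine (mul_le_mul_of_nonneg_left (hpk i) (by positivity)).trans ?_
        rw [← pow_add]
        exact pow_le_pow_of_le_one hs0.le hs1 (by omega)
      · rw [smul_zero, norm_zero, mul_zero]
        positivity
    · rw [map_zero, norm_zero, mul_zero]
      positivity
    · intro x y _ _ hx hy
      rw [map_add]
      rcases le_max_iff.1 (PadicInt.nonarchimedean (pairing f x) (pairing f y)) with h | h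
      · exact (mul_le_mul_of_nonneg_left h (by positivity)).trans hx
      · exact (mul_le_mul_of_nonneg_left h (by positivity)).trans hy
    · intro z x _ hx
      rw [map_zsmul, zsmul_eq_mul, norm_mul]
      exact (mul_le_mul_of_nonneg_left (mul_le_of_le_one_left (norm_nonneg _)
        (PadicInt.norm_le_one _)) (by positivity)).trans hx
  rw [← sub_add_cancel a b, map_add]
  rcases le_max_iff.1 (PadicInt.nonarchimedean (pairing f (a - b)) (pairing f b)) with h | h
  · exact (mul_le_mul (pow_le_one₀ hs0.le hs1) h (norm_nonneg _) zero_le_one).trans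
      (by rwa [one_mul])
  · exact (mul_le_mul_of_nonneg_left h (by positivity)).trans hmono

end UniformFiltration

section Translation

variable {p : ℕ} {N : Type*} [Group N]

theorem of_mul_mem_augIdeal_pow (n : N) {k : ℕ} (hk : 1 ≤ k) {a : MonoidAlgebra ℤ N}
    (ha : a ∈ augIdeal p (MonoidAlgebra.of ℤ N) ^ k) :
    MonoidAlgebra.of ℤ N n * a ∈ augIdeal p (MonoidAlgebra.of ℤ N) ^ k := by
  have h := add_mem (augIdeal_pow_anti hk k.le_succ
    (mul_mem_augIdeal_pow_succ' (sub_one_mem_augIdeal (MonoidAlgebra.of ℤ N) n) ha)) ha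
  rwa [sub_mul, one_mul, sub_add_cancel] at h

/-- The additive group generated by the products `p ^ i y` with `y` in the `j`-th power of the
augmentation ideal and `p * i + j ≥ p * n`. It is the `n`-th step of a filtration for which all
elements `h ^ p - 1` are in the first step. -/
def divIdeal (p : ℕ) (N : Type*) [Group N] (n : ℕ) : Submodule ℤ (MonoidAlgebra ℤ N) :=
  Submodule.span ℤ {w | ∃ (i j : ℕ) (y : MonoidAlgebra ℤ N),
    y ∈ augIdeal p (MonoidAlgebra.of ℤ N) ^ j ∧ p * n ≤ p * i + j ∧ w = p ^ i * y}

theorem one_mem_divIdeal : 1 ∈ divIdeal p N 0 :=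
  Submodule.subset_span ⟨0, 0, 1,
    by simp [Submodule.one_eq_span, Submodule.mem_span_singleton_self], by simp, by simp⟩

theorem mul_mem_divIdeal {m n : ℕ} {x y : MonoidAlgebra ℤ N} (hx : x ∈ divIdeal p N m)
    (hy : y ∈ divIdeal p N n) : x * y ∈ divIdeal p N (m + n) := by
  have h := Submodule.mul_mem_mul hx hy
  rw [divIdeal, divIdeal, Submodule.span_mul_span] at h
  refine Submodule.span_mono ?_ h
  rintro _ ⟨_, ⟨i, j, y, hy, h, rfl⟩, _, ⟨i', j', y', hy', h', rfl⟩, rfl⟩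
  refine ⟨i + i', j + j', y * y', mul_mem_augIdeal_pow hy hy', by linarith, ?_⟩
  have hc := ((Nat.cast_commute p y).pow_left i').eq
  change p ^ i * y * (p ^ i' * y') = _
  rw [mul_assoc, ← mul_assoc y, ← hc, pow_add]
  simp only [mul_assoc]

theorem pow_sub_one_mem_divIdeal (hp : p.Prime) (u : N) :
    MonoidAlgebra.of ℤ N (u ^ p) - 1 ∈ divIdeal p N 1 := by
  obtain ⟨y, hy, h⟩ := exists_map_pow_sub_one (ω := MonoidAlgebra.of ℤ N) hp u
  have h1 : (p : MonoidAlgebra ℤ N) * y ∈ divIdeal p N 1 :=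
    Submodule.subset_span ⟨1, 1, y, by rwa [pow_one], by omega, by rw [pow_one]⟩
  have h2 : MonoidAlgebra.of ℤ N (u ^ p) - 1 - p * y ∈ divIdeal p N 1 :=
    Submodule.subset_span ⟨0, p, _, h, by omega, by rw [pow_zero, one_mul]⟩
  simpa using add_mem h2 h1

end Translation

namespace UniformFiltration

variable {p : ℕ} [Fact p.Prime] {N : Type*} [Group N] [TopologicalSpace N]
  (𝓕 : UniformFiltration p (GroupDatum.eps p) N) [IsTopologicalGroup N] [CompactSpace N]
  {d : ℕ} {g : Fin d → N}

include 𝓕 in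
/-- The estimate `norm_pairing_le` is invariant under translation, as a power of the augmentation
ideal is stable under multiplication by elements of the group. -/
theorem norm_pairing_of_mul_le
    (hg : Dense ((Subgroup.closure (Set.range g) : Subgroup N) : Set N))
    {f : N → ℤ_[p]} (hfc : Continuous f) {α : Fin d → ℕ}
    (hf : ∀ m, f (orderedProd g m) = ∏ i, ((m i).choose (α i) : ℤ_[p]))
    {s : ℝ} (hs : (p : ℝ)⁻¹ ≤ s) (hs1 : s ≤ 1) {k : ℕ} (n : N) {a : MonoidAlgebra ℤ N}
    (ha : a ∈ augIdeal p (MonoidAlgebra.of ℤ N) ^ k) :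
    s ^ (∑ i, α i) * ‖pairing f (MonoidAlgebra.of ℤ N n * a)‖ ≤ s ^ k := by
  have hs0 : 0 ≤ s := (inv_nonneg.2 (Nat.cast_nonneg p)).trans hs
  rcases Nat.eq_zero_or_pos k with rfl | hk
  · rw [pow_zero]
    exact mul_le_one₀ (pow_le_one₀ hs0 hs1) (norm_nonneg _) (PadicInt.norm_le_one _)
  · exact 𝓕.norm_pairing_le hg hfc hf hs hs1 (of_mul_mem_augIdeal_pow n hk ha)

include 𝓕 in
/-- If `p⁻¹ ≤ s ^ p`, a factor `p` is as small as a factor in the `p`-th power of the augmentation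
ideal, so that the `k`-th step of `divIdeal` behaves like the `p * k`-th power of the augmentation
ideal. -/
theorem norm_pairing_of_mul_le_of_mem_divIdeal
    (hg : Dense ((Subgroup.closure (Set.range g) : Subgroup N) : Set N))
    {f : N → ℤ_[p]} (hfc : Continuous f) {α : Fin d → ℕ}
    (hf : ∀ m, f (orderedProd g m) = ∏ i, ((m i).choose (α i) : ℤ_[p]))
    {s : ℝ} (hs : (p : ℝ)⁻¹ ≤ s ^ p) (hs0 : 0 ≤ s) (hs1 : s ≤ 1) {k : ℕ} (n : N)
    {a : MonoidAlgebra ℤ N} (ha : a ∈ divIdeal p N k) :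
    s ^ (∑ i, α i) * ‖pairing f (MonoidAlgebra.of ℤ N n * a)‖ ≤ s ^ (p * k) := by
  refine Submodule.span_induction (p := fun a _ => s ^ (∑ i, α i) *
    ‖pairing f (MonoidAlgebra.of ℤ N n * a)‖ ≤ s ^ (p * k)) ?_ ?_ ?_ ?_ ha
  · rintro _ ⟨i, j, y, hy, h, rfl⟩
    have hs' : (p : ℝ)⁻¹ ≤ s :=
      hs.trans (pow_le_of_le_one hs0 hs1 (Fact.out : p.Prime).ne_zero)
    have h1 := 𝓕.norm_pairing_of_mul_le hg hfc hf hs' hs1 n hy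
    rw [← Nat.cast_pow, ← nsmul_eq_mul, mul_smul_comm, map_nsmul, nsmul_eq_mul, norm_mul,
      Nat.cast_pow, norm_pow, PadicInt.norm_p, mul_left_comm]
    refine (mul_le_mul (pow_le_pow_left₀ (by positivity) hs i) h1 (by positivity)
      (by positivity)).trans ?_
    rw [← pow_mul, ← pow_add]
    exact pow_le_pow_of_le_one hs0 hs1 h
  · rw [mul_zero, map_zero, norm_zero, mul_zero]
    positivity
  · intro x y _ _ hx hy
    rw [mul_add, map_add]
    rcases le_max_iff.1 (PadicInt.nonarchimedean (pairing f (MonoidAlgebra.of ℤ N n * x))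
      (pairing f (MonoidAlgebra.of ℤ N n * y))) with h | h
    · exact (mul_le_mul_of_nonneg_left h (by positivity)).trans hx
    · exact (mul_le_mul_of_nonneg_left h (by positivity)).trans hy
  · intro z x _ hx
    rw [mul_smul_comm, map_zsmul, zsmul_eq_mul, norm_mul]
    exact (mul_le_mul_of_nonneg_left (mul_le_of_le_one_left (norm_nonneg _)
      (PadicInt.norm_le_one _)) (by positivity)).trans hx

end UniformFiltration

/-! ### Mahler expansions on `N̄₁` -/

namespace Identifications

variable {p : ℕ} [Fact p.Prime] {D : GroupDatum.{u} p} {R : Type v} [NormedCommRing R]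
  {C : NormChoice D} {κ : D.T₀ →* Rˣ} (Φ : Identifications C κ)

instance : Finite (D.Nbar 1 ⧸ D.NbarEps) :=
  Subgroup.quotient_finite_of_isOpen _ D.isClopen_NbarEps.isOpen

/-- The binomial function `g₁^{x₁} ⋯ g_d^{x_d} ↦ ∏ i, (x_i choose α_i)`. -/
def binom (α : Fin C.d → ℕ) (y : D.NbarEps) : ℤ_[p] := ∏ i, mahler (α i) (Φ.coord.symm y i)

theorem continuous_binom (α : Fin C.d → ℕ) : Continuous (Φ.binom α) :=
  continuous_finsetProd _ fun i _ => (mahler (α i)).continuous.comp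
    ((continuous_apply i).comp Φ.coord.symm.continuous)

theorem coord_symm_orderedProd (m : Fin C.d → ℕ) :
    Φ.coord.symm (orderedProd C.g m) = fun i => (m i : ℤ_[p]) := by
  rw [Homeomorph.symm_apply_eq, Φ.coord_natCast]
  rfl

theorem binom_orderedProd (α m : Fin C.d → ℕ) :
    Φ.binom α (orderedProd C.g m) = ∏ i, ((m i).choose (α i) : ℤ_[p]) := by
  rw [binom, coord_symm_orderedProd]
  refine Finset.prod_congr rfl fun i _ => ?_
  rw [mahler_natCast_eq]

theorem basisFunAux_rep_mul (c : D.Nbar 1 ⧸ D.NbarEps) (α : Fin C.d → ℕ) (y : D.NbarEps) :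
    Φ.basisFunAux c α (C.rep c * y) = Φ.binom α y := by
  have h : (C.rep c)⁻¹ * (C.rep c * (y : D.Nbar 1)) = y := inv_mul_cancel_left _ _
  rw [basisFunAux, dif_pos (by rw [h]; exact y.2), binom]
  congr! 5

theorem basisFunAux_eq_zero {c : D.Nbar 1 ⧸ D.NbarEps} (α : Fin C.d → ℕ) {x : D.Nbar 1}
    (hx : (x : D.Nbar 1 ⧸ D.NbarEps) ≠ c) : Φ.basisFunAux c α x = 0 := by
  refine dif_neg fun h => hx ?_
  rw [← C.mk_rep c]
  exact (QuotientGroup.eq.2 h).symm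

theorem exists_rep_mul (x : D.Nbar 1) : ∃ (c : D.Nbar 1 ⧸ D.NbarEps) (y : D.NbarEps),
    x = C.rep c * y :=
  ⟨x, ⟨(C.rep x)⁻¹ * x, QuotientGroup.eq.1 (C.mk_rep x)⟩, (mul_inv_cancel_left _ _).symm⟩

theorem mk_rep_mul (c : D.Nbar 1 ⧸ D.NbarEps) (y : D.NbarEps) :
    ((C.rep c * y : D.Nbar 1) : D.Nbar 1 ⧸ D.NbarEps) = c := by
  rw [QuotientGroup.mk_mul_of_mem _ y.2, C.mk_rep]

include Φ in
theorem denseRange_orderedProd : DenseRange (orderedProd C.g) := by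
  have h : DenseRange fun m : Fin C.d → ℕ => fun i => (m i : ℤ_[p]) :=
    DenseRange.piMap fun _ => PadicInt.denseRange_natCast
  have h2 := Φ.coord.surjective.denseRange.comp h Φ.coord.continuous
  convert h2 using 1
  funext m
  exact (Φ.coord_natCast m).symm

/-- The monomial `∏ i, ([g_i] - 1) ^ α_i`. -/
def monomial (C : NormChoice D) (α : Fin C.d → ℕ) : MonoidAlgebra ℤ D.NbarEps :=
  orderedProd (fun i => MonoidAlgebra.of ℤ D.NbarEps (C.g i) - 1) α

/-- The Mahler coefficient of a function on `N̄₁`, on the coset `c` and for the index `α`. -/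
def mahlerCoeff (C : NormChoice D) (F : D.Nbar 1 → ℤ_[p]) (c : D.Nbar 1 ⧸ D.NbarEps)
    (α : Fin C.d → ℕ) : ℤ_[p] :=
  pairing (fun y : D.NbarEps => F (C.rep c * y)) (monomial C α)

open Classical in
theorem mahlerCoeff_basisFunAux (c c' : D.Nbar 1 ⧸ D.NbarEps) (α β : Fin C.d → ℕ) :
    mahlerCoeff C (Φ.basisFunAux c α) c' β = if (c, α) = (c', β) then 1 else 0 := by
  by_cases h : c = c'
  · subst h
    simp only [mahlerCoeff, basisFunAux_rep_mul, monomial]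
    rw [pairing_orderedProd_sub_one (Φ.binom_orderedProd α)]
    simp
  · have h1 : ∀ y : D.NbarEps, Φ.basisFunAux c α (C.rep c' * y) = 0 := fun y =>
      Φ.basisFunAux_eq_zero α (by rw [mk_rep_mul]; exact Ne.symm h)
    simp [mahlerCoeff, h1, pairing_zero, h]

theorem monomial_mem (α : Fin C.d → ℕ) :
    monomial C α ∈ augIdeal p (MonoidAlgebra.of ℤ D.NbarEps) ^ (∑ i, α i) :=
  orderedProd_mem (K := fun n => augIdeal p (MonoidAlgebra.of ℤ D.NbarEps) ^ n)
    (by simp [Submodule.one_eq_span, Submodule.mem_span_singleton_self])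
    (fun hx hy => mul_mem_augIdeal_pow hx hy)
    (fun i => by rw [pow_one]; exact sub_one_mem_augIdeal _ _) α

include Φ in
/-- A continuous function whose Mahler coefficients are small is small. -/
theorem norm_le_of_mahlerCoeff_le {F : D.Nbar 1 → ℤ_[p]} (hF : Continuous F) {δ : ℝ} (hδ : 0 ≤ δ)
    (h : ∀ c α, ‖mahlerCoeff C F c α‖ ≤ δ) (x : D.Nbar 1) : ‖F x‖ ≤ δ := by
  obtain ⟨c, y, rfl⟩ := exists_rep_mul (C := C) x
  -- By density it suffices to consider ordered products of powers with natural exponents; these are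
  -- integral combinations of the monomials.
  refine Φ.denseRange_orderedProd.induction_on (p := fun y : D.NbarEps => ‖F (C.rep c * y)‖ ≤ δ) y
    (isClosed_le (hF.comp (continuous_const.mul continuous_subtype_val)).norm continuous_const)
    fun m => ?_
  have h1 := of_orderedProd_mem_span C.g m
  rw [← pairing_of (fun y : D.NbarEps => F (C.rep c * y))]
  refine Submodule.span_induction
    (p := fun a _ => ‖pairing (fun y : D.NbarEps => F (C.rep c * y)) a‖ ≤ δ) ?_ ?_ ?_ ?_ h1
  · rintro _ ⟨α, rfl⟩
    exact h c α
  · rwa [map_zero, norm_zero]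
  · intro a b _ _ ha hb
    rw [map_add]
    exact (PadicInt.nonarchimedean _ _).trans (max_le ha hb)
  · intro z a _ ha
    rw [map_zsmul, zsmul_eq_mul, norm_mul]
    exact (mul_le_of_le_one_left (norm_nonneg _) (PadicInt.norm_le_one _)).trans ha

/-- Continuous functions are limits of the partial sums of their Mahler expansions: the coefficients
tend to zero, because high powers of the augmentation ideal are weakly small. -/
theorem exists_norm_sub_sum_le {F : D.Nbar 1 → ℤ_[p]} (hF : Continuous F) {δ : ℝ} (hδ : 0 < δ) :
    ∃ s : Finset ((D.Nbar 1 ⧸ D.NbarEps) × (Fin C.d → ℕ)), ∀ x,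
      ‖F x - ∑ i ∈ s, mahlerCoeff C F i.1 i.2 * Φ.basisFunAux i.1 i.2 x‖ ≤ δ := by
  classical
  obtain ⟨k, hk⟩ := PadicInt.exists_pow_neg_lt p hδ
  have hex : ∀ c, ∃ M, ∀ a ∈ augIdeal p (MonoidAlgebra.of ℤ D.NbarEps) ^ (M + 1),
      (p : ℤ_[p]) ^ k ∣ pairing (fun y : D.NbarEps => F (C.rep c * y)) a := fun c =>
    D.filtration.exists_pairing_eq_zero
      (hF.comp (continuous_const.mul continuous_subtype_val)) k
  choose M hM using hex
  have : Fintype (D.Nbar 1 ⧸ D.NbarEps) := Fintype.ofFinite _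
  let m := Finset.univ.sup M
  have hsmall : ∀ c α, m < ∑ i, α i → ‖mahlerCoeff C F c α‖ ≤ δ := by
    intro c α h
    refine le_trans ?_ hk.le
    rw [PadicInt.norm_le_pow_iff_mem_span_pow, Ideal.mem_span_singleton]
    refine hM c _ (augIdeal_pow_anti (Nat.le_add_left 1 _) ?_ (monomial_mem α))
    exact (Nat.succ_le_succ (Finset.le_sup (Finset.mem_univ c))).trans h
  have hfin : {α : Fin C.d → ℕ | ∑ i, α i ≤ m}.Finite :=
    (Set.finite_Iic fun _ : Fin C.d => m).subset fun α hα i =>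
      (Finset.single_le_sum (fun _ _ => Nat.zero_le _) (Finset.mem_univ i)).trans hα
  let s : Finset ((D.Nbar 1 ⧸ D.NbarEps) × (Fin C.d → ℕ)) := Finset.univ ×ˢ hfin.toFinset
  refine ⟨s, Φ.norm_le_of_mahlerCoeff_le (hF.sub (continuous_finsetSum _ fun i _ =>
    continuous_const.mul (Φ.continuous_basisFunAux i.1 i.2))) hδ.le fun c α => ?_⟩
  have h1 : mahlerCoeff C (fun x => F x -
      ∑ i ∈ s, mahlerCoeff C F i.1 i.2 * Φ.basisFunAux i.1 i.2 x) c α =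
      mahlerCoeff C F c α - if (c, α) ∈ s then mahlerCoeff C F c α else 0 := by
    rw [mahlerCoeff, pairing_sub (fun y : D.NbarEps => F (C.rep c * y)),
      pairing_sum_mul s (fun i => mahlerCoeff C F i.1 i.2)
        (fun i (y : D.NbarEps) => Φ.basisFunAux i.1 i.2 (C.rep c * y))]
    congr 1
    have h2 : ∀ i : (D.Nbar 1 ⧸ D.NbarEps) × (Fin C.d → ℕ),
        pairing (fun y : D.NbarEps => Φ.basisFunAux i.1 i.2 (C.rep c * y)) (monomial C α) =
          if i = (c, α) then 1 else 0 := fun i => Φ.mahlerCoeff_basisFunAux i.1 c i.2 α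
    simp only [h2, mul_ite, mul_one, mul_zero]
    rw [Finset.sum_ite_eq']
  refine (congrArg norm h1).trans_le ?_
  split_ifs with h
  · rw [sub_self, norm_zero]
    exact hδ.le
  · rw [sub_zero]
    refine hsmall c α (not_le.1 fun h' => h ?_)
    simp [s, h']

end Identifications

/-! ### Bounds for the action on distributions -/

namespace GroupDatum

variable {p : ℕ} [Fact p.Prime] (D : GroupDatum.{u} p)

theorem incl_injective : Function.Injective D.incl := by
  intro x y h
  funext v
  apply Points.ext_hom
  refine AlgHom.ext fun a => Subtype.ext ?_
  exact DFunLike.congr_fun (congrArg Points.hom (congrFun h v)) a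

theorem conjFun_mul {t : D.G} (ht : D.ConjMapsInto t 1) (x y : D.Nbar 1) :
    D.conjFun ht (x * y) = D.conjFun ht x * D.conjFun ht y := by
  refine Subtype.ext (D.incl_injective ?_)
  rw [D.incl_conjFun, Subgroup.coe_mul, map_mul, Subgroup.coe_mul, map_mul, D.incl_conjFun,
    D.incl_conjFun]
  group

/-- Conjugation by `t` on `N̄_ε`. -/
def conjHom {t : D.T} (ht : D.ConjMapsInto (t : D.G) 1) : D.NbarEps →* D.NbarEps where
  toFun x := ⟨D.conjFun ht x, D.conjFun_mem t.2 (j := 0) ht ht x.2⟩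
  map_one' := by
    refine Subtype.ext (mul_left_cancel (a := D.conjFun ht 1) ?_)
    change D.conjFun ht 1 * D.conjFun ht 1 = D.conjFun ht 1 * 1
    rw [← D.conjFun_mul, mul_one, mul_one]
  map_mul' x y := Subtype.ext (D.conjFun_mul ht x y)

/-- If conjugation by `t` maps `N̄₁` to `N̄₂`, its values on `N̄_ε` are `p`-th powers. -/
theorem exists_conjHom_eq_pow {t : D.T} (ht : D.ConjMapsInto (t : D.G) 2) (x : D.NbarEps) :
    ∃ u, D.conjHom (ht.mono one_le_two) x = u ^ p := by
  have h : D.conjHom (ht.mono one_le_two) x ∈ D.filtration.F (0 + 1) := by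
    rw [mem_filtration_iff]
    exact D.conjFun_mem t.2 (j := 1) ht (ht.mono one_le_two) x.2
  obtain ⟨u, -, hu⟩ := D.filtration.root h
  exact ⟨u, hu.symm⟩

end GroupDatum

namespace Identifications

variable {p : ℕ} [Fact p.Prime] {D : GroupDatum.{u} p} {R : Type v} [NormedCommRing R]
  {C : NormChoice D} {κ : D.T₀ →* Rˣ} (Φ : Identifications C κ)

/-- The image of the monomial `∏ i, ([g_i] - 1) ^ α_i` under conjugation by `t`. -/
def conjMonomial (C : NormChoice D) {t : D.T} (ht : D.ConjMapsInto (t : D.G) 1)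
    (α : Fin C.d → ℕ) : MonoidAlgebra ℤ D.NbarEps :=
  orderedProd (fun i => MonoidAlgebra.of ℤ D.NbarEps (D.conjHom ht (C.g i)) - 1) α

/-- The Mahler coefficients of the pullback of a basis function under conjugation are integrals of
binomial functions against translates of conjugated monomials. -/
theorem norm_mahlerCoeff_conj_le {t : D.T} (ht : D.ConjMapsInto (t : D.G) 1)
    (c c' : D.Nbar 1 ⧸ D.NbarEps) (α β : Fin C.d → ℕ) {B : ℝ} (hB : 0 ≤ B)
    (h : ∀ n, ‖pairing (Φ.binom β) (MonoidAlgebra.of ℤ D.NbarEps n * conjMonomial C ht α)‖ ≤ B) :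
    ‖mahlerCoeff C (fun x => Φ.basisFunAux c' β (D.conjFun ht x)) c α‖ ≤ B := by
  obtain ⟨c'', n, hn⟩ := exists_rep_mul (C := C) (D.conjFun ht (C.rep c))
  have hx : ∀ y : D.NbarEps, D.conjFun ht (C.rep c * y) =
      C.rep c'' * ((n * D.conjHom ht y : D.NbarEps) : D.Nbar 1) := by
    intro y
    rw [D.conjFun_mul, hn, Subgroup.coe_mul, mul_assoc]
    rfl
  rw [mahlerCoeff]
  simp only [hx]
  by_cases hc : c'' = c'
  · subst hc
    simp only [Φ.basisFunAux_rep_mul]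
    let φ : MonoidAlgebra ℤ D.NbarEps →ₐ[ℤ] MonoidAlgebra ℤ D.NbarEps :=
      MonoidAlgebra.lift ℤ _ _ ((MonoidAlgebra.of ℤ D.NbarEps).comp (D.conjHom ht))
    have hφ : ∀ x, φ (MonoidAlgebra.of ℤ D.NbarEps x) =
        MonoidAlgebra.of ℤ D.NbarEps (D.conjHom ht x) := fun x => by simp [φ]
    rw [pairing_comp (Φ.binom β) n (D.conjHom ht) φ.toRingHom hφ]
    have h1 : φ.toRingHom (monomial C α) = conjMonomial C ht α := by
      refine (map_orderedProd φ.toRingHom.toMonoidHom _ α).trans ?_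
      rw [conjMonomial]
      congr 1
      funext i
      change φ (_ - 1) = _
      rw [map_sub, map_one, hφ]
    rw [h1]
    exact h n
  · have h0 : ∀ y : D.NbarEps,
        Φ.basisFunAux c' β (C.rep c'' * ((n * D.conjHom ht y : D.NbarEps) : D.Nbar 1)) = 0 :=
      fun y => Φ.basisFunAux_eq_zero β (by rw [mk_rep_mul]; exact hc)
    simp only [h0]
    rw [pairing_zero, norm_zero]
    exact hB

theorem norm_pairing_conjMonomial_le {t : D.T} (ht : D.ConjMapsInto (t : D.G) 1)
    (r : Radius p) (α β : Fin C.d → ℕ) (n : D.NbarEps) :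
    (r : ℝ) ^ (∑ i, β i) *
      ‖pairing (Φ.binom β) (MonoidAlgebra.of ℤ D.NbarEps n * conjMonomial C ht α)‖ ≤
    (r : ℝ) ^ (∑ i, α i) := by
  refine D.filtration.norm_pairing_of_mul_le C.dense (Φ.continuous_binom β)
    (Φ.binom_orderedProd β) r.2.1 r.2.2.le n ?_
  exact orderedProd_mem (K := fun n => augIdeal p (MonoidAlgebra.of ℤ D.NbarEps) ^ n)
    (by simp [Submodule.one_eq_span, Submodule.mem_span_singleton_self])
    (fun hx hy => mul_mem_augIdeal_pow hx hy)
    (fun i => by rw [pow_one]; exact sub_one_mem_augIdeal _ _) α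

theorem root_pow (r : Radius p) : (r.root : ℝ) ^ p = r := by
  change ((r : ℝ) ^ ((p : ℝ)⁻¹)) ^ p = r
  exact Real.rpow_inv_natCast_pow r.nonneg (Fact.out : p.Prime).ne_zero

theorem norm_pairing_conjMonomial_root_le {t : D.T} (ht : D.ConjMapsInto (t : D.G) 2)
    (r : Radius p) (α β : Fin C.d → ℕ) (n : D.NbarEps) :
    (r.root : ℝ) ^ (∑ i, β i) * ‖pairing (Φ.binom β)
      (MonoidAlgebra.of ℤ D.NbarEps n * conjMonomial C (ht.mono one_le_two) α)‖ ≤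
    (r : ℝ) ^ (∑ i, α i) := by
  have h := D.filtration.norm_pairing_of_mul_le_of_mem_divIdeal C.dense (Φ.continuous_binom β)
    (Φ.binom_orderedProd β) (s := r.root) (by rw [root_pow]; exact r.2.1) r.root.nonneg
    r.root.2.2.le n (a := conjMonomial C (ht.mono one_le_two) α) (k := ∑ i, α i) ?_
  · rwa [pow_mul, root_pow] at h
  · refine orderedProd_mem one_mem_divIdeal mul_mem_divIdeal (fun i => ?_) α
    obtain ⟨u, hu⟩ := D.exists_conjHom_eq_pow ht (C.g i)
    rw [hu]
    exact pow_sub_one_mem_divIdeal Fact.out u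

variable [Algebra ℤ_[p] R] [IsBanachTateAlgebra p R]

/-- A `ℤ_p`-valued function, viewed as a function with values in `R`. -/
def mapToRing (R : Type v) [NormedCommRing R] [Algebra ℤ_[p] R] [IsBanachTateAlgebra p R]
    {F : D.Nbar 1 → ℤ_[p]} (hF : Continuous F) : C(D.Nbar 1, R) :=
  ⟨fun x => algebraMap ℤ_[p] R (F x), (continuous_algebraMap_padicInt p R).comp hF⟩

/-- By the Mahler expansion, the value of a functional at a function is bounded by its values at
the terms of the expansion. -/
theorem norm_apply_le (ν : C(D.Nbar 1, R) →L[R] R) {F : D.Nbar 1 → ℤ_[p]} (hF : Continuous F)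
    {B : ℝ} (hB : 0 ≤ B)
    (h : ∀ c α, ‖mahlerCoeff C F c α‖ * ‖ν (Φ.basisFun c α)‖ ≤ B) :
    ‖ν (mapToRing R hF)‖ ≤ B := by
  by_contra! hlt
  have hpos : 0 < ‖ν (mapToRing R hF)‖ := hB.trans_lt hlt
  obtain ⟨δ, hδ, hν⟩ := Metric.continuousAt_iff.1 (ν.continuous.continuousAt (x := 0)) _ hpos
  obtain ⟨s, hs⟩ := Φ.exists_norm_sub_sum_le hF (half_pos hδ)
  let S : C(D.Nbar 1, R) :=
    ∑ i ∈ s, algebraMap ℤ_[p] R (mahlerCoeff C F i.1 i.2) • Φ.basisFun i.1 i.2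
  have hsub : ∀ x, (mapToRing R hF - S) x = algebraMap ℤ_[p] R
      (F x - ∑ i ∈ s, mahlerCoeff C F i.1 i.2 * Φ.basisFunAux i.1 i.2 x) := by
    intro x
    rw [map_sub, map_sum]
    simp only [map_mul]
    simp only [S, ContinuousMap.sub_apply, ContinuousMap.sum_apply, ContinuousMap.smul_apply,
      smul_eq_mul]
    rfl
  have hnorm : ‖mapToRing R hF - S‖ ≤ δ / 2 := by
    rw [ContinuousMap.norm_le _ (half_pos hδ).le]
    intro x
    rw [hsub]
    exact (IsBanachTateAlgebra.norm_algebraMap_le _).trans (hs x)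
  have h1 : ‖ν (mapToRing R hF - S)‖ < ‖ν (mapToRing R hF)‖ := by
    have h2 := @hν (mapToRing R hF - S) (by
      rw [dist_zero_right]
      exact hnorm.trans_lt (half_lt_self hδ))
    rwa [map_zero, dist_zero_right] at h2
  have h2 : ‖ν S‖ < ‖ν (mapToRing R hF)‖ := by
    refine lt_of_le_of_lt ?_ hlt
    rw [map_sum]
    refine IsUltrametricDist.norm_sum_le_of_forall_le_of_nonneg hB fun i _ => ?_
    rw [map_smul, smul_eq_mul]
    refine (norm_mul_le _ _).trans ((mul_le_mul_of_nonneg_right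
      (IsBanachTateAlgebra.norm_algebraMap_le _) (norm_nonneg _)).trans (h i.1 i.2))
  have h3 := IsUltrametricDist.norm_add_le_max (ν (mapToRing R hF - S)) (ν S)
  rw [← map_add, sub_add_cancel] at h3
  exact absurd h3 (not_le.2 (max_lt h1 h2))

theorem norm_coeff_mul_le (r : Radius p) (μ : DKappa D κ) (c : D.Nbar 1 ⧸ D.NbarEps)
    (α : Fin C.d → ℕ) : ‖Φ.coeff μ c α‖ * (r : ℝ) ^ (∑ j, α j) ≤ Φ.rNorm r μ :=
  le_ciSup (Φ.bddAbove_coeff r μ) (c, α)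

theorem radius_pos (r : Radius p) : 0 < (r : ℝ) :=
  (inv_pos.2 (Nat.cast_pos.2 (Fact.out : p.Prime).pos)).trans_le r.2.1

/-- A bound for integrals of binomial functions against translates of conjugated monomials gives a
bound for the coefficients of the transformed distribution. -/
theorem rNorm_act_le_of_pairing_le {t : D.T} (ht : D.ConjMapsInto (t : D.G) 1) (r s : Radius p)
    (h : ∀ (α β : Fin C.d → ℕ) (n : D.NbarEps), (s : ℝ) ^ (∑ i, β i) *
      ‖pairing (Φ.binom β) (MonoidAlgebra.of ℤ D.NbarEps n * conjMonomial C ht α)‖ ≤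
      (r : ℝ) ^ (∑ i, α i)) (μ : DKappa D κ) :
    Φ.rNorm s (Φ.act ht μ) ≤ Φ.rNorm r μ := by
  refine Real.iSup_le (fun i => ?_) (apply_nonneg _ _)
  obtain ⟨c', β⟩ := i
  have hs : 0 < (s : ℝ) ^ (∑ i, β i) := pow_pos (radius_pos s) _
  let ν : C(D.Nbar 1, R) →L[R] R := μ.comp (Φ.res.symm : C(D.Nbar 1, R) →L[R] AKappa D κ)
  have hF : Continuous fun x => Φ.basisFunAux c' β (D.conjFun ht x) :=
    (Φ.continuous_basisFunAux c' β).comp (D.continuous_conjFun ht)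
  have hcoeff : Φ.coeff (Φ.act ht μ) c' β = ν (mapToRing R hF) := by
    change μ (Φ.res.symm (pullback R (D.conj ht) (Φ.res (Φ.res.symm (Φ.basisFun c' β))))) = _
    rw [ContinuousLinearEquiv.apply_symm_apply]
    rfl
  rw [← le_div_iff₀ hs, hcoeff]
  refine Φ.norm_apply_le ν hF (div_nonneg (apply_nonneg _ _) hs.le) fun c α => ?_
  have h1 := Φ.norm_mahlerCoeff_conj_le ht c c' α β
    (B := (r : ℝ) ^ (∑ i, α i) / (s : ℝ) ^ (∑ i, β i))
    (div_nonneg (pow_nonneg r.nonneg _) hs.le)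
    fun n => (le_div_iff₀' hs).2 (h α β n)
  refine (mul_le_mul_of_nonneg_right h1 (norm_nonneg _)).trans ?_
  rw [div_mul_eq_mul_div]
  refine div_le_div_of_nonneg_right ?_ hs.le
  rw [mul_comm]
  exact Φ.norm_coeff_mul_le r μ c α

/-- The action of `Σ⁺` is norm-decreasing. -/
theorem rNorm_act_le {t : D.T} (ht : D.ConjMapsInto (t : D.G) 1) (r : Radius p)
    (μ : DKappa D κ) : Φ.rNorm r (Φ.act ht μ) ≤ Φ.rNorm r μ :=
  Φ.rNorm_act_le_of_pairing_le ht r r (Φ.norm_pairing_conjMonomial_le ht r) μ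

/-- The action of `Σ^cpt` is norm-decreasing even for the larger radius `r ^ (1 / p)` on the
target. -/
theorem rNorm_root_act_le {t : D.T} (ht : D.ConjMapsInto (t : D.G) 2) (r : Radius p)
    (μ : DKappa D κ) :
    Φ.rNorm r.root (Φ.act (ht.mono one_le_two) μ) ≤ Φ.rNorm r μ :=
  Φ.rNorm_act_le_of_pairing_le _ r r.root (Φ.norm_pairing_conjMonomial_root_le ht r) μ

end Identifications

/-! ### Maps between the completions -/

theorem IsCompactMap.comp {R : Type*} [NormedCommRing R] {M M' N : Type*} [NormedAddCommGroup M]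
    [NormedAddCommGroup M'] [NormedAddCommGroup N] [Module R M] [Module R M'] [Module R N]
    {J : M' →L[R] N} (hJ : IsCompactMap J) {V : M →L[R] M'} (hV : ∀ x, ‖V x‖ ≤ ‖x‖) :
    IsCompactMap (J.comp V) := by
  intro δ hδ
  obtain ⟨ψ, ⟨P, hP, hψP⟩, hψ⟩ := hJ δ hδ
  exact ⟨ψ.comp V, ⟨P, hP, fun x => hψP (V x)⟩, fun x =>
    (hψ (V x)).trans (mul_le_mul_of_nonneg_left (hV x) hδ.le)⟩

namespace Identifications

variable {p : ℕ} [Fact p.Prime] {D : GroupDatum.{u} p} {R : Type v} [NormedCommRing R]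
  [Algebra ℤ_[p] R] [IsBanachTateAlgebra p R]
  {C : NormChoice D} {κ : D.T₀ →* Rˣ} (Φ : Identifications C κ)

theorem denseRange_toCompleted (r : Radius p) : DenseRange (Φ.toCompleted r) :=
  UniformSpace.Completion.denseRange_coe (α := Φ.NormedDKappa r)

theorem norm_toCompleted (r : Radius p) (μ : DKappa D κ) : ‖Φ.toCompleted r μ‖ = Φ.rNorm r μ :=
  UniformSpace.Completion.norm_coe (E := Φ.NormedDKappa r) μ

/-- Norm-decreasing maps extend to the completions. -/
theorem exists_extension (r s : Radius p) (f : DKappa D κ →ₗ[R] DKappa D κ)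
    (hf : ∀ μ, Φ.rNorm s (f μ) ≤ Φ.rNorm r μ) :
    ∃ L : Φ.Completed r →L[R] Φ.Completed s,
      (∀ μ, L (Φ.toCompleted r μ) = Φ.toCompleted s (f μ)) ∧ ∀ x, ‖L x‖ ≤ ‖x‖ := by
  let f' : Φ.NormedDKappa r →ₗ[R] Φ.NormedDKappa s := f
  have hf' : ∀ μ, ‖f' μ‖ ≤ 1 * ‖μ‖ := fun μ => by
    rw [one_mul]
    exact hf μ
  let F : Φ.NormedDKappa r →L[R] Φ.NormedDKappa s :=
    ⟨f', AddMonoidHomClass.continuous_of_bound f' 1 hf'⟩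
  have hF : ∀ μ, F.completion (Φ.toCompleted r μ) = Φ.toCompleted s (f μ) := fun μ =>
    F.completion_apply_coe μ
  refine ⟨F.completion, hF, fun x => ?_⟩
  refine (Φ.denseRange_toCompleted r).induction_on (p := fun x => ‖F.completion x‖ ≤ ‖x‖) x
    (isClosed_le F.completion.continuous.norm continuous_norm) fun μ => ?_
  rw [hF, norm_toCompleted, norm_toCompleted]
  exact hf μ

/-- By its definition, the norm bounds each coefficient; so the coefficients extend continuously to
the completion. -/
theorem exists_coeff_extension (r : Radius p) (c : D.Nbar 1 ⧸ D.NbarEps) (α : Fin C.d → ℕ) :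
    ∃ L : Φ.Completed r →L[R] R, (∀ μ, L (Φ.toCompleted r μ) = Φ.coeff μ c α) ∧
      ∀ x, ‖L x‖ * (r : ℝ) ^ (∑ j, α j) ≤ ‖x‖ := by
  have hr : 0 < (r : ℝ) ^ (∑ j, α j) := pow_pos (radius_pos r) _
  let f : Φ.NormedDKappa r →ₗ[R] R :=
    { toFun := fun μ => Φ.coeff μ c α
      map_add' := fun _ _ => rfl
      map_smul' := fun _ _ => rfl }
  have hf : ∀ μ, ‖f μ‖ ≤ ((r : ℝ) ^ (∑ j, α j))⁻¹ * ‖μ‖ := fun μ => by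
    rw [inv_mul_eq_div, le_div_iff₀ hr]
    exact Φ.norm_coeff_mul_le r μ c α
  let F : Φ.NormedDKappa r →L[R] R := ⟨f, AddMonoidHomClass.continuous_of_bound f _ hf⟩
  have hF : ∀ μ, F.fromCompletion (Φ.toCompleted r μ) = Φ.coeff μ c α := fun μ =>
    F.fromCompletion_apply_coe μ
  refine ⟨F.fromCompletion, hF, fun x => ?_⟩
  refine (Φ.denseRange_toCompleted r).induction_on
    (p := fun x => ‖F.fromCompletion x‖ * (r : ℝ) ^ (∑ j, α j) ≤ ‖x‖) x
    (isClosed_le (F.fromCompletion.continuous.norm.mul continuous_const) continuous_norm)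
    fun μ => ?_
  rw [hF, norm_toCompleted]
  exact Φ.norm_coeff_mul_le r μ c α

/-- The coefficient `d_{c,α}`, as a functional on the completion. -/
def coeffCLM (r : Radius p) (c : D.Nbar 1 ⧸ D.NbarEps) (α : Fin C.d → ℕ) :
    Φ.Completed r →L[R] R := (Φ.exists_coeff_extension r c α).choose

theorem coeffCLM_toCompleted (r : Radius p) (c : D.Nbar 1 ⧸ D.NbarEps) (α : Fin C.d → ℕ)
    (μ : DKappa D κ) : Φ.coeffCLM r c α (Φ.toCompleted r μ) = Φ.coeff μ c α :=
  (Φ.exists_coeff_extension r c α).choose_spec.1 μ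

theorem norm_coeffCLM_mul_le (r : Radius p) (c : D.Nbar 1 ⧸ D.NbarEps) (α : Fin C.d → ℕ)
    (x : Φ.Completed r) : ‖Φ.coeffCLM r c α x‖ * (r : ℝ) ^ (∑ j, α j) ≤ ‖x‖ :=
  (Φ.exists_coeff_extension r c α).choose_spec.2 x

/-- An element of the completion is determined by its coefficients. -/
theorem eq_zero_of_coeffCLM (r : Radius p) {x : Φ.Completed r}
    (hx : ∀ c α, Φ.coeffCLM r c α x = 0) : x = 0 := by
  refine norm_le_zero_iff.1 (le_of_forall_pos_le_add fun δ hδ => ?_)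
  obtain ⟨μ, hμ⟩ := (Φ.denseRange_toCompleted r).exists_dist_lt x (half_pos hδ)
  rw [dist_eq_norm] at hμ
  have h : Φ.rNorm r μ ≤ δ / 2 := by
    refine Real.iSup_le (fun i => ?_) (half_pos hδ).le
    have h1 := Φ.norm_coeffCLM_mul_le r i.1 i.2 (x - Φ.toCompleted r μ)
    rw [map_sub, hx, zero_sub, norm_neg, coeffCLM_toCompleted] at h1
    exact h1.trans hμ.le
  rw [← norm_toCompleted] at h
  have h2 := norm_add_le (x - Φ.toCompleted r μ) (Φ.toCompleted r μ)
  rw [sub_add_cancel] at h2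
  linarith

theorem rNorm_mono {r s : Radius p} (h : (r : ℝ) ≤ s) (μ : DKappa D κ) :
    Φ.rNorm r μ ≤ Φ.rNorm s μ := by
  refine Real.iSup_le (fun i => ?_) (apply_nonneg _ _)
  exact (mul_le_mul_of_nonneg_left (pow_le_pow_left₀ r.nonneg h _) (norm_nonneg _)).trans
    (Φ.norm_coeff_mul_le s μ i.1 i.2)

/-- Integration against the translate of an element of the group ring is a continuous functional. -/
theorem exists_functional (c : D.Nbar 1 ⧸ D.NbarEps) (a : MonoidAlgebra ℤ D.NbarEps) :
    ∃ ν : C(D.Nbar 1, R) →L[R] R, ∀ f : C(D.Nbar 1, R),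
      ν f = pairing (fun y : D.NbarEps => f (C.rep c * y)) a := by
  refine MonoidAlgebra.induction_on (motive := fun a : MonoidAlgebra ℤ D.NbarEps =>
    ∃ ν : C(D.Nbar 1, R) →L[R] R, ∀ f : C(D.Nbar 1, R),
      ν f = pairing (fun y : D.NbarEps => f (C.rep c * y)) a) a ?_ ?_ ?_
  · intro y
    refine ⟨ContinuousMap.evalCLM R (C.rep c * (y : D.Nbar 1)), fun f => ?_⟩
    rw [pairing_of]
    rfl
  · rintro a b ⟨ν, hν⟩ ⟨ν', hν'⟩
    exact ⟨ν + ν', fun f => by rw [map_add, ← hν, ← hν']; rfl⟩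
  · rintro z a ⟨ν, hν⟩
    exact ⟨z • ν, fun f => by rw [map_zsmul, ← hν]; rfl⟩

open Classical in
/-- The distribution `[h_c] ∏ i, ([g_i] - 1) ^ α_i`: its only nonzero coefficient is `d_{c,α}`. -/
theorem exists_coeff_eq_ite (c : D.Nbar 1 ⧸ D.NbarEps) (α : Fin C.d → ℕ) :
    ∃ μ : DKappa D κ, ∀ c' β, Φ.coeff μ c' β = if (c', β) = (c, α) then 1 else 0 := by
  obtain ⟨ν, hν⟩ := exists_functional (R := R) c (monomial C α)
  refine ⟨ν.comp (Φ.res : AKappa D κ →L[R] C(D.Nbar 1, R)), fun c' β => ?_⟩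
  change ν (Φ.res (Φ.res.symm (Φ.basisFun c' β))) = _
  rw [ContinuousLinearEquiv.apply_symm_apply, hν]
  have h := map_pairing (algebraMap ℤ_[p] R).toAddMonoidHom
    (fun y : D.NbarEps => Φ.basisFunAux c' β (C.rep c * y)) (monomial C α)
  refine h.symm.trans ?_
  change algebraMap ℤ_[p] R (mahlerCoeff C (Φ.basisFunAux c' β) c α) = _
  rw [mahlerCoeff_basisFunAux]
  split_ifs <;> simp

/-- The elements of a line in the completion, as a continuous function of the coordinate. -/
theorem continuous_smul_toCompleted (r : Radius p) (μ : DKappa D κ) :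
    Continuous fun a : R => a • Φ.toCompleted r μ := by
  have h : ∀ a : R, ‖(LinearMap.toSpanSingleton R (Φ.Completed r) (Φ.toCompleted r μ)) a‖ ≤
      Φ.rNorm r μ * ‖a‖ := fun a => by
    rw [LinearMap.toSpanSingleton_apply, ← map_smul, norm_toCompleted, mul_comm]
    exact Φ.rNorm_smul_le r a μ
  exact AddMonoidHomClass.continuous_of_bound
    (LinearMap.toSpanSingleton R (Φ.Completed r) (Φ.toCompleted r μ)) _ h

theorem le_root (r : Radius p) : (r : ℝ) ≤ r.root := by
  conv_lhs => rw [← root_pow r]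
  exact pow_le_of_le_one r.root.nonneg r.root.2.2.le (Fact.out : p.Prime).ne_zero

/-- Truncation of the expansions approximates the identity, as a map from the completion for the
radius `r ^ (1 / p)` to the completion for the radius `r`. -/
theorem isCompactMap_of_toCompleted {r : Radius p} {J : Φ.Completed r.root →L[R] Φ.Completed r}
    (hJ : ∀ μ, J (Φ.toCompleted r.root μ) = Φ.toCompleted r μ) : IsCompactMap J := by
  classical
  intro δ hδ
  have hlt : (r.root : ℝ) < 1 := r.root.2.2
  -- For `|α| ≥ M`, the weight `r ^ |α|` is at most `δ * (r ^ (1 / p)) ^ |α|`.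
  obtain ⟨M, hM⟩ := exists_pow_lt_of_lt_one hδ hlt
  choose e he using fun i : (D.Nbar 1 ⧸ D.NbarEps) × (Fin C.d → ℕ) =>
    Φ.exists_coeff_eq_ite i.1 i.2
  have : Fintype (D.Nbar 1 ⧸ D.NbarEps) := Fintype.ofFinite _
  have hfin : {α : Fin C.d → ℕ | ∑ i, α i ≤ M}.Finite :=
    (Set.finite_Iic fun _ : Fin C.d => M).subset fun α hα i =>
      (Finset.single_le_sum (fun _ _ => Nat.zero_le _) (Finset.mem_univ i)).trans hα
  let s : Finset ((D.Nbar 1 ⧸ D.NbarEps) × (Fin C.d → ℕ)) := Finset.univ ×ˢ hfin.toFinset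
  let line : (D.Nbar 1 ⧸ D.NbarEps) × (Fin C.d → ℕ) → R →L[R] Φ.Completed r := fun i =>
    ⟨LinearMap.toSpanSingleton R (Φ.Completed r) (Φ.toCompleted r (e i)),
      Φ.continuous_smul_toCompleted r (e i)⟩
  let ψ : Φ.Completed r.root →L[R] Φ.Completed r :=
    ∑ i ∈ s, (line i).comp (Φ.coeffCLM r.root i.1 i.2)
  have hψ : ∀ x, ψ x = ∑ i ∈ s, Φ.coeffCLM r.root i.1 i.2 x • Φ.toCompleted r (e i) := by
    intro x
    simp only [ψ, sum_apply]
    rfl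
  refine ⟨ψ, ⟨Submodule.span R (s.image fun i => Φ.toCompleted r (e i)),
    ⟨_, rfl⟩, fun x => ?_⟩, fun x => ?_⟩
  · rw [hψ]
    exact Submodule.sum_mem _ fun i hi => Submodule.smul_mem _ _
      (Submodule.subset_span (Finset.mem_coe.2 (Finset.mem_image_of_mem _ hi)))
  refine (Φ.denseRange_toCompleted r.root).induction_on (p := fun x => ‖J x - ψ x‖ ≤ δ * ‖x‖) x
    (isClosed_le (J.continuous.sub ψ.continuous).norm (continuous_const.mul continuous_norm))
    fun μ => ?_
  have h1 : J (Φ.toCompleted r.root μ) - ψ (Φ.toCompleted r.root μ) =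
      Φ.toCompleted r (μ - ∑ i ∈ s, Φ.coeff μ i.1 i.2 • e i) := by
    rw [hJ, hψ, map_sub, map_sum]
    simp only [coeffCLM_toCompleted, map_smul]
  rw [h1, norm_toCompleted, norm_toCompleted]
  refine Real.iSup_le (fun i => ?_) (mul_nonneg hδ.le (apply_nonneg _ _))
  have h2 : Φ.coeff (μ - ∑ j ∈ s, Φ.coeff μ j.1 j.2 • e j) i.1 i.2 =
      if i ∈ s then 0 else Φ.coeff μ i.1 i.2 := by
    have h3 : Φ.coeff (μ - ∑ j ∈ s, Φ.coeff μ j.1 j.2 • e j) i.1 i.2 =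
        Φ.coeff μ i.1 i.2 - ∑ j ∈ s, Φ.coeff μ j.1 j.2 * Φ.coeff (e j) i.1 i.2 := by
      simp only [← Φ.coeffCLM_toCompleted r, map_sub, map_sum, map_smul, smul_eq_mul]
    rw [h3]
    simp only [he, mul_ite, mul_one, mul_zero]
    rw [Finset.sum_ite_eq]
    split_ifs <;> simp
  rw [h2]
  split_ifs with hi
  · rw [norm_zero, zero_mul]
    exact mul_nonneg hδ.le (apply_nonneg _ _)
  · have hi' : M ≤ ∑ j, i.2 j := by
      by_contra! h
      exact hi (by simp [s, h.le])
    have hroot := r.root.nonneg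
    calc ‖Φ.coeff μ i.1 i.2‖ * (r : ℝ) ^ (∑ j, i.2 j)
        ≤ ‖Φ.coeff μ i.1 i.2‖ * ((r.root : ℝ) ^ (∑ j, i.2 j) * (r.root : ℝ) ^ M) := by
          refine mul_le_mul_of_nonneg_left ?_ (norm_nonneg _)
          conv_lhs => rw [← root_pow r]
          rw [← pow_mul, ← pow_add]
          have h2 := Nat.mul_le_mul_right (∑ j, i.2 j) (Fact.out : p.Prime).two_le
          exact pow_le_pow_of_le_one hroot hlt.le (by omega)
      _ = (r.root : ℝ) ^ M * (‖Φ.coeff μ i.1 i.2‖ * (r.root : ℝ) ^ (∑ j, i.2 j)) := by ring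
      _ ≤ δ * Φ.rNorm r.root μ :=
          mul_le_mul hM.le (Φ.norm_coeff_mul_le _ _ _ _) (by positivity) hδ.le

/-- Maps that extend the identity preserve the coefficients, hence are injective. -/
theorem injective_of_toCompleted {r s : Radius p} {J : Φ.Completed s →L[R] Φ.Completed r}
    (hJ : ∀ μ, J (Φ.toCompleted s μ) = Φ.toCompleted r μ) : Function.Injective J := by
  refine (injective_iff_map_eq_zero J).2 fun x hx => Φ.eq_zero_of_coeffCLM s fun c α => ?_
  have h : ∀ y, Φ.coeffCLM s c α y = Φ.coeffCLM r c α (J y) := fun y =>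
    (Φ.denseRange_toCompleted s).induction_on y
      (isClosed_eq (Φ.coeffCLM s c α).continuous
        ((Φ.coeffCLM r c α).continuous.comp J.continuous))
      fun μ => by rw [hJ, coeffCLM_toCompleted, coeffCLM_toCompleted]
  rw [h, hx, map_zero]

theorem existsUnique_extension_act {t : D.T} (ht : D.ConjMapsInto (t : D.G) 1) (r : Radius p) :
    ∃! τ : Φ.Completed r →L[R] Φ.Completed r,
      ∀ μ : DKappa D κ, τ (Φ.toCompleted r μ) = Φ.toCompleted r (Φ.act ht μ) := by
  obtain ⟨τ, hτ, -⟩ := Φ.exists_extension r r (Φ.act ht) (Φ.rNorm_act_le ht r)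
  refine ⟨τ, hτ, fun τ' hτ' => ContinuousLinearMap.coeFn_injective ?_⟩
  refine (Φ.denseRange_toCompleted r).equalizer τ'.continuous τ.continuous ?_
  funext μ
  exact (hτ' μ).trans (hτ μ).symm

theorem exists_inclusion (r : Radius p) : ∃ J : Φ.Completed r.root →L[R] Φ.Completed r,
    (∀ μ, J (Φ.toCompleted r.root μ) = Φ.toCompleted r μ) ∧ ∀ x, ‖J x‖ ≤ ‖x‖ :=
  Φ.exists_extension r.root r LinearMap.id (Φ.rNorm_mono (le_root r))

/-- The action of `Σ^cpt` on a completion factors through the completion for the larger radius. -/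
theorem exists_compact_extension_act {r : Radius p} {J : Φ.Completed r.root →L[R] Φ.Completed r}
    (hJ : ∀ μ, J (Φ.toCompleted r.root μ) = Φ.toCompleted r μ) {t : D.T}
    (ht : D.ConjMapsInto (t : D.G) 2) :
    ∃ τ : Φ.Completed r →L[R] Φ.Completed r,
      (∀ μ : DKappa D κ, τ (Φ.toCompleted r μ) =
        Φ.toCompleted r (Φ.act (ht.mono one_le_two) μ)) ∧
      IsCompactMap τ ∧
      ∃ V : Φ.Completed r →L[R] Φ.Completed r.root,
        (∀ x, ‖V x‖ ≤ ‖x‖) ∧ ∀ x, τ x = J (V x) := by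
  obtain ⟨V, hV, hVn⟩ := Φ.exists_extension r r.root (Φ.act (ht.mono one_le_two))
    (Φ.rNorm_root_act_le ht r)
  refine ⟨J.comp V, fun μ => ?_, (Φ.isCompactMap_of_toCompleted hJ).comp hVn, V, hVn,
    fun _ => rfl⟩
  exact (congrArg J (hV μ)).trans (hJ _)

end Identifications

end OverconvergentDistributions

end

set_option maxHeartbeats 400000 in
theorem mainTheorem8 (p : ℕ) [Fact p.Prime] (D : GroupDatum.{u} p)
    (σ : D.T →* D.T₀)
    (hσ : ∀ (t : D.T) (t₀ : D.T₀), (t : D.G) = D.incl t₀ → σ t = t₀)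
    (R : Type v) [NormedCommRing R] [Algebra ℤ_[p] R] [IsBanachTateAlgebra p R]
    (κ : D.T₀ →* Rˣ) (hκ : Continuous κ) (hadapted : IsAdapted D κ)
    (C : NormChoice D) :
    ∃ Φ : Identifications C κ, ∀ r : Radius p, rMin D κ ≤ r →
      (∀ (t : D.T) (ht : t ∈ D.SigmaPlus σ),
        (∀ μ : DKappa D κ, Φ.rNorm r (Φ.act ht.2 μ) ≤ Φ.rNorm r μ) ∧
        ∃! τ : Φ.Completed r →L[R] Φ.Completed r,
          ∀ μ : DKappa D κ, τ (Φ.toCompleted r μ) = Φ.toCompleted r (Φ.act ht.2 μ)) ∧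
      ∃ J : Φ.Completed r.root →L[R] Φ.Completed r,
        (∀ μ : DKappa D κ, J (Φ.toCompleted r.root μ) = Φ.toCompleted r μ) ∧
        Function.Injective J ∧ (∀ x, ‖J x‖ ≤ ‖x‖) ∧ IsCompactMap J ∧
        ∀ (t : D.T) (ht : t ∈ D.SigmaCpt σ),
          ∃ τ : Φ.Completed r →L[R] Φ.Completed r,
            (∀ μ : DKappa D κ, τ (Φ.toCompleted r μ) =
              Φ.toCompleted r (Φ.act (ht.2.mono one_le_two) μ)) ∧
            IsCompactMap τ ∧
            ∃ V : Φ.Completed r →L[R] Φ.Completed r.root,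
              (∀ x, ‖V x‖ ≤ ‖x‖) ∧ ∀ x, τ x = J (V x) := by
  obtain ⟨coord, hcoord⟩ := D.filtration.exists_homeomorph C.dense C.minimal
  obtain ⟨Φ⟩ : Nonempty (Identifications C κ) :=
    ⟨coord, hcoord, restriction κ hκ, fun _ _ => rfl⟩
  refine ⟨Φ, fun r _ => ⟨fun t ht => ?_, ?_⟩⟩
  · have h : D.ConjMapsInto (t : D.G) 1 := ht.2
    exact ⟨Φ.rNorm_act_le h r, Φ.existsUnique_extension_act h r⟩
  · obtain ⟨J, hJ, hJn⟩ := Φ.exists_inclusion r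
    refine ⟨J, hJ, Φ.injective_of_toCompleted hJ, hJn, Φ.isCompactMap_of_toCompleted hJ,
      fun t ht => ?_⟩
    have h : D.ConjMapsInto (t : D.G) 2 := ht.2
    exact Φ.exists_compact_extension_act hJ h
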